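/- **Conventions.** Let $R$ be a weakly finite unital ring with involution $x\mapsto\bar x$, let $\varepsilon=\pm1$, and let $Z\subseteq\widetilde K_1(R)$ be a subgroup invariant under the involution $[A]\mapsto[A^*]$. A *based module* is a finitely generated stably free left $R$-module $M$ with an $s$-basis (a basis of some $M\oplus R^m$), taken up to changes of basis with torsion in $Z$; an isomorphism of based modules is *simple* if its torsion lies in $Z$. Put $M^*=\operatorname{Hom}_R(M,R)$ with $(r\varphi)(x)=\varphi(x)\bar r$ and the dual $s$-basis, identify $M^{**}=M$, and let $Q_\varepsilon(M)=\operatorname{coker}(1-\varepsilon T)$ on $\operatorname{Hom}_R(M,M^*)$, where $T\phi=\phi^*$. An *$\varepsilon$-quadratic form* is a pair $v=(V,\theta)$ with $V$ based and $\theta\in Q_\varepsilon(V)$; its symmetrisation is $\lambda=\theta+\varepsilon\theta^*$, and $-v=(V,-\theta)$. The form is *nonsingular* (*simple*) if $\lambda$ is an isomorphism (a simple isomorphism). All isometries are simple. **Boundary isomorphisms.** A split $(-\varepsilon)$-quadratic formation $(F,\binom{\gamma}{\delta}(G,\theta))$ has $\gamma:G\to F$, $\delta:G\to F^*$, $\theta\in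 Q_\varepsilon(G)$. We use $\partial v=(V,\binom1\lambda(V,\theta))$, the trivial formations $(P,P^*)=(P,\binom01(P^*,0))$, and their direct sums. An *isomorphism* $(\alpha,\beta,\nu)$ of formations consists of simple isomorphisms $\alpha:F_1\to F_2$, $\beta:G_1\to G_2$ and $\nu\in Q_\varepsilon(F_1^*)$ with $$\theta_1+\delta_1^*\nu\delta_1=\beta^*\theta_2\beta\in Q_\varepsilon(G_1),\qquad \alpha\gamma_1+\alpha(\nu+\varepsilon\nu^*)^*\delta_1=\gamma_2\beta,\qquad \alpha^{-*}\delta_1=\delta_2\beta.$$ Composition is $(\alpha',\beta',\nu')\circ(\alpha,\beta,\nu)=(\alpha'\alpha,\beta'\beta,\nu+\alpha^{-1}\nu'\alpha^{-*})$. A *homotopy* from $(\alpha,\beta,\nu)$ to $(\alpha',\beta',\nu')$ is a linear map $\Delta:G_1^*\to F_2$ with $$\beta'^{-*}-\beta^{-*}=\delta_2^*\Delta,\qquad \alpha'-\alpha=\Delta\delta_1^*,\qquad \alpha'\nu'\alpha'^*-\alpha\nu\alpha^*=(-\varepsilon\alpha'\gamma_1+\Delta\theta_1)\Delta^*\in Q_\varepsilon(F_2^*).$$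 A *stable isomorphism* $f:\partial v\to\partial v'$ is an isomorphism $\partial v\oplus(P,P^*)\to\partial v'\oplus(P',P'^*)$ with $P,P'$ based. Two stable isomorphisms are *stably homotopic* if they become homotopic after adding identities of trivial formations and composing with isomorphisms of trivial formations on both sides. $\operatorname{Iso}(\partial v,\partial v')$ is the set of stable homotopy classes. For an isometry $h$ put $\partial h=(h,h,0)$. The group $\operatorname{Aut}(v)\times\operatorname{Aut}(v')$ acts by $(g,h)\cdot[f]=[\partial h\circ f\circ\partial g^{-1}]$; the quotients by $\operatorname{Aut}(v)$, $\operatorname{Aut}(v')$ and $\operatorname{Aut}(v)\times\operatorname{Aut}(v')$ are $\operatorname{lIso}$, $\operatorname{rIso}$ and $\operatorname{bIso}$. Let $a$, $b$, $s$ be the upper left entries of $\alpha$, $\beta^{-1}$, $\alpha\nu\alpha^*$. The *union* is $$v\cup_f-v'=\left(V\oplus V'^*,\begin{pmatrix}\theta&0\\\varepsilon a&-s\end{pmatrix}\right).$$ $\operatorname{Iso}_m(\partial v,\partial v')$ is the set of $[f]$ with $v\cup_f-v'\cong m$, and $\operatorname{lIso}_m,\operatorname{rIso}_m,\operatorname{bIso}_m$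 are its quotients. **Primitive embeddings.** A *2-sided primitive embedding* $v\xrightarrow{j}m\xleftarrow{j'}w$ consists of split isometric injections into a simple form $m=(M,\psi)$ with $j(V)^\perp=j'(W)$ as based modules: with $\phi$ the symmetrisation of $m$, the sequence $0\to V\xrightarrow{j}M\xrightarrow{j'^*\phi}W^*\to0$ is split by a simple isomorphism $V\oplus W^*\cong M$. Two such embeddings of $v,w$ into $m_0,m_1$ are isomorphic if an isometry $m_0\to m_1$ carries one pair of maps to the other. $\operatorname{Prim}_m(v,w)$ is the set of isomorphism classes for a fixed $m$, and $\operatorname{Prim}(v,w)$ the set of isomorphism classes for varying $m$, that is, the disjoint union of the $\operatorname{Prim}_m(v,w)$ over isometry classes $[m]$. The group $\operatorname{Aut}(v)\times\operatorname{Aut}(w)$ acts by $(g,h)\cdot[(j,j')]=[(jg^{-1},j'h^{-1})]$; the quotients by $\operatorname{Aut}(v)$, $\operatorname{Aut}(w)$ and the product are denoted by the prefixes $\operatorname{l}$, $\operatorname{r}$, $\operatorname{b}$. **The construction of $f_j$.** Given a 2-sided primitive embedding $(j,j')$ of $v$, $-v'$ into $m=(M,\psi)$, let $v^\perp=(V^\perp,\theta^\perp)$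 be the restriction of $m$ to $V^\perp=j(V)^\perp$ (based via $j'$), $j^\perp:V^\perp\to M$ the inclusion, $\sigma:(V^\perp)^*\to M$ a section of $j^{\perp*}\phi$, and $(M',\psi')=H_\varepsilon(V^\perp)=(V^\perp\oplus(V^\perp)^*,\begin{pmatrix}0&1\\0&0\end{pmatrix})$ with symmetrisation $\phi'$. Put $$h=\begin{pmatrix}1&0&0\\j^\perp&\sigma&j\end{pmatrix}\begin{pmatrix}-\sigma^*\phi^*j&1&-\sigma^*\psi^*\sigma\\0&0&1\\1&0&0\end{pmatrix}:V\oplus M'\to V^\perp\oplus M,$$ $$f_j=\bigl(1\oplus(1,\phi,-\phi^{-*}\psi\phi^{-1})\bigr)\circ(h,h,0)\circ\bigl(1\oplus(1,\phi'^{-1},\phi'^{-*}\psi'\phi'^{-1})\bigr):\ \partial v\oplus(M',M'^*)\to\partial(-v^\perp)\oplus(M,M^*).$$ **Theorem.** Let $v=(V,\theta)$, $v'=(V',\theta')$ and $m$ be $\varepsilon$-quadratic forms, with $m$ nonsingular, and let $\lambda'$ be the symmetrisation of $v'$. 1. There is a well-defined map $\operatorname{Pr}:\operatorname{Iso}_m(\partial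 v,\partial v')\to\operatorname{Prim}_m(v,-v')$ that sends $[f]$ to the class of $\bigl(k\circ\binom10,\ k\circ\binom{b}{-\lambda'}\bigr)$, for any representative $f$ and any isometry $k:v\cup_f-v'\to m$. 2. There is a well-defined map $\delta:\operatorname{Prim}_m(v,-v')\to\operatorname{Iso}_m(\partial v,\partial v')$ that sends $[(j,j')]$ to $[(\partial j'^{-1}\oplus1)\circ f_j]$, for every choice of $\sigma$ and of a representative of $\psi$; here $j'^{-1}:-v^\perp\to v'$. 3. The maps $\operatorname{Pr}$ and $\delta$ descend to mutually inverse bijections $$\operatorname{lIso}_m(\partial v,\partial v')\leftrightarrow\operatorname{lPrim}_m(v,-v'),\quad \operatorname{rIso}_m(\partial v,\partial v')\leftrightarrow\operatorname{rPrim}_m(v,-v'),\quad \operatorname{bIso}_m(\partial v,\partial v')\leftrightarrow\operatorname{bPrim}_m(v,-v').$$ The same statements hold with the subscript $m$ removed, where $\operatorname{Pr}$ sends $[f]$ to the class of $v\xrightarrow{\binom10}v\cup_f-v'\xleftarrow{\binom{b}{-\lambda'}}-v'$ and $\delta$ is given by the same formula. -/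

import Mathlib

universe u

noncomputable section

namespace PrimEmb

/-! ## Duals of left modules over a ring with involution -/

section Duals

/-- The dual `M^*` of a left module over a ring with involution `x ↦ star x`: the additive group of
left-linear maps `M → R`, with the left action `(r • φ) x = φ x * star r`. -/
def CDual (R M : Type*) [Ring R] [AddCommGroup M] [Module R M] := M →ₗ[R] R

variable {R : Type*} [Ring R] {M N L : Type*} [AddCommGroup M] [Module R M]
  [AddCommGroup N] [Module R N] [AddCommGroup L] [Module R L]

instance : AddCommGroup (CDual R M) := inferInstanceAs (AddCommGroup (M →ₗ[R] R))
instance : FunLike (CDual R M) M R := inferInstanceAs (FunLike (M →ₗ[R] R) M R)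
instance : LinearMapClass (CDual R M) R M R :=
  inferInstanceAs (LinearMapClass (M →ₗ[R] R) R M R)

theorem CDual.ext {f g : CDual R M} (h : ∀ x, f x = g x) : f = g := LinearMap.ext h

@[simp] theorem CDual.add_apply (f g : CDual R M) (x : M) : (f + g) x = f x + g x := rfl
@[simp] theorem CDual.neg_apply (f : CDual R M) (x : M) : (-f) x = -f x := rfl
@[simp] theorem CDual.sub_apply (f g : CDual R M) (x : M) : (f - g) x = f x - g x := rfl
@[simp] theorem CDual.zero_apply (x : M) : (0 : CDual R M) x = 0 := rfl

/-- A linear functional, seen as an element of the dual. -/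
def CDual.of (f : M →ₗ[R] R) : CDual R M := f

@[simp] theorem CDual.of_apply (f : M →ₗ[R] R) (x : M) : CDual.of f x = f x := rfl

variable [StarRing R]

instance : SMul R (CDual R M) where
  smul r f := CDual.of
    { toFun := fun x => f x * star r
      map_add' := fun x y => by simp [add_mul]
      map_smul' := fun c x => by simp [mul_assoc] }

@[simp] theorem CDual.smul_apply (r : R) (f : CDual R M) (x : M) :
    (r • f) x = f x * star r := rfl

instance : Module R (CDual R M) where
  one_smul f := CDual.ext fun x => by simp
  mul_smul r s f := CDual.ext fun x => by simp [mul_assoc]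
  smul_zero r := CDual.ext fun x => by simp
  smul_add r f g := CDual.ext fun x => by simp [add_mul]
  add_smul r s f := CDual.ext fun x => by simp [mul_add]
  zero_smul f := CDual.ext fun x => by simp

/-- The dual `f^* : N^* → M^*` of a linear map `f : M → N`. -/
def dualMap (f : M →ₗ[R] N) : CDual R N →ₗ[R] CDual R M where
  toFun φ := CDual.of
    { toFun := fun x => φ (f x)
      map_add' := fun x y => by simp
      map_smul' := fun c x => by simp }
  map_add' φ ψ := CDual.ext fun x => by simp
  map_smul' c φ := CDual.ext fun x => by simp

@[simp] theorem dualMap_apply (f : M →ₗ[R] N) (φ : CDual R N) (x : M) :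
    dualMap f φ x = φ (f x) := rfl

/-- The dual of a linear equivalence. -/
def dualEquiv (e : M ≃ₗ[R] N) : CDual R N ≃ₗ[R] CDual R M where
  toLinearMap := dualMap e.toLinearMap
  invFun := dualMap e.symm.toLinearMap
  left_inv φ := CDual.ext fun x => by simp
  right_inv φ := CDual.ext fun x => by simp

/-- The evaluation map `M → M^**`, `x ↦ (φ ↦ star (φ x))`. -/
def ev (R M : Type*) [Ring R] [StarRing R] [AddCommGroup M] [Module R M] :
    M →ₗ[R] CDual R (CDual R M) where
  toFun x := CDual.of
    { toFun := fun φ => star (φ x)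
      map_add' := fun φ ψ => by simp
      map_smul' := fun c φ => by simp }
  map_add' x y := CDual.ext fun φ => by
    change star (φ (x + y)) = star (φ x) + star (φ y)
    simp
  map_smul' c x := CDual.ext fun φ => by
    change star (φ (c • x)) = star (φ x) * star c
    simp

@[simp] theorem ev_apply (x : M) (φ : CDual R M) : ev R M x φ = star (φ x) := rfl

/-- For `B : M → N^*`, the map `N → M^*` given by `y ↦ (x ↦ star (B x y))`: the dual
`B^* : N^** → M^*` precomposed with the evaluation `N → N^**`. -/
def flip (B : M →ₗ[R] CDual R N) : N →ₗ[R] CDual R M := dualMap B ∘ₗ ev R N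

@[simp] theorem flip_apply (B : M →ₗ[R] CDual R N) (x : M) (y : N) :
    flip B y x = star (B x y) := rfl

/-- The canonical isomorphism `M^* ⊕ N^* ≃ (M ⊕ N)^*`. -/
def prodDual : (CDual R M × CDual R N) ≃ₗ[R] CDual R (M × N) where
  toLinearMap := (dualMap (LinearMap.fst R M N)).coprod (dualMap (LinearMap.snd R M N))
  invFun φ := (dualMap (LinearMap.inl R M N) φ, dualMap (LinearMap.inr R M N) φ)
  left_inv p := by
    ext1 <;> exact CDual.ext fun x => by simp
  right_inv φ := CDual.ext fun x => by
    simp [← map_add]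

/-- The isomorphism of `R^n` with its dual that sends the standard basis to the dual basis. -/
def stdDual (R : Type*) [Ring R] [StarRing R] (n : ℕ) :
    (Fin n → R) ≃ₗ[R] CDual R (Fin n → R) where
  toFun a := CDual.of
    { toFun := fun x => ∑ i, x i * star (a i)
      map_add' := fun x y => by simp [add_mul, Finset.sum_add_distrib]
      map_smul' := fun c x => by simp [Finset.mul_sum, mul_assoc] }
  map_add' a b := CDual.ext fun x => by simp [mul_add, Finset.sum_add_distrib]
  map_smul' c a := CDual.ext fun x => by simp [Finset.sum_mul, mul_assoc]
  invFun φ i := star (φ (Pi.single i 1))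
  left_inv a := by
    funext i
    simp [Pi.single_apply]
  right_inv φ := CDual.ext fun x => by
    have hx : x = ∑ i, x i • (Pi.single i (1 : R) : Fin n → R) := by
      funext j
      simp [Finset.sum_apply, Pi.single_apply]
    conv_rhs => rw [hx]
    simp only [CDual.of_apply, LinearMap.coe_mk, AddHom.coe_mk, star_star, map_sum, map_smul,
      smul_eq_mul]

theorem ev_std_bijective (n : ℕ) : Function.Bijective (ev R (Fin n → R)) := by
  constructor
  · intro x y h
    funext i
    have := congrArg (fun F : CDual R (CDual R (Fin n → R)) => F (stdDual R n (Pi.single i 1))) h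
    simpa [stdDual, Pi.single_apply] using this
  · intro F
    refine ⟨(stdDual R n).symm (dualMap (stdDual R n).toLinearMap F), CDual.ext fun φ => ?_⟩
    obtain ⟨a, rfl⟩ := (stdDual R n).surjective φ
    have h := congrArg (fun G : CDual R (Fin n → R) => G a)
      ((stdDual R n).apply_symm_apply (dualMap (stdDual R n).toLinearMap F))
    have h2 : ∀ b : Fin n → R, star (stdDual R n a b) = stdDual R n b a := by
      intro b
      simp [stdDual]
    rw [ev_apply, h2]
    exact h

/-- A retract of a reflexive module is reflexive. -/
theorem ev_bijective_of_retract (i : M →ₗ[R] N) (p : N →ₗ[R] M) (h : ∀ x, p (i x) = x)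
    (hN : Function.Bijective (ev R N)) : Function.Bijective (ev R M) := by
  constructor
  · intro x y hxy
    have : ev R N (i x) = ev R N (i y) := CDual.ext fun φ =>
      congrArg (fun F : CDual R (CDual R M) => F (dualMap i φ)) hxy
    rw [← h x, ← h y, hN.1 this]
  · intro F
    obtain ⟨z, hz⟩ := hN.2 (dualMap (dualMap i) F)
    refine ⟨p z, CDual.ext fun φ => ?_⟩
    have h1 := congrArg (fun G : CDual R (CDual R N) => G (dualMap p φ)) hz
    have h2 : dualMap i (dualMap p φ) = φ := CDual.ext fun x => by simp [h]
    simpa [h2] using h1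

end Duals

/-! ## The reduced group `K₁` -/

section KOne

variable (R : Type u) [Ring R]

/-- `R^m ⊕ R^n ≃ R^(m+n)`. -/
def finAdd (m n : ℕ) : ((Fin m → R) × (Fin n → R)) ≃ₗ[R] (Fin (m + n) → R) :=
  (LinearEquiv.sumArrowLequivProdArrow (Fin m) (Fin n) R R).symm.trans
    (LinearEquiv.funCongrLeft R R finSumFinEquiv.symm)

/-- Automorphisms of the standard free modules `R^n`, for all `n`. -/
abbrev FreeAut := Σ n : ℕ, (Fin n → R) ≃ₗ[R] (Fin n → R)

/-- The defining relations of the reduced `K₁`: additivity on composites, invariance under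
stabilisation `f ↦ f ⊕ 1`, and triviality of `-1 : R → R`. -/
inductive K1Rel : FreeAbelianGroup (FreeAut R) → Prop
  | mul (n : ℕ) (f g : (Fin n → R) ≃ₗ[R] (Fin n → R)) :
      K1Rel (FreeAbelianGroup.of (⟨n, f.trans g⟩ : FreeAut R)
        - FreeAbelianGroup.of (⟨n, f⟩ : FreeAut R) - FreeAbelianGroup.of (⟨n, g⟩ : FreeAut R))
  | stab (n k : ℕ) (f : (Fin n → R) ≃ₗ[R] (Fin n → R)) :
      K1Rel (FreeAbelianGroup.of (⟨n + k, (finAdd R n k).symm.trans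
          ((LinearEquiv.prodCongr f (LinearEquiv.refl R _)).trans (finAdd R n k))⟩ : FreeAut R)
        - FreeAbelianGroup.of (⟨n, f⟩ : FreeAut R))
  | sign : K1Rel (FreeAbelianGroup.of (⟨1, LinearEquiv.neg R⟩ : FreeAut R))

/-- The reduced `K₁`-group of `R`: the abelianisation of the colimit of the groups
`Aut(R^n)` along stabilisation, modulo the class of `-1`. -/
def RedK1 := FreeAbelianGroup (FreeAut R) ⧸ AddSubgroup.closure {x | K1Rel R x}

instance : AddCommGroup (RedK1 R) :=
  inferInstanceAs
    (AddCommGroup (FreeAbelianGroup (FreeAut R) ⧸ AddSubgroup.closure {x | K1Rel R x}))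

variable {R}

/-- The class in the reduced `K₁`-group of an automorphism of `R^n`. -/
def k1Class {n : ℕ} (f : (Fin n → R) ≃ₗ[R] (Fin n → R)) : RedK1 R :=
  QuotientAddGroup.mk (FreeAbelianGroup.of (⟨n, f⟩ : FreeAut R))

/-- The conjugate transpose of an automorphism of `R^n`: its dual with respect to the dual basis. -/
def conjDual [StarRing R] {n : ℕ} (f : (Fin n → R) ≃ₗ[R] (Fin n → R)) :
    (Fin n → R) ≃ₗ[R] (Fin n → R) :=
  (stdDual R n).trans ((dualEquiv f).trans (stdDual R n).symm)

/-- `Z` is invariant under the involution `[A] ↦ [A^*]` of the reduced `K₁`-group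
(every element of this group is the class of an automorphism of some `R^n`). -/
def StarInvariant [StarRing R] (Z : AddSubgroup (RedK1 R)) : Prop :=
  ∀ (n : ℕ) (f : (Fin n → R) ≃ₗ[R] (Fin n → R)), k1Class f ∈ Z → k1Class (conjDual f) ∈ Z

end KOne

/-! ## Based modules and simple isomorphisms -/

/-- A based module: a finitely generated stably free left `R`-module `M` together with an
`s`-basis, that is, a basis of `M ⊕ R^extra`. Only the class of the `s`-basis up to changes of
basis with torsion in `Z` matters in what follows. -/
structure BMod (R : Type u) [Ring R] where
  carrier : Type u
  [grp : AddCommGroup carrier]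
  [mod : Module R carrier]
  extra : ℕ
  rank : ℕ
  sbasis : (carrier × (Fin extra → R)) ≃ₗ[R] (Fin rank → R)

attribute [instance] BMod.grp BMod.mod

instance (R : Type u) [Ring R] : CoeSort (BMod R) (Type u) := ⟨BMod.carrier⟩

section Based

variable {R : Type u} [Ring R]

/-- The matrix of `f : M ≃ N` with respect to the `s`-bases, as an isomorphism of free modules
`R^(rank M) ⊕ R^(extra N) ≃ M ⊕ R^(extra M) ⊕ R^(extra N) ≃ N ⊕ R^(extra M) ⊕ R^(extra N)
≃ R^(rank N) ⊕ R^(extra M)`. -/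
def stableMatrix {M N : BMod R} (f : M ≃ₗ[R] N) :
    ((Fin M.rank → R) × (Fin N.extra → R)) ≃ₗ[R] ((Fin N.rank → R) × (Fin M.extra → R)) :=
  (LinearEquiv.prodCongr M.sbasis.symm (LinearEquiv.refl R (Fin N.extra → R))).trans <|
  (LinearEquiv.prodAssoc R M (Fin M.extra → R) (Fin N.extra → R)).trans <|
  (LinearEquiv.prodCongr f (LinearEquiv.prodComm R (Fin M.extra → R) (Fin N.extra → R))).trans <|
  (LinearEquiv.prodAssoc R N (Fin N.extra → R) (Fin M.extra → R)).symm.trans <|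
  LinearEquiv.prodCongr N.sbasis (LinearEquiv.refl R (Fin M.extra → R))

/-- An isomorphism of based modules is simple if its torsion, the class of its matrix with respect
to the `s`-bases, lies in `Z`. -/
def IsSimple (Z : AddSubgroup (RedK1 R)) {M N : BMod R} (f : M ≃ₗ[R] N) : Prop :=
  ∃ h : M.rank + N.extra = N.rank + M.extra,
    k1Class ((finAdd R M.rank N.extra).symm.trans <| (stableMatrix f).trans <|
      (finAdd R N.rank M.extra).trans <|
        LinearEquiv.funCongrLeft R R (finCongr h)) ∈ Z

/-- Transport of the `s`-basis along an isomorphism. -/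
abbrev BMod.transport (M : BMod R) {N : Type u} [AddCommGroup N] [Module R N] (e : M ≃ₗ[R] N) :
    BMod R where
  carrier := N
  extra := M.extra
  rank := M.rank
  sbasis := (LinearEquiv.prodCongr e.symm (LinearEquiv.refl R _)).trans M.sbasis

/-- The direct sum of based modules. -/
abbrev BMod.prod (M N : BMod R) : BMod R where
  carrier := M × N
  extra := M.extra + N.extra
  rank := M.rank + N.rank
  sbasis := (LinearEquiv.prodCongr (LinearEquiv.refl R (M × N))
      (finAdd R M.extra N.extra).symm).trans <|
    (LinearEquiv.prodProdProdComm R M N (Fin M.extra → R) (Fin N.extra → R)).trans <|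
    (LinearEquiv.prodCongr M.sbasis N.sbasis).trans (finAdd R M.rank N.rank)

variable [StarRing R]

/-- The dual of a based module, with the dual `s`-basis. -/
abbrev BMod.dual (M : BMod R) : BMod R where
  carrier := CDual R M
  extra := M.extra
  rank := M.rank
  sbasis := (LinearEquiv.prodCongr (LinearEquiv.refl R (CDual R M)) (stdDual R M.extra)).trans <|
    prodDual.trans <| (dualEquiv M.sbasis).symm.trans (stdDual R M.rank).symm

theorem BMod.ev_bijective (M : BMod R) : Function.Bijective (ev R M) :=
  ev_bijective_of_retract
    (M.sbasis.toLinearMap ∘ₗ LinearMap.inl R M (Fin M.extra → R))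
    (LinearMap.fst R M (Fin M.extra → R) ∘ₗ M.sbasis.symm.toLinearMap)
    (fun x => by simp) (ev_std_bijective M.rank)

/-- The canonical identification `M ≃ M^**`. -/
def BMod.evEquiv (M : BMod R) : M ≃ₗ[R] CDual R (CDual R M) :=
  LinearEquiv.ofBijective (ev R M) M.ev_bijective

/-- For `f : M^* → N`, the map `f^* : N^* → M^** = M`. -/
def codual {M : BMod R} {N : Type u} [AddCommGroup N] [Module R N] (f : CDual R M →ₗ[R] N) :
    CDual R N →ₗ[R] M :=
  M.evEquiv.symm.toLinearMap ∘ₗ dualMap f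

end Based

/-! ## Quadratic forms -/

section Quad

variable {R : Type u} [Ring R] [StarRing R]

/-- The involution `T` of `Hom(M, M^*)`, `(T φ) x y = star (φ y x)`. -/
def T (M : Type u) [AddCommGroup M] [Module R M] :
    (M →ₗ[R] CDual R M) →+ (M →ₗ[R] CDual R M) where
  toFun := flip
  map_zero' := LinearMap.ext fun x => CDual.ext fun y => by simp
  map_add' φ ψ := LinearMap.ext fun x => CDual.ext fun y => by simp

@[simp] theorem T_apply {M : Type u} [AddCommGroup M] [Module R M] (φ : M →ₗ[R] CDual R M)
    (x y : M) : T M φ x y = star (φ y x) := rfl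

/-- The homomorphism `1 - ε T` of `Hom(M, M^*)`. -/
def oneSub (ε : ℤˣ) (M : Type u) [AddCommGroup M] [Module R M] :
    (M →ₗ[R] CDual R M) →+ (M →ₗ[R] CDual R M) :=
  AddMonoidHom.id _ - (ε : ℤ) • T M

/-- `Q_ε(M) = coker (1 - ε T)`. -/
abbrev Q (R : Type u) [Ring R] [StarRing R] (ε : ℤˣ) (M : Type u) [AddCommGroup M] [Module R M] :=
  (M →ₗ[R] CDual R M) ⧸ (oneSub (R := R) ε M).range

variable {ε : ℤˣ} {M N : Type u} [AddCommGroup M] [Module R M] [AddCommGroup N] [Module R N]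

/-- The class in `Q_ε(M)` of a homomorphism `M → M^*`. -/
def Q.mk (ψ : M →ₗ[R] CDual R M) : Q R ε M := QuotientAddGroup.mk ψ

/-- `ψ ↦ f^* ψ f` on homomorphisms. -/
def pullHom (f : M →ₗ[R] N) : (N →ₗ[R] CDual R N) →+ (M →ₗ[R] CDual R M) where
  toFun ψ := dualMap f ∘ₗ ψ ∘ₗ f
  map_zero' := LinearMap.ext fun x => CDual.ext fun y => by simp
  map_add' φ ψ := LinearMap.ext fun x => CDual.ext fun y => by simp

@[simp] theorem pullHom_apply (f : M →ₗ[R] N) (ψ : N →ₗ[R] CDual R N) (x y : M) :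
    pullHom f ψ x y = ψ (f x) (f y) := rfl

theorem pullHom_oneSub (f : M →ₗ[R] N) (ψ : N →ₗ[R] CDual R N) :
    pullHom f (oneSub ε N ψ) = oneSub ε M (pullHom f ψ) := by
  have h : pullHom f (T N ψ) = T M (pullHom f ψ) := rfl
  simp [oneSub, map_sub, map_zsmul, h]

/-- `ψ ↦ f^* ψ f`, as a homomorphism `Q_ε(N) → Q_ε(M)`. -/
def Q.pull (f : M →ₗ[R] N) : Q R ε N →+ Q R ε M :=
  QuotientAddGroup.map _ _ (pullHom f) (by
    rintro _ ⟨ψ, rfl⟩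
    exact ⟨pullHom f ψ, (pullHom_oneSub f ψ).symm⟩)

/-- The symmetrisation `ψ ↦ (1 + ε T) ψ`. -/
def Q.symm : Q R ε M →+ (M →ₗ[R] CDual R M) :=
  QuotientAddGroup.lift _ (AddMonoidHom.id _ + (ε : ℤ) • T M) (by
    rintro _ ⟨ψ, rfl⟩
    have h : T M (T M ψ) = ψ := LinearMap.ext fun x => CDual.ext fun y => by simp
    rw [AddMonoidHom.mem_ker]
    rcases Int.units_eq_one_or ε with h0 | h0
    · simp [oneSub, h0, h]
    · simp only [oneSub, h0, Units.val_neg, Units.val_one, neg_smul, one_smul, sub_neg_eq_add,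
        AddMonoidHom.add_apply, AddMonoidHom.neg_apply, AddMonoidHom.id_apply, map_add, h]
      abel)

theorem Q.symm_mk (ψ : M →ₗ[R] CDual R M) (x y : M) :
    Q.symm (Q.mk (ε := ε) ψ) x y = ψ x y + (ε : ℤ) • star (ψ y x) := by
  rcases Int.units_eq_one_or ε with h | h <;> subst h
  · change (ψ + ((1 : ℤˣ) : ℤ) • T M ψ) x y = _
    simp
  · change (ψ + ((-1 : ℤˣ) : ℤ) • T M ψ) x y = _
    simp

end Quad

/-- An `ε`-quadratic form `(M, ψ)`: a based module `M` and `ψ ∈ Q_ε(M)`. -/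
structure QForm (R : Type u) [Ring R] [StarRing R] (ε : ℤˣ) where
  M : BMod R
  form : Q R ε M

section Forms

variable {R : Type u} [Ring R] [StarRing R] {ε : ℤˣ}

/-- The symmetrisation of a form. -/
abbrev QForm.symm (v : QForm R ε) : v.M →ₗ[R] CDual R v.M := Q.symm v.form

/-- The form `-v = (V, -θ)`. -/
abbrev QForm.neg (v : QForm R ε) : QForm R ε := ⟨v.M, -v.form⟩

/-- Nonsingular forms: the symmetrisation is an isomorphism. -/
def QForm.Nonsingular (v : QForm R ε) : Prop := Function.Bijective v.symm

/-- Simple forms: the symmetrisation is a simple isomorphism. -/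
def QForm.Simple (Z : AddSubgroup (RedK1 R)) (v : QForm R ε) : Prop :=
  ∃ e : v.M ≃ₗ[R] v.M.dual, IsSimple Z e ∧ ∀ x, e x = v.symm x

theorem QForm.Simple.nonsingular {Z : AddSubgroup (RedK1 R)} {v : QForm R ε} (h : v.Simple Z) :
    v.Nonsingular := by
  obtain ⟨e, -, he⟩ := h
  have : ⇑v.symm = ⇑e := funext fun x => (he x).symm
  rw [QForm.Nonsingular, this]
  exact e.bijective

/-- The symmetrisation of a nonsingular form as an isomorphism `M ≃ M^*`. -/
def QForm.symmEquiv (v : QForm R ε) (h : v.Nonsingular) : v.M ≃ₗ[R] CDual R v.M :=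
  LinearEquiv.ofBijective v.symm h

/-- The hyperbolic form `H_ε(L)`: the class of `(x, ξ), (y, η) ↦ ξ y` on `L ⊕ L^*`. -/
abbrev hyp (ε : ℤˣ) (L : BMod R) : QForm R ε :=
  ⟨L.prod L.dual, Q.mk (M := L × CDual R L)
    (dualMap (LinearMap.fst R L (CDual R L)) ∘ₗ LinearMap.snd R L (CDual R L))⟩

theorem hyp_nonsingular (L : BMod R) : (hyp ε L).Nonsingular := by
  have h2 : ((ε : ℤ) * (ε : ℤ)) = 1 := by
    rcases Int.units_eq_one_or ε with h | h <;> simp [h]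
  have key : ∀ (p : L × CDual R L) (q : L × CDual R L),
      (hyp ε L).symm p q = p.2 q.1 + (ε : ℤ) • star (q.2 p.1) := by
    intro p q
    exact Q.symm_mk _ p q
  constructor
  · intro p p' h
    have h1 : ∀ q : L × CDual R L, (hyp ε L).symm p q = (hyp ε L).symm p' q := fun q => by rw [h]
    have ha : p.2 = p'.2 := CDual.ext fun y => by
      have := h1 (y, 0)
      rw [key, key] at this
      simpa using this
    have hb : p.1 = p'.1 := L.ev_bijective.1 (CDual.ext fun φ => by
      have := h1 (0, φ)
      rw [key, key] at this
      rcases Int.units_eq_one_or ε with h0 | h0 <;> simpa [h0] using this)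
    exact Prod.ext hb ha
  · intro F
    obtain ⟨x, hx⟩ := L.ev_bijective.2 (dualMap (LinearMap.inr R L (CDual R L)) F)
    refine ⟨(((ε : ℤ) • x : L), dualMap (LinearMap.inl R L (CDual R L)) F), CDual.ext fun q => ?_⟩
    have hq := congrArg (fun G : CDual R (CDual R L) => G q.2) hx
    refine (key _ _).trans ?_
    simp only [ev_apply, dualMap_apply] at hq
    simp only [dualMap_apply, map_zsmul, star_zsmul, smul_smul, h2, one_smul, hq]
    rw [← map_add]
    simp

/-- Isometries of forms; they are required to be simple. -/
structure Isometry (Z : AddSubgroup (RedK1 R)) (v w : QForm R ε) where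
  e : v.M ≃ₗ[R] w.M
  simple : IsSimple Z e
  isometric : Q.pull e.toLinearMap w.form = v.form

end Forms

/-! ## Split formations and their isomorphisms -/

/-- The data `(F, (γ, δ) (G, θ))` of a split `(-ε)`-quadratic formation, with `ε`-quadratic Hessian
`θ`. It is used only for (sums of) boundaries of forms and trivial formations, for which
`(γ, δ) : G → F ⊕ F^*` is the inclusion of a simple lagrangian and `γ^* δ = θ + ε θ^*`. -/
structure SplitFormation (R : Type u) [Ring R] [StarRing R] (ε : ℤˣ) where
  F : BMod R
  G : BMod R
  γ : G →ₗ[R] F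
  δ : G →ₗ[R] CDual R F
  θ : Q R ε G

section Formations

variable {R : Type u} [Ring R] [StarRing R] {ε : ℤˣ}

/-- The boundary `∂(V, θ) = (V, (1, θ + ε θ^*) (V, θ))` of an `ε`-quadratic form. -/
abbrev bdry (v : QForm R ε) : SplitFormation R ε := ⟨v.M, v.M, LinearMap.id, v.symm, v.form⟩

/-- The trivial split formation `(P, P^*) = (P, (0, 1) (P^*, 0))`. -/
abbrev triv (ε : ℤˣ) (P : BMod R) : SplitFormation R ε :=
  ⟨P, P.dual, (0 : CDual R P →ₗ[R] P), (LinearMap.id : CDual R P →ₗ[R] CDual R P), 0⟩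

/-- The direct sum of split formations. -/
abbrev SplitFormation.sum (X Y : SplitFormation R ε) : SplitFormation R ε where
  F := X.F.prod Y.F
  G := X.G.prod Y.G
  γ := (X.γ.prodMap Y.γ : (X.G × Y.G) →ₗ[R] (X.F × Y.F))
  δ := (((dualMap (LinearMap.fst R X.F Y.F) ∘ₗ X.δ).coprod
    (dualMap (LinearMap.snd R X.F Y.F) ∘ₗ Y.δ)) : (X.G × Y.G) →ₗ[R] CDual R (X.F × Y.F))
  θ := Q.pull (LinearMap.fst R X.G Y.G) X.θ + Q.pull (LinearMap.snd R X.G Y.G) Y.θ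

/-- A triple `(α, β, ν)` with `α : F₁ ≃ F₂`, `β : G₁ ≃ G₂` and `ν ∈ Q_ε(F₁^*)`. -/
structure Triple (X Y : SplitFormation R ε) where
  α : X.F ≃ₗ[R] Y.F
  β : X.G ≃ₗ[R] Y.G
  ν : Q R ε (CDual R X.F)

/-- A triple `(α, β, ν)` is an isomorphism of split formations if `α`, `β` are simple,
`θ₁ + δ₁^* ν δ₁ = β^* θ₂ β ∈ Q_ε(G₁)`, `α γ₁ + α (ν + ε ν^*)^* δ₁ = γ₂ β`
and `α^{-*} δ₁ = δ₂ β` (here `F₁^** = F₁`). -/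
structure Triple.IsIso (Z : AddSubgroup (RedK1 R)) {X Y : SplitFormation R ε} (f : Triple X Y) :
    Prop where
  simple_α : IsSimple Z f.α
  simple_β : IsSimple Z f.β
  hessian : X.θ + Q.pull X.δ f.ν = Q.pull f.β.toLinearMap Y.θ
  map_γ : ∀ x : X.G,
    f.α (X.γ x) + f.α (X.F.evEquiv.symm (T (CDual R X.F) (Q.symm f.ν) (X.δ x))) = Y.γ (f.β x)
  map_δ : ∀ x : X.G, dualMap f.α.symm.toLinearMap (X.δ x) = Y.δ (f.β x)

/-- The composite `g ∘ f = (α' α, β' β, ν + α^{-1} ν' α^{-*})`. -/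
def Triple.comp {X Y W : SplitFormation R ε} (g : Triple Y W) (f : Triple X Y) : Triple X W :=
  ⟨f.α.trans g.α, f.β.trans g.β, f.ν + Q.pull (dualMap f.α.symm.toLinearMap) g.ν⟩

/-- The identity `(1, 1, 0)`. -/
def Triple.id (X : SplitFormation R ε) : Triple X X := ⟨LinearEquiv.refl R _, LinearEquiv.refl R _, 0⟩

/-- The inverse `(α^{-1}, β^{-1}, - α ν α^*)`. -/
def Triple.inv {X Y : SplitFormation R ε} (f : Triple X Y) : Triple Y X :=
  ⟨f.α.symm, f.β.symm, -Q.pull (dualMap f.α.toLinearMap) f.ν⟩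

/-- The direct sum of triples. -/
def Triple.sum {X Y X' Y' : SplitFormation R ε} (f : Triple X Y) (f' : Triple X' Y') :
    Triple (X.sum X') (Y.sum Y') where
  α := (LinearEquiv.prodCongr f.α f'.α : (X.F × X'.F) ≃ₗ[R] (Y.F × Y'.F))
  β := (LinearEquiv.prodCongr f.β f'.β : (X.G × X'.G) ≃ₗ[R] (Y.G × Y'.G))
  ν := (Q.pull (dualMap (LinearMap.inl R X.F X'.F)) f.ν +
    Q.pull (dualMap (LinearMap.inr R X.F X'.F)) f'.ν : Q R ε (CDual R (X.F × X'.F)))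

/-- The associativity isomorphism for direct sums. -/
def Triple.assoc (X Y W : SplitFormation R ε) : Triple ((X.sum Y).sum W) (X.sum (Y.sum W)) where
  α := LinearEquiv.prodAssoc R X.F Y.F W.F
  β := LinearEquiv.prodAssoc R X.G Y.G W.G
  ν := 0

/-- The boundary `∂h = (h, h, 0)` of an isomorphism of the underlying modules of two forms. -/
def Triple.bdry {v w : QForm R ε} (h : v.M ≃ₗ[R] w.M) : Triple (bdry v) (bdry w) := ⟨h, h, 0⟩

/-- Homotopies `Δ : G₁^* → F₂` from `(α, β, ν)` to `(α', β', ν')`: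
`β'^{-*} - β^{-*} = δ₂^* Δ`, `α' - α = Δ δ₁^*` and
`α' ν' α'^* - α ν α^* = (- ε α' γ₁ + Δ θ₁) Δ^* ∈ Q_ε(F₂^*)`. -/
def Homotopic {X Y : SplitFormation R ε} (f f' : Triple X Y) : Prop :=
  ∃ Δ : CDual R X.G →ₗ[R] Y.F,
    (∀ φ : CDual R X.G, dualMap f'.β.symm.toLinearMap φ - dualMap f.β.symm.toLinearMap φ
      = flip Y.δ (Δ φ)) ∧
    (∀ x : X.F, f'.α x - f.α x = Δ (flip X.δ x)) ∧
    Q.pull (dualMap f'.α.toLinearMap) f'.ν - Q.pull (dualMap f.α.toLinearMap) f.ν =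
      Q.mk (-((ε : ℤ) • (ev R Y.F ∘ₗ f'.α.toLinearMap ∘ₗ X.γ ∘ₗ codual Δ)))
        + Q.pull (codual Δ) X.θ

/-- The data of a stable isomorphism `∂v ⊕ (P, P^*) → ∂v' ⊕ (P', P'^*)`. -/
abbrev StTriple (v v' : QForm R ε) (P P' : BMod R) :=
  Triple ((bdry v).sum (triv ε P)) ((bdry v').sum (triv ε P'))

/-- Stable isomorphisms `∂v → ∂v'`. -/
structure StableIso (Z : AddSubgroup (RedK1 R)) (v v' : QForm R ε) where
  P : BMod R
  P' : BMod R
  f : StTriple v v' P P'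
  isIso : f.IsIso Z

/-- The stabilisation `f̃ = (1 ⊕ h) ∘ (f ⊕ 1) ∘ (1 ⊕ g) : x ⊕ (P, P^*) → y ⊕ (Q, Q^*)` of
`f : x ⊕ u → y ⊕ w` along `g : (P, P^*) → u ⊕ r` and `h : w ⊕ r → (Q, Q^*)`. -/
def stabilise {x y u w r p q : SplitFormation R ε} (f : Triple (x.sum u) (y.sum w))
    (g : Triple p (u.sum r)) (h : Triple (w.sum r) q) : Triple (x.sum p) (y.sum q) :=
  ((Triple.id y).sum h).comp <| (Triple.assoc y w r).comp <| (f.sum (Triple.id r)).comp <|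
    (Triple.assoc x u r).inv.comp ((Triple.id x).sum g)

/-- Two stable isomorphisms are stably homotopic if they have homotopic stabilisations. -/
def StablyHomotopic (Z : AddSubgroup (RedK1 R)) {v v' : QForm R ε} (f₁ f₂ : StableIso Z v v') :
    Prop :=
  ∃ (R₁ R₂ P Q : BMod R)
    (g₁ : Triple (triv ε P) ((triv ε f₁.P).sum (triv ε R₁)))
    (g₂ : Triple (triv ε P) ((triv ε f₂.P).sum (triv ε R₂)))
    (h₁ : Triple ((triv ε f₁.P').sum (triv ε R₁)) (triv ε Q))
    (h₂ : Triple ((triv ε f₂.P').sum (triv ε R₂)) (triv ε Q)),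
    g₁.IsIso Z ∧ g₂.IsIso Z ∧ h₁.IsIso Z ∧ h₂.IsIso Z ∧
      Homotopic (stabilise f₁.f g₁ h₁) (stabilise f₂.f g₂ h₂)

/-- `Iso(∂v, ∂v')`: stable homotopy classes of stable isomorphisms. -/
def Iso (Z : AddSubgroup (RedK1 R)) (v v' : QForm R ε) := Quot (StablyHomotopic Z (v := v) (v' := v'))

/-- The class of a stable isomorphism. -/
def Iso.mk {Z : AddSubgroup (RedK1 R)} {v v' : QForm R ε} (f : StableIso Z v v') : Iso Z v v' :=
  Quot.mk _ f

/-! ## The union of two forms along a stable isomorphism -/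

variable {v v' : QForm R ε} {P P' : BMod R}

/-- The component `a : V → V'` of `(α, β, ν)`: the upper left entry of `α`. -/
def compA (f : StTriple v v' P P') : v.M →ₗ[R] v'.M :=
  LinearMap.fst R v'.M P' ∘ₗ f.α.toLinearMap ∘ₗ LinearMap.inl R v.M P

/-- The component `b : V' → V` of `(α, β, ν)`: the upper left entry of `β^{-1}`. -/
def compB (f : StTriple v v' P P') : v'.M →ₗ[R] v.M :=
  LinearMap.fst R v.M (CDual R P) ∘ₗ f.β.symm.toLinearMap ∘ₗ LinearMap.inl R v'.M (CDual R P')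

/-- The component `s ∈ Q_ε(V'^*)` of `(α, β, ν)`: the upper left entry of `α ν α^*`. -/
def compS (f : StTriple v v' P P') : Q R ε (CDual R v'.M) :=
  Q.pull (dualMap (LinearMap.fst R v'.M P')) (Q.pull (dualMap f.α.toLinearMap) f.ν)

/-- The union `v ∪_f -v' = (V ⊕ V'^*, [[θ, 0], [ε a, -s]])`. -/
abbrev union (f : StTriple v v' P P') : QForm R ε where
  M := v.M.prod v'.M.dual
  form := Q.pull (LinearMap.fst R v.M (CDual R v'.M)) v.form
    + Q.mk (M := v.M × CDual R v'.M) ((ε : ℤ) • (dualMap (LinearMap.snd R v.M (CDual R v'.M)) ∘ₗ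
        ev R v'.M ∘ₗ compA f ∘ₗ LinearMap.fst R v.M (CDual R v'.M)))
    - Q.pull (LinearMap.snd R v.M (CDual R v'.M)) (compS f)

/-- The map `(1, 0) : V → V ⊕ V'^*`. -/
def unionInl (f : StTriple v v' P P') : v.M →ₗ[R] (union f).M :=
  LinearMap.inl R v.M (CDual R v'.M)

/-- The map `(b, -λ') : V' → V ⊕ V'^*`, with `λ'` the symmetrisation of `v'`. -/
def unionInr (f : StTriple v v' P P') : v'.M →ₗ[R] (union f).M :=
  (compB f).prod (-v'.symm)

end Formations

/-! ## Primitive embeddings -/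

section Prim

variable {R : Type u} [Ring R] [StarRing R] {ε : ℤˣ}

/-- The orthogonal complement `j(V)^⊥` of the image of `j : V → M`. -/
def orth {m : QForm R ε} {V : Type u} [AddCommGroup V] [Module R V] (j : V →ₗ[R] m.M) :
    Submodule R m.M :=
  LinearMap.ker (dualMap j ∘ₗ m.symm)

/-- A 2-sided primitive embedding `v → m ← w`: a pair of split isometric injections into the
simple form `m` with `j(v)^⊥ = j'(w)`. The last equality is one of based modules, where `j(v)^⊥` is
based by means of `0 → V → M → (V^⊥)^* → 0`: the sequence
`0 → V → M → W^* → 0` with maps `j` and `j'^* φ`, where `φ` is the symmetrisation of `m`,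
is isomorphic to the split sequence by a simple isomorphism `V ⊕ W^* ≃ M`. -/
structure TwoSided (Z : AddSubgroup (RedK1 R)) (v w m : QForm R ε) where
  j : v.M →ₗ[R] m.M
  j' : w.M →ₗ[R] m.M
  simple : m.Simple Z
  isometric : Q.pull j m.form = v.form
  isometric' : Q.pull j' m.form = w.form
  split : ∃ p : m.M →ₗ[R] v.M, p ∘ₗ j = LinearMap.id
  split' : ∃ p : m.M →ₗ[R] w.M, p ∘ₗ j' = LinearMap.id
  orth_eq : orth j = LinearMap.range j'
  based : ∃ e : v.M.prod w.M.dual ≃ₗ[R] m.M, IsSimple Z e ∧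
    (∀ x : v.M, e ((x, 0) : v.M × CDual R w.M) = j x) ∧
    ∀ (x : v.M) (ξ : CDual R w.M), dualMap j' (m.symm (e ((x, ξ) : v.M × CDual R w.M))) = ξ

variable {Z : AddSubgroup (RedK1 R)} {v w m : QForm R ε}

/-- Two 2-sided primitive embeddings `v → m₀ ← w` and `v → m₁ ← w` are isomorphic if there is an
isometry `m₀ ≃ m₁` compatible with both embeddings. -/
def TwoSided.Isomorphic {m₀ m₁ : QForm R ε} (E : TwoSided Z v w m₀) (E' : TwoSided Z v w m₁) :
    Prop :=
  ∃ g : Isometry Z m₀ m₁, (∀ x, g.e (E.j x) = E'.j x) ∧ ∀ x, g.e (E.j' x) = E'.j' x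

/-- `Prim_m(v, w)`: isomorphism classes of 2-sided primitive embeddings `v → m ← w`. -/
def PrimM (Z : AddSubgroup (RedK1 R)) (v w m : QForm R ε) :=
  Quot (fun E E' : TwoSided Z v w m => E.Isomorphic E')

/-- The class of a 2-sided primitive embedding in `Prim_m(v, w)`. -/
def PrimM.mk (E : TwoSided Z v w m) : PrimM Z v w m := Quot.mk _ E

/-- `Prim(v, w)`, the union of the sets `Prim_m(v, w)` over the isometry classes of forms `m`:
isomorphism classes of 2-sided primitive embeddings `v → m ← w` with varying `m`. -/
def Prim (Z : AddSubgroup (RedK1 R)) (v w : QForm R ε) :=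
  Quot (fun E E' : (Σ m : QForm R ε, TwoSided Z v w m) => E.2.Isomorphic E'.2)

/-- The class of a 2-sided primitive embedding in `Prim(v, w)`. -/
def Prim.mk (E : TwoSided Z v w m) : Prim Z v w := Quot.mk _ ⟨m, E⟩

/-- `Iso_m(∂v, ∂v')`: the classes `[f]` with `v ∪_f -v'` isometric to `m`. -/
def IsoM (Z : AddSubgroup (RedK1 R)) (v v' m : QForm R ε) :=
  {x : Iso Z v v' // ∃ f : StableIso Z v v', x = Iso.mk f ∧ Nonempty (Isometry Z (union f.f) m)}

/-- The class in `Iso_m(∂v, ∂v')` of a stable isomorphism `f` with an isometry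
`v ∪_f -v' ≃ m`. -/
def IsoM.mk {v' : QForm R ε} (f : StableIso Z v v') (k : Isometry Z (union f.f) m) :
    IsoM Z v v' m :=
  ⟨Iso.mk f, f, rfl, ⟨k⟩⟩

/-! ## The actions of the isometry groups, and the quotients -/

/-- Which isometry groups are divided out: `Aut(v)` for `left` (the prefix `l`), `Aut(v')` for
`right` (the prefix `r`), and `Aut(v) × Aut(v')` for `both` (the prefix `b`). -/
inductive Side
  | left
  | right
  | both

/-- The pairs `(g, h) ∈ Aut(v) × Aut(v')` that lie in the group to be divided out. -/
def Side.Allows : Side → Isometry Z v v → Isometry Z w w → Prop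
  | .left, _, h => h.e = LinearEquiv.refl R _
  | .right, g, _ => g.e = LinearEquiv.refl R _
  | .both, _, _ => True

/-- The action `(g, h) · f = ∂h ∘ f ∘ ∂g^{-1}` on stable isomorphisms. -/
def act {v' : QForm R ε} {P P' : BMod R} (g : Isometry Z v v) (h : Isometry Z v' v')
    (f : StTriple v v' P P') : StTriple v v' P P' :=
  ((Triple.bdry h.e).sum (Triple.id (triv ε P'))).comp <|
    f.comp ((Triple.bdry (v := v) (w := v) g.e.symm).sum (Triple.id (triv ε P)))

/-- `x` and `y` in `Iso(∂v, ∂v')` are related by an element of the group to be divided out. -/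
def Iso.Rel (s : Side) {v' : QForm R ε} (x y : Iso Z v v') : Prop :=
  ∃ (P P' : BMod R) (f : StTriple v v' P P') (hf : f.IsIso Z) (g : Isometry Z v v)
    (h : Isometry Z v' v') (hgf : (act g h f).IsIso Z),
    s.Allows g h ∧ x = Iso.mk ⟨P, P', f, hf⟩ ∧ y = Iso.mk ⟨P, P', act g h f, hgf⟩

/-- `x` and `y` in `Prim_m(v, w)` are related by an element of the group to be divided out, which
acts by `(g, h) · (j, j') = (j ∘ g^{-1}, j' ∘ h^{-1})`. -/
def PrimM.Rel (s : Side) (x y : PrimM Z v w m) : Prop :=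
  ∃ (E E' : TwoSided Z v w m) (g : Isometry Z v v) (h : Isometry Z w w),
    s.Allows g h ∧ x = PrimM.mk E ∧ y = PrimM.mk E' ∧
      E'.j = E.j ∘ₗ g.e.symm.toLinearMap ∧ E'.j' = E.j' ∘ₗ h.e.symm.toLinearMap

/-- The same for `Prim(v, w)`. -/
def Prim.Rel (s : Side) (x y : Prim Z v w) : Prop :=
  ∃ (m : QForm R ε) (E E' : TwoSided Z v w m) (g : Isometry Z v v) (h : Isometry Z w w),
    s.Allows g h ∧ x = Prim.mk E ∧ y = Prim.mk E' ∧
      E'.j = E.j ∘ₗ g.e.symm.toLinearMap ∧ E'.j' = E.j' ∘ₗ h.e.symm.toLinearMap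

/-- `lIso(∂v, ∂v')`, `rIso(∂v, ∂v')` and `bIso(∂v, ∂v')`. -/
def SIso (s : Side) (Z : AddSubgroup (RedK1 R)) (v v' : QForm R ε) :=
  Quot (Iso.Rel s (Z := Z) (v := v) (v' := v'))

/-- `lIso_m(∂v, ∂v')`, `rIso_m(∂v, ∂v')` and `bIso_m(∂v, ∂v')`. -/
def SIsoM (s : Side) (Z : AddSubgroup (RedK1 R)) (v v' m : QForm R ε) :=
  Quot (fun x y : IsoM Z v v' m => Iso.Rel s x.1 y.1)

/-- `lPrim(v, w)`, `rPrim(v, w)` and `bPrim(v, w)`. -/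
def SPrim (s : Side) (Z : AddSubgroup (RedK1 R)) (v w : QForm R ε) :=
  Quot (Prim.Rel s (Z := Z) (v := v) (w := w))

/-- `lPrim_m(v, w)`, `rPrim_m(v, w)` and `bPrim_m(v, w)`. -/
def SPrimM (s : Side) (Z : AddSubgroup (RedK1 R)) (v w m : QForm R ε) :=
  Quot (PrimM.Rel s (Z := Z) (v := v) (w := w) (m := m))

/-! ## From primitive embeddings to stable isomorphisms -/

/-- For a nonsingular form `(M, ψ)` with symmetrisation `φ`, the triple
`(1, φ, - φ^{-*} ψ φ^{-1}) : ∂(M, ψ) → (M, M^*)`. -/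
def trivialise (m : QForm R ε) (hm : m.Nonsingular) : Triple (bdry m) (triv ε m.M) where
  α := LinearEquiv.refl R m.M
  β := m.symmEquiv hm
  ν := -Q.pull (m.symmEquiv hm).symm.toLinearMap m.form

/-- The triple `(1, φ^{-1}, φ^{-*} ψ φ^{-1}) : (M, M^*) → ∂(M, ψ)`. -/
def untrivialise (m : QForm R ε) (hm : m.Nonsingular) : Triple (triv ε m.M) (bdry m) where
  α := LinearEquiv.refl R m.M
  β := (m.symmEquiv hm).symm
  ν := Q.pull (m.symmEquiv hm).symm.toLinearMap m.form

/-- A splitting of `0 → V → M → K^* → 0`, with maps `j` and `κ^* φ`: a section `σ` of `κ^* φ`.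
Here `κ : K → M` is the inclusion of the complement `j(V)^⊥`. The field `bij`, which expresses
exactness, is the bijectivity of `(j, σ) : V ⊕ K^* → M`. -/
structure Splitting (m : QForm R ε) {V K : Type u} [AddCommGroup V] [Module R V]
    [AddCommGroup K] [Module R K] (j : V →ₗ[R] m.M) (κ : K →ₗ[R] m.M) where
  σ : CDual R K →ₗ[R] m.M
  section_eq : ∀ ξ, dualMap κ (m.symm (σ ξ)) = ξ
  bij : Function.Bijective (j.coprod σ)

/-- The isomorphism `V ⊕ K ⊕ K^* → K ⊕ M` given by the product of matrices
`[[1, 0, 0], [κ, σ, j]] · [[- σ^* φ^* j, 1, - σ^* ψ^* σ], [0, 0, 1], [1, 0, 0]]`, where `ψ` is a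
representative of the form on `M` and `φ` its symmetrisation. In other words
`(x, y, ξ) ↦ (z, κ z + σ ξ + j x)` with `z = y - σ^* φ^* j x - σ^* ψ^* σ ξ`. -/
def hMap (m : QForm R ε) (ψ : m.M →ₗ[R] CDual R m.M) {V : Type u} [AddCommGroup V] [Module R V]
    {K : BMod R} {j : V →ₗ[R] m.M} {κ : K →ₗ[R] m.M} (S : Splitting m j κ) :
    (V × (K × CDual R K)) ≃ₗ[R] (K × m.M) :=
  let e : (V × CDual R K) ≃ₗ[R] m.M := LinearEquiv.ofBijective (j.coprod S.σ) S.bij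
  let c : (V × CDual R K) →ₗ[R] K :=
    (-(codual S.σ ∘ₗ flip m.symm ∘ₗ j)).coprod (-(codual S.σ ∘ₗ flip ψ ∘ₗ S.σ))
  { toFun := fun p => (p.2.1 + c (p.1, p.2.2), κ (p.2.1 + c (p.1, p.2.2)) + e (p.1, p.2.2))
    map_add' := fun p q => by
      have h : ((p + q).1, (p + q).2.2) = ((p.1, p.2.2) + (q.1, q.2.2) : V × CDual R K) := rfl
      rw [h]
      ext <;> simp only [map_add, Prod.fst_add, Prod.snd_add] <;> abel
    map_smul' := fun r p => by
      have h : ((r • p).1, (r • p).2.2) = (r • (p.1, p.2.2) : V × CDual R K) := rfl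
      rw [h]
      ext <;> simp only [map_smul, Prod.smul_fst, Prod.smul_snd, map_add, RingHom.id_apply,
        smul_add]
    invFun := fun q =>
      ((e.symm (q.2 - κ q.1)).1, (q.1 - c (e.symm (q.2 - κ q.1)), (e.symm (q.2 - κ q.1)).2))
    left_inv := fun p => by simp
    right_inv := fun q => by
      simp only [Prod.mk.eta, sub_add_cancel, LinearEquiv.apply_symm_apply, add_sub_cancel] }

/-- Crowley and Sixt's stable isomorphism
`f_j : ∂v ⊕ (M', M'^*) → ∂(-k) ⊕ (M, M^*)`, for a split isometric injection `j : v → m` into a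
nonsingular form `m = (M, ψ)` with complement `κ : k → m`, where `(M', ψ') = H_ε(K)`. It is the
composite of `1 ⊕ (1, φ'^{-1}, φ'^{-*} ψ' φ'^{-1})`, `∂h` and `1 ⊕ (1, φ, - φ^{-*} ψ φ^{-1})`. -/
def fj (v k : QForm R ε) (m : QForm R ε) (hm : m.Nonsingular) (ψ : m.M →ₗ[R] CDual R m.M)
    {j : v.M →ₗ[R] m.M} {κ : k.M →ₗ[R] m.M} (S : Splitting m j κ) :
    StTriple v k.neg (hyp ε k.M).M m.M :=
  ((Triple.id (bdry k.neg)).sum (trivialise m hm)).comp <|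
    Triple.comp (Y := (bdry v).sum (bdry (hyp ε k.M)))
      (⟨hMap m ψ S, hMap m ψ S, 0⟩ :
        Triple ((bdry v).sum (bdry (hyp ε k.M))) ((bdry k.neg).sum (bdry m)))
      ((Triple.id (bdry v)).sum (untrivialise (hyp ε k.M) (hyp_nonsingular k.M)))

/-- For a 2-sided primitive embedding, the isomorphism `j' : W ≃ j(V)^⊥`. -/
def TwoSided.toPerp (E : TwoSided Z v w m) : w.M ≃ₗ[R] orth E.j :=
  (LinearEquiv.ofInjective E.j' (by
    obtain ⟨p, hp⟩ := E.split'
    exact Function.LeftInverse.injective (g := p) fun x => LinearMap.congr_fun hp x)).trans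
    (LinearEquiv.ofEq _ _ E.orth_eq.symm)

/-- The form `v^⊥ = (j(V)^⊥, θ^⊥)` obtained by restricting the form `m`. -/
abbrev TwoSided.perp (E : TwoSided Z v w m) : QForm R ε where
  M := w.M.transport E.toPerp
  form := Q.pull (orth E.j).subtype m.form

/-- The inclusion `j^⊥ : V^⊥ → M`. -/
def TwoSided.perpIncl (E : TwoSided Z v w m) : E.perp.M →ₗ[R] m.M := (orth E.j).subtype

/-- For a 2-sided primitive embedding `(j, j')` of `v` and `-v'` in `m`, the triple
`δ(j, j') = (∂j'^{-1} ⊕ 1) ∘ f_j`, where `j'^{-1} : -v^⊥ → v'`. It depends on a representative `ψ`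
of the form on `M` and on a splitting. -/
def TwoSided.delta {v' : QForm R ε} (E : TwoSided Z v v'.neg m) (ψ : m.M →ₗ[R] CDual R m.M)
    (S : Splitting m E.j E.perpIncl) : StTriple v v' (hyp ε E.perp.M).M m.M :=
  ((Triple.bdry (v := E.perp.neg) (w := v') E.toPerp.symm).sum (Triple.id (triv ε m.M))).comp
    (fj v E.perp m E.simple.nonsingular ψ S)

/-! ## The maps `Pr` and `δ` -/

/-- `Pr : Iso_m(∂v, ∂v') → Prim_m(v, -v')` is the map that sends `[f]` to
the class of `(k ∘ (1, 0), k ∘ (b, -λ'))`, for every representative `f` and every isometry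
`k : v ∪_f -v' ≃ m`; in particular this pair is a 2-sided primitive embedding. -/
def IsPrM {v' : QForm R ε} (Pr : IsoM Z v v' m → PrimM Z v v'.neg m) : Prop :=
  ∀ (f : StableIso Z v v') (k : Isometry Z (union f.f) m),
    ∃ E : TwoSided Z v v'.neg m, E.j = k.e.toLinearMap ∘ₗ unionInl f.f ∧
      E.j' = k.e.toLinearMap ∘ₗ unionInr f.f ∧ Pr (IsoM.mk f k) = PrimM.mk E

/-- `Pr : Iso(∂v, ∂v') → Prim(v, -v')` is the map that sends `[f]` to the class of
`v → v ∪_f -v' ← -v'`, with maps `(1, 0)` and `(b, -λ')`. -/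
def IsPr {v' : QForm R ε} (Pr : Iso Z v v' → Prim Z v v'.neg) : Prop :=
  ∀ f : StableIso Z v v',
    ∃ E : TwoSided Z v v'.neg (union f.f), E.j = unionInl f.f ∧ E.j' = unionInr f.f ∧
      Pr (Iso.mk f) = Prim.mk E

/-- `δ : Prim_m(v, -v') → Iso_m(∂v, ∂v')` is the map that sends `[(j, j')]` to the class of
`(∂j'^{-1} ⊕ 1) ∘ f_j`, for every `(j, j')` and every choice in the construction of `f_j`;
in particular this triple is a stable isomorphism. -/
def IsDeltaM {v' : QForm R ε} (δ : PrimM Z v v'.neg m → IsoM Z v v' m) : Prop :=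
  ∀ (E : TwoSided Z v v'.neg m) (ψ : m.M →ₗ[R] CDual R m.M) (S : Splitting m E.j E.perpIncl),
    Q.mk ψ = m.form → ∃ h : (E.delta ψ S).IsIso Z, (δ (PrimM.mk E)).1 = Iso.mk ⟨_, _, E.delta ψ S, h⟩

/-- `δ : Prim(v, -v') → Iso(∂v, ∂v')` is the map that sends the class of `(j, j')` to the class of
`(∂j'^{-1} ⊕ 1) ∘ f_j`. -/
def IsDelta {v' : QForm R ε} (δ : Prim Z v v'.neg → Iso Z v v') : Prop :=
  ∀ (m : QForm R ε) (E : TwoSided Z v v'.neg m) (ψ : m.M →ₗ[R] CDual R m.M)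
    (S : Splitting m E.j E.perpIncl),
    Q.mk ψ = m.form → ∃ h : (E.delta ψ S).IsIso Z, δ (Prim.mk E) = Iso.mk ⟨_, _, E.delta ψ S, h⟩

end Prim

end PrimEmb

end

open PrimEmb

noncomputable section

namespace PrimEmb

/-! ## Torsion of isomorphisms of framed modules -/

section Torsion

variable {R : Type u} [Ring R]

/-! The union of $f$ depends only on the upper left entries $a$, $b$, $s$. The upper left entries of
the three equations of an isomorphism show that $(1,0)$ and $(b,-\lambda')$ embed $v$ and $-v'$
isometrically in $v\cup_f-v'$, and that pairing with $(b,-\lambda')$ is the projection to $V'^*$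
(`union_symm_unionInr`). The other entries of $f$ serve to show that the complement of $V$ is
exactly the image of $V'$ (`union_orth`) and that the union is simple (`union_simple`): its
symmetrisation plus the identity of $P'^*$ is a product of simple isomorphisms, among them
$\alpha^*$, $\beta$ and some shears.

An isomorphism between the embedding pairs of two unions fixes $V$ and preserves the projection to
$V'^*$, because that projection is the pairing with the second embedding. Hence it is a shear
$(x,\xi)\mapsto(x+D\xi,\xi)$. The conditions on $D$, collected in `Linked`, are the upper left
corner of the equations of a homotopy $\Delta$ for which $\Delta^*$ has corner $D$. Conversely, once
both stable isomorphisms use the same trivial summands, $D$ extends to a homotopy: on a trivial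
formation $\delta$ is an identity, which prescribes the other blocks of $\Delta^*$
(`Linked.homotopic`). Common trivial summands are available after stabilisation. So stable homotopy
is the same as isomorphism of embedding pairs (`stablyHomotopic_iff`), and $\operatorname{Pr}$ is
well defined and injective before any group is divided out.

For the stable isomorphism built from $(j,j')$ one finds $a=-\sigma^*\phi^*j$ and
$s=-\sigma^*\psi\sigma$, up to the identification of $V'$ with $V^\perp$. Therefore $(x,\xi)\mapsto
jx-\sigma\xi$ is an isometry from the union to $m$. It carries $(1,0)$ to $j$, but $(b,-\lambda')$
to $-j'$ (`TwoSided.exists_isometry_delta`). Thus $\operatorname{Pr}\circ\delta$ is not the identity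
but the sign change $[(j,j')]\mapsto[(j,-j')]$ (`pr_delta`). The sign change is an involution, so
$\operatorname{Pr}$ is onto, and $\delta$ is $\operatorname{Pr}^{-1}$ composed with the sign change;
in particular it does not depend on $\sigma$ or $\psi$.

In the quotients the sign disappears (`Prim.rel_twist`): $-1$ is an isometry of $-v'$, and $-1$ on
$m$ carries $(-j,j')$ to $(j,-j')$, so $-1\in\operatorname{Aut}(v)$ has the same effect. As
$\operatorname{Pr}$ is equivariant (`pr_rel_iff`), the descended maps are mutually inverse. The
version with fixed $m$ follows from the injection of $\operatorname{Prim}_m$ into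
$\operatorname{Prim}$.

The torsion bookkeeping rests on shears and exchanges of summands having no torsion in the reduced
$K_1$, and on the invariance of $Z$ for duals. -/

theorem k1Class_trans {n : ℕ} (f g : (Fin n → R) ≃ₗ[R] (Fin n → R)) :
    k1Class (f.trans g) = k1Class f + k1Class g := by
  have h : (QuotientAddGroup.mk (FreeAbelianGroup.of (⟨n, f.trans g⟩ : FreeAut R)
        - FreeAbelianGroup.of (⟨n, f⟩ : FreeAut R) - FreeAbelianGroup.of (⟨n, g⟩ : FreeAut R)) :
      RedK1 R) = 0 :=
    (QuotientAddGroup.eq_zero_iff _).2 (AddSubgroup.subset_closure (K1Rel.mul n f g))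
  have h' : k1Class (f.trans g) - k1Class f - k1Class g = 0 := h
  rw [sub_sub, sub_eq_zero] at h'
  exact h'

theorem k1Class_stab (n k : ℕ) (f : (Fin n → R) ≃ₗ[R] (Fin n → R)) :
    k1Class ((finAdd R n k).symm.trans
      ((LinearEquiv.prodCongr f (LinearEquiv.refl R _)).trans (finAdd R n k))) = k1Class f := by
  have h : k1Class ((finAdd R n k).symm.trans
      ((LinearEquiv.prodCongr f (LinearEquiv.refl R _)).trans (finAdd R n k))) - k1Class f = 0 :=
    (QuotientAddGroup.eq_zero_iff _).2 (AddSubgroup.subset_closure (K1Rel.stab n k f))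
  exact sub_eq_zero.1 h

theorem k1Class_neg_one : k1Class (LinearEquiv.neg R : (Fin 1 → R) ≃ₗ[R] (Fin 1 → R)) = 0 :=
  (QuotientAddGroup.eq_zero_iff _).2 (AddSubgroup.subset_closure K1Rel.sign)

theorem k1Class_refl (n : ℕ) : k1Class (LinearEquiv.refl R (Fin n → R)) = 0 := by
  have h := k1Class_trans (LinearEquiv.refl R (Fin n → R)) (LinearEquiv.refl R (Fin n → R))
  rw [LinearEquiv.refl_trans] at h
  simpa using h

theorem k1Class_symm {n : ℕ} (f : (Fin n → R) ≃ₗ[R] (Fin n → R)) :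
    k1Class f.symm = -k1Class f := by
  have h := k1Class_trans f f.symm
  rw [LinearEquiv.self_trans_symm, k1Class_refl] at h
  exact (neg_eq_of_add_eq_zero_right h.symm).symm

/-- The torsion of an isomorphism of standard free modules of the same rank lies in `Z`. -/
def GoodMatrix (Z : AddSubgroup (RedK1 R)) {a b : ℕ} (A : (Fin a → R) ≃ₗ[R] (Fin b → R)) : Prop :=
  ∃ h : a = b, k1Class (A.trans (LinearEquiv.funCongrLeft R R (finCongr h))) ∈ Z

theorem goodMatrix_iff {Z : AddSubgroup (RedK1 R)} {a : ℕ} (A : (Fin a → R) ≃ₗ[R] (Fin a → R)) :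
    GoodMatrix Z A ↔ k1Class A ∈ Z :=
  ⟨fun ⟨_, h⟩ => h, fun h => ⟨rfl, h⟩⟩

variable {Z : AddSubgroup (RedK1 R)}

theorem GoodMatrix.refl (n : ℕ) : GoodMatrix Z (LinearEquiv.refl R (Fin n → R)) :=
  (goodMatrix_iff _).2 (by rw [k1Class_refl]; exact Z.zero_mem)

theorem GoodMatrix.trans {a b c : ℕ} {A : (Fin a → R) ≃ₗ[R] (Fin b → R)}
    {B : (Fin b → R) ≃ₗ[R] (Fin c → R)} (hA : GoodMatrix Z A) (hB : GoodMatrix Z B) :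
    GoodMatrix Z (A.trans B) := by
  -- `id` lets the equality of ranks be substituted while `hA` itself stays available.
  obtain ⟨rfl, -⟩ := id hA
  obtain ⟨rfl, -⟩ := id hB
  rw [goodMatrix_iff] at *
  rw [k1Class_trans]
  exact Z.add_mem hA hB

theorem GoodMatrix.symm {a b : ℕ} {A : (Fin a → R) ≃ₗ[R] (Fin b → R)} (hA : GoodMatrix Z A) :
    GoodMatrix Z A.symm := by
  obtain ⟨rfl, -⟩ := id hA
  rw [goodMatrix_iff] at *
  rw [k1Class_symm]
  exact Z.neg_mem hA

/-- Equality of ranks is part of the condition, and $a+k=b+k$ forces $a=b$. Read from left to right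
this cancels an identity summand. -/
theorem GoodMatrix.stab_iff {a b : ℕ} (k : ℕ) {A : (Fin a → R) ≃ₗ[R] (Fin b → R)} :
    GoodMatrix Z ((finAdd R a k).symm.trans
      ((LinearEquiv.prodCongr A (LinearEquiv.refl R _)).trans (finAdd R b k))) ↔
      GoodMatrix Z A := by
  constructor
  · intro h
    obtain ⟨h', -⟩ := id h
    obtain rfl : a = b := by omega
    rw [goodMatrix_iff] at *
    rwa [k1Class_stab] at h
  · intro h
    obtain ⟨rfl, -⟩ := id h
    rw [goodMatrix_iff] at *
    rwa [k1Class_stab]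

/-- Conjugation is invisible in an abelian group, so nothing is required of the torsion of $p$. -/
theorem GoodMatrix.conj {a b : ℕ} (h : a = b) {A : (Fin a → R) ≃ₗ[R] (Fin a → R)}
    (hA : GoodMatrix Z A) (p : (Fin a → R) ≃ₗ[R] (Fin b → R)) :
    GoodMatrix Z (p.symm.trans (A.trans p)) := by
  subst h
  rw [goodMatrix_iff] at *
  rw [k1Class_trans, k1Class_trans, k1Class_symm]
  simpa using hA

theorem GoodMatrix.of_apply {a b : ℕ} (h : b = a) {A : (Fin a → R) ≃ₗ[R] (Fin b → R)}
    (hA : ∀ x i, A x i = x (Fin.cast h i)) : GoodMatrix Z A := by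
  subst h
  have : A = LinearEquiv.refl R _ := LinearEquiv.ext fun x => funext fun i => hA x i
  rw [this]
  exact GoodMatrix.refl _

/-- A module with a chosen isomorphism to a standard free module. -/
class Framed (R : Type u) [Ring R] (X : Type*) [AddCommGroup X] [Module R X] where
  rk : ℕ
  frame : X ≃ₗ[R] (Fin rk → R)

instance (n : ℕ) : Framed R (Fin n → R) := ⟨n, LinearEquiv.refl R _⟩

variable {X Y W X' Y' : Type*} [AddCommGroup X] [Module R X] [AddCommGroup Y] [Module R Y]
  [AddCommGroup W] [Module R W] [AddCommGroup X'] [Module R X'] [AddCommGroup Y'] [Module R Y']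

instance [Framed R X] [Framed R Y] : Framed R (X × Y) :=
  ⟨Framed.rk R X + Framed.rk R Y,
    (LinearEquiv.prodCongr Framed.frame Framed.frame).trans (finAdd R _ _)⟩

variable [Framed R X] [Framed R Y] [Framed R W] [Framed R X'] [Framed R Y']

/-- The matrix of an isomorphism with respect to the frames. -/
def frameMatrix (f : X ≃ₗ[R] Y) : (Fin (Framed.rk R X) → R) ≃ₗ[R] (Fin (Framed.rk R Y) → R) :=
  Framed.frame.symm.trans (f.trans Framed.frame)

/-- The torsion of an isomorphism of framed modules lies in `Z`. -/
def Good (Z : AddSubgroup (RedK1 R)) (f : X ≃ₗ[R] Y) : Prop := GoodMatrix Z (frameMatrix f)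

theorem Good.congr {f g : X ≃ₗ[R] Y} (hf : Good Z f) (h : ∀ x, g x = f x) : Good Z g := by
  rwa [LinearEquiv.ext h]

/-- Covers the isomorphisms with identity matrix; the cast allows ranks that are equal only
propositionally, as for associativity. -/
theorem Good.of_frame {f : X ≃ₗ[R] Y} (h : Framed.rk R Y = Framed.rk R X)
    (hf : ∀ x i, (Framed.frame (f x) : Fin _ → R) i = (Framed.frame x : Fin _ → R) (Fin.cast h i)) :
    Good Z f :=
  GoodMatrix.of_apply h fun x i => by
    have := hf (Framed.frame.symm x) i
    rwa [LinearEquiv.apply_symm_apply] at this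

theorem Good.refl : Good Z (LinearEquiv.refl R X) := Good.of_frame rfl fun _ _ => rfl

theorem Good.trans {f : X ≃ₗ[R] Y} {g : Y ≃ₗ[R] W} (hf : Good Z f) (hg : Good Z g) :
    Good Z (f.trans g) := by
  have h : frameMatrix (f.trans g) = (frameMatrix f).trans (frameMatrix g) :=
    LinearEquiv.ext fun x => by simp [frameMatrix]
  rw [Good, h]
  exact GoodMatrix.trans hf hg

theorem Good.symm {f : X ≃ₗ[R] Y} (hf : Good Z f) : Good Z f.symm := by
  have h : frameMatrix f.symm = (frameMatrix f).symm :=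
    LinearEquiv.ext fun x => by simp [frameMatrix]
  rw [Good, h]
  exact GoodMatrix.symm hf

theorem Good.rk_eq {f : X ≃ₗ[R] Y} (hf : Good Z f) : Framed.rk R X = Framed.rk R Y := hf.1

theorem frameMatrix_prod_refl (f : X ≃ₗ[R] Y) :
    frameMatrix (LinearEquiv.prodCongr f (LinearEquiv.refl R W)) =
      (finAdd R _ _).symm.trans
      ((LinearEquiv.prodCongr (frameMatrix f) (LinearEquiv.refl R _)).trans (finAdd R _ _)) := by
  refine LinearEquiv.ext fun x => ?_
  change finAdd R _ _ (_, _) = finAdd R _ _ (_, _)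
  congr 1
  ext1
  · rfl
  · exact LinearEquiv.apply_symm_apply _ _

theorem Good.prod_refl {f : X ≃ₗ[R] Y} (hf : Good Z f) :
    Good Z (LinearEquiv.prodCongr f (LinearEquiv.refl R W)) := by
  rw [Good, frameMatrix_prod_refl, GoodMatrix.stab_iff]
  exact hf

theorem Good.of_prod_refl {f : X ≃ₗ[R] Y}
    (hf : Good Z (LinearEquiv.prodCongr f (LinearEquiv.refl R W))) : Good Z f := by
  rw [Good, frameMatrix_prod_refl, GoodMatrix.stab_iff] at hf
  exact hf

theorem Good.conj {f : X ≃ₗ[R] X} (hf : Good Z f) (h : Framed.rk R X = Framed.rk R Y)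
    (p : X ≃ₗ[R] Y) : Good Z (p.symm.trans (f.trans p)) := by
  have h' := GoodMatrix.conj h hf (frameMatrix p)
  have : frameMatrix (p.symm.trans (f.trans p)) =
      (frameMatrix p).symm.trans ((frameMatrix f).trans (frameMatrix p)) :=
    LinearEquiv.ext fun x => by simp [frameMatrix]
  rwa [Good, this]

/-- No torsion condition on $f$ or $g$: commutators die in $K_1$. This is the source of the
triviality of shears. -/
theorem Good.commutator (f g : X ≃ₗ[R] X) :
    Good Z (f.trans (g.trans (f.symm.trans g.symm))) := by
  have h : frameMatrix (f.trans (g.trans (f.symm.trans g.symm))) =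
      (frameMatrix f).trans ((frameMatrix g).trans
        ((frameMatrix f).symm.trans (frameMatrix g).symm)) :=
    LinearEquiv.ext fun x => by simp [frameMatrix]
  rw [Good, h, goodMatrix_iff, k1Class_trans, k1Class_trans, k1Class_trans, k1Class_symm,
    k1Class_symm]
  simp

/-- The isomorphism of framed modules of the same rank with identity matrix. -/
def frameCast (h : Framed.rk R Y = Framed.rk R X) : X ≃ₗ[R] Y :=
  Framed.frame.trans ((LinearEquiv.funCongrLeft R R (finCongr h)).trans Framed.frame.symm)

theorem frame_frameCast (h : Framed.rk R Y = Framed.rk R X) (x : X) (i : Fin (Framed.rk R Y)) :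
    (Framed.frame (frameCast h x) : Fin _ → R) i = (Framed.frame x : Fin _ → R) (Fin.cast h i) := by
  simp [frameCast, LinearEquiv.funCongrLeft]

theorem finAdd_castAdd {a b : ℕ} (x : (Fin a → R) × (Fin b → R)) (i : Fin a) :
    finAdd R a b x (Fin.castAdd b i) = x.1 i := by
  simp only [finAdd, LinearEquiv.trans_apply, LinearEquiv.funCongrLeft_apply,
    LinearMap.funLeft_apply, finSumFinEquiv_symm_apply_castAdd]
  rfl

theorem finAdd_natAdd {a b : ℕ} (x : (Fin a → R) × (Fin b → R)) (i : Fin b) :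
    finAdd R a b x (Fin.natAdd a i) = x.2 i := by
  simp only [finAdd, LinearEquiv.trans_apply, LinearEquiv.funCongrLeft_apply,
    LinearMap.funLeft_apply, finSumFinEquiv_symm_apply_natAdd]
  rfl

theorem finAdd_apply_of_lt {a b : ℕ} (x : (Fin a → R) × (Fin b → R)) (i : Fin (a + b))
    (h : i.1 < a) : finAdd R a b x i = x.1 ⟨i, h⟩ :=
  finAdd_castAdd x ⟨i, h⟩

theorem finAdd_apply_of_ge {a b : ℕ} (x : (Fin a → R) × (Fin b → R)) (i : Fin (a + b))
    (h : ¬ i.1 < a) : finAdd R a b x i = x.2 ⟨i - a, by omega⟩ := by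
  have := finAdd_natAdd x ⟨i - a, by omega⟩
  rw [← this]
  exact congrArg _ (Fin.ext (by simp; omega))

theorem Good.refl_prod_frameCast (h : Framed.rk R Y = Framed.rk R X) :
    Good Z (LinearEquiv.prodCongr (LinearEquiv.refl R W) (frameCast h : X ≃ₗ[R] Y)) := by
  refine Good.of_frame (congrArg (Framed.rk R W + ·) h) fun x i => ?_
  change finAdd R _ _ (_, _) _ = finAdd R _ _ (_, _) _
  by_cases hi : i.1 < Framed.rk R W
  · rw [finAdd_apply_of_lt _ _ hi, finAdd_apply_of_lt _ _ (by exact hi)]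
    rfl
  · rw [finAdd_apply_of_ge _ _ hi, finAdd_apply_of_ge _ _ (by exact hi)]
    exact frame_frameCast h _ _

/-- For an automorphism, $1\oplus f$ is the conjugate of $f\oplus1$ by the exchange of summands,
whose own torsion is not needed. A general $f$ is first made an automorphism by composing with an
isomorphism with identity matrix. -/
theorem Good.refl_prod {f : X ≃ₗ[R] Y} (hf : Good Z f) :
    Good Z (LinearEquiv.prodCongr (LinearEquiv.refl R W) f) := by
  have hc : Good Z (frameCast hf.rk_eq.symm : X ≃ₗ[R] Y) :=
    Good.of_frame hf.rk_eq.symm fun x i => frame_frameCast _ _ _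
  have h1 : Good Z (f.trans (frameCast hf.rk_eq.symm : X ≃ₗ[R] Y).symm) := hf.trans hc.symm
  have h2 := (h1.prod_refl (W := W)).conj (Y := W × X) (Nat.add_comm _ _)
    (LinearEquiv.prodComm R X W)
  refine (h2.trans (Good.refl_prod_frameCast (W := W) hf.rk_eq.symm)).congr fun x => ?_
  ext <;> simp

theorem Good.prodCongr {f : X ≃ₗ[R] Y} {g : X' ≃ₗ[R] Y'} (hf : Good Z f) (hg : Good Z g) :
    Good Z (LinearEquiv.prodCongr f g) :=
  ((hf.prod_refl (W := X')).trans (hg.refl_prod (W := Y))).congr fun x => by ext <;> simp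

theorem finAdd_assoc {a b c : ℕ} (x : Fin a → R) (y : Fin b → R) (w : Fin c → R)
    (i : Fin (a + (b + c))) :
    finAdd R a (b + c) (x, finAdd R b c (y, w)) i =
      finAdd R (a + b) c (finAdd R a b (x, y), w) (Fin.cast (Nat.add_assoc a b c).symm i) := by
  by_cases h1 : i.1 < a
  · rw [finAdd_apply_of_lt _ _ h1, finAdd_apply_of_lt _ _ (by rw [Fin.val_cast]; omega)]
    exact (finAdd_apply_of_lt (x, y) ⟨i.1, Nat.lt_add_right b h1⟩ h1).symm
  · rw [finAdd_apply_of_ge _ _ h1]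
    by_cases h2 : i.1 - a < b
    · rw [finAdd_apply_of_lt _ (Fin.cast _ i) (by rw [Fin.val_cast]; omega)]
      exact (finAdd_apply_of_lt (y, w) _ h2).trans
        (finAdd_apply_of_ge (x, y) ⟨i.1, by omega⟩ h1).symm
    · rw [finAdd_apply_of_ge _ (Fin.cast _ i) (by rw [Fin.val_cast]; omega)]
      refine (finAdd_apply_of_ge (y, w) _ h2).trans ?_
      simp [Nat.sub_sub]

theorem Good.assoc : Good Z (LinearEquiv.prodAssoc R X Y W) :=
  Good.of_frame (Nat.add_assoc _ _ _).symm fun _ i => finAdd_assoc _ _ _ i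

/-- The shear `(x, y) ↦ (x, y + c x)`. -/
def shear {X Y : Type*} [AddCommGroup X] [Module R X] [AddCommGroup Y] [Module R Y]
    (c : X →ₗ[R] Y) : (X × Y) ≃ₗ[R] (X × Y) :=
  LinearEquiv.skewProd (LinearEquiv.refl R X) (LinearEquiv.refl R Y) c

/-- The shear `(x, y) ↦ (x + c y, y)`. -/
def shear' {X Y : Type*} [AddCommGroup X] [Module R X] [AddCommGroup Y] [Module R Y]
    (c : Y →ₗ[R] X) : (X × Y) ≃ₗ[R] (X × Y) :=
  (LinearEquiv.prodComm R X Y).trans ((shear c).trans (LinearEquiv.prodComm R Y X))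

@[simp] theorem shear_apply {X Y : Type*} [AddCommGroup X] [Module R X] [AddCommGroup Y]
    [Module R Y] (c : X →ₗ[R] Y) (p : X × Y) : shear c p = (p.1, p.2 + c p.1) := rfl

@[simp] theorem shear_symm_apply {X Y : Type*} [AddCommGroup X] [Module R X] [AddCommGroup Y]
    [Module R Y] (c : X →ₗ[R] Y) (p : X × Y) : (shear c).symm p = (p.1, p.2 - c p.1) := rfl

@[simp] theorem shear'_apply {X Y : Type*} [AddCommGroup X] [Module R X] [AddCommGroup Y]
    [Module R Y] (c : Y →ₗ[R] X) (p : X × Y) : shear' c p = (p.1 + c p.2, p.2) := rfl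

@[simp] theorem shear'_symm_apply {X Y : Type*} [AddCommGroup X] [Module R X] [AddCommGroup Y]
    [Module R Y] (c : Y →ₗ[R] X) (p : X × Y) : (shear' c).symm p = (p.1 - c p.2, p.2) := rfl

/-- The identity $e_{21}(c)=[e_{23}(1),e_{31}(-c)]$ of elementary matrices, up to conventions, after
adding a second copy of $Y$ to make room. -/
theorem Good.shear (c : X →ₗ[R] Y) : Good Z (shear c) := by
  let A : ((X × Y) × Y) ≃ₗ[R] ((X × Y) × Y) := PrimEmb.shear' (LinearMap.inr R X Y)
  let B : ((X × Y) × Y) ≃ₗ[R] ((X × Y) × Y) :=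
    PrimEmb.shear (-c ∘ₗ LinearMap.fst R X Y)
  refine Good.of_prod_refl (W := Y) ((Good.commutator A B).congr ?_)
  rintro ⟨⟨x, y⟩, z⟩
  simp only [A, B, LinearEquiv.trans_apply, LinearEquiv.prodCongr_apply, shear_apply,
    shear'_apply, shear_symm_apply, shear'_symm_apply, LinearEquiv.refl_apply]
  simp
  abel

theorem Good.shear' (c : Y →ₗ[R] X) : Good Z (shear' c) :=
  ((Good.shear c).conj (Y := X × Y) (Nat.add_comm _ _) (LinearEquiv.prodComm R Y X)).congr
    fun _ => rfl

theorem Good.neg_fin (n : ℕ) : Good Z (LinearEquiv.neg R : (Fin n → R) ≃ₗ[R] (Fin n → R)) := by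
  induction n with
  | zero => exact Good.refl.congr fun x => Subsingleton.elim _ _
  | succ n ih =>
    have h1 : Good Z (LinearEquiv.neg R : (Fin 1 → R) ≃ₗ[R] (Fin 1 → R)) := by
      refine (goodMatrix_iff _).2 ?_
      have : frameMatrix (LinearEquiv.neg R : (Fin 1 → R) ≃ₗ[R] (Fin 1 → R)) =
        LinearEquiv.neg R := rfl
      rw [this]
      exact (k1Class_neg_one (R := R)).symm ▸ Z.zero_mem
    have h2 : Good Z (finAdd R n 1) := Good.of_frame rfl fun _ _ => rfl
    refine (h2.symm.trans ((ih.prodCongr h1).trans h2)).congr fun x => ?_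
    obtain ⟨x, rfl⟩ := (finAdd R n 1).surjective x
    simp only [LinearEquiv.neg_apply, LinearEquiv.trans_apply, LinearEquiv.symm_apply_apply,
      ← map_neg]
    rfl

theorem Good.frame : Good Z (Framed.frame : X ≃ₗ[R] _) := Good.of_frame rfl fun _ _ => rfl

theorem Good.neg : Good Z (LinearEquiv.neg R : X ≃ₗ[R] X) :=
  (Good.frame.trans ((Good.neg_fin _).trans Good.frame.symm)).congr fun x => by simp

/-- The automorphism `(x, y) ↦ (x + i (y - p x), p x)` that exchanges the summand `i Y` of `X`
with `Y`. -/
def exchange {X Y : Type*} [AddCommGroup X] [Module R X] [AddCommGroup Y] [Module R Y]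
    (i : Y →ₗ[R] X) (p : X →ₗ[R] Y) : (X × Y) ≃ₗ[R] (X × Y) :=
  (PrimEmb.shear (-p)).trans ((PrimEmb.shear' i).trans
    ((PrimEmb.shear (-p)).trans
      (LinearEquiv.prodCongr (LinearEquiv.refl R X) (LinearEquiv.neg R))))

theorem exchange_apply {X Y : Type*} [AddCommGroup X] [Module R X] [AddCommGroup Y] [Module R Y]
    (i : Y →ₗ[R] X) (p : X →ₗ[R] Y) (h : ∀ y, p (i y) = y) (x : X × Y) :
    exchange i p x = (x.1 + i (x.2 - p x.1), p x.1) := by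
  ext <;> simp [exchange, sub_eq_add_neg, h]

theorem Good.exchange (i : Y →ₗ[R] X) (p : X →ₗ[R] Y) : Good Z (exchange i p) :=
  (Good.shear _).trans ((Good.shear' _).trans ((Good.shear _).trans (Good.refl.prodCongr Good.neg)))

/-- The exchange is a product of three shears and a sign; the sign is trivial because the reduced
group kills $-1$. -/
theorem Good.comm_self : Good Z (LinearEquiv.prodComm R X X) :=
  (Good.exchange LinearMap.id LinearMap.id).congr fun x => by
    rw [exchange_apply _ _ (fun _ => rfl)]
    ext <;> simp

theorem Good.comm_of_prod (h₁ : Good Z (LinearEquiv.prodComm R X Y))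
    (h₂ : Good Z (LinearEquiv.prodComm R X' Y)) : Good Z (LinearEquiv.prodComm R (X × X') Y) :=
  (Good.assoc.trans <| (h₂.refl_prod).trans <| Good.assoc.symm.trans <|
    h₁.prod_refl.trans Good.assoc).congr fun _ => rfl

theorem Good.comm_congr (h : Good Z (LinearEquiv.prodComm R X Y)) {f : X ≃ₗ[R] X'}
    {g : Y ≃ₗ[R] Y'} (hf : Good Z f) (hg : Good Z g) : Good Z (LinearEquiv.prodComm R X' Y') :=
  ((hf.symm.prodCongr hg.symm).trans (h.trans (hg.prodCongr hf))).congr fun x => by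
    ext <;> simp

theorem Good.comm_zero : Good Z (LinearEquiv.prodComm R (Fin 0 → R) X) := by
  refine Good.of_frame (Nat.add_comm _ _) fun x i => ?_
  change finAdd R _ _ (_, _) _ = finAdd R _ _ (_, _) _
  rw [finAdd_apply_of_lt _ _ i.2, finAdd_apply_of_ge _ _ (by exact Nat.not_lt_zero _)]
  rfl

theorem Good.finAdd (a b : ℕ) : Good Z (finAdd R a b) := Good.of_frame rfl fun _ _ => rfl

theorem Good.comm_fin_one (b : ℕ) : Good Z (LinearEquiv.prodComm R (Fin 1 → R) (Fin b → R)) := by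
  induction b with
  | zero => exact Good.comm_zero.symm
  | succ b ih =>
    exact (Good.comm_congr (Good.comm_of_prod ih.symm (Good.comm_self (X := Fin 1 → R)))
      (Good.finAdd b 1) Good.refl).symm

/-- Exchanges of blocks are products of exchanges of two copies of $R$, hence have no torsion
whatever the ranks. -/
theorem Good.comm_fin (a b : ℕ) : Good Z (LinearEquiv.prodComm R (Fin a → R) (Fin b → R)) := by
  induction a with
  | zero => exact Good.comm_zero
  | succ a ih =>
    exact Good.comm_congr (Good.comm_of_prod ih (Good.comm_fin_one b)) (Good.finAdd a 1) Good.refl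

theorem Good.comm : Good Z (LinearEquiv.prodComm R X Y) :=
  Good.comm_congr (Good.comm_fin _ _) Good.frame.symm Good.frame.symm

/-- Exchange of the last two factors. -/
def swapRight (R : Type u) [Ring R] (X Y W : Type*) [AddCommGroup X] [Module R X]
    [AddCommGroup Y] [Module R Y] [AddCommGroup W] [Module R W] :
    ((X × Y) × W) ≃ₗ[R] ((X × W) × Y) :=
  (LinearEquiv.prodAssoc R X Y W).trans
    ((LinearEquiv.prodCongr (LinearEquiv.refl R X) (LinearEquiv.prodComm R Y W)).trans
      (LinearEquiv.prodAssoc R X W Y).symm)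

theorem Good.swapRight : Good Z (swapRight R X Y W) :=
  Good.assoc.trans (Good.comm.refl_prod.trans Good.assoc.symm)

theorem Good.prodProdProdComm : Good Z (LinearEquiv.prodProdProdComm R X Y X' Y') :=
  (Good.assoc.symm.trans <| (Good.swapRight (X := X) (Y := Y) (W := X')).prod_refl.trans
    Good.assoc).congr fun _ => rfl

end Torsion

/-! ## Torsion and duality -/

section Single

variable {R : Type u} [Ring R]

theorem finAdd_symm_single_castAdd (a b : ℕ) (i : Fin a) :
    (finAdd R a b).symm (Pi.single (Fin.castAdd b i) 1) = (Pi.single i 1, 0) := by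
  rw [LinearEquiv.symm_apply_eq]
  funext k
  refine Fin.addCases (fun k => ?_) (fun k => ?_) k
  · rw [finAdd_castAdd]
    simp [Pi.single_apply, Fin.ext_iff]
  · rw [finAdd_natAdd]
    have : Fin.natAdd a k ≠ Fin.castAdd b i := by
      simp only [ne_eq, Fin.ext_iff, Fin.val_natAdd, Fin.val_castAdd]
      omega
    simp [this]

theorem finAdd_symm_single_natAdd (a b : ℕ) (i : Fin b) :
    (finAdd R a b).symm (Pi.single (Fin.natAdd a i) 1) = (0, Pi.single i 1) := by
  rw [LinearEquiv.symm_apply_eq]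
  funext k
  refine Fin.addCases (fun k => ?_) (fun k => ?_) k
  · rw [finAdd_castAdd]
    have : Fin.castAdd b k ≠ Fin.natAdd a i := by
      simp only [ne_eq, Fin.ext_iff, Fin.val_natAdd, Fin.val_castAdd]
      omega
    simp [this]
  · rw [finAdd_natAdd]
    simp [Pi.single_apply, Fin.ext_iff]

end Single

section TorsionDual

variable {R : Type u} [Ring R] [StarRing R] {Z : AddSubgroup (RedK1 R)}
variable {X Y : Type*} [AddCommGroup X] [Module R X] [AddCommGroup Y] [Module R Y]

@[simp] theorem dualEquiv_apply (e : X ≃ₗ[R] Y) (φ : CDual R Y) (x : X) :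
    dualEquiv e φ x = φ (e x) := rfl

@[simp] theorem prodDual_apply (p : CDual R X × CDual R Y) (x : X × Y) :
    prodDual p x = p.1 x.1 + p.2 x.2 := rfl

theorem stdDual_apply (n : ℕ) (a x : Fin n → R) : stdDual R n a x = ∑ i, x i * star (a i) := rfl

variable [Framed R X] [Framed R Y]

instance : Framed R (CDual R X) :=
  ⟨Framed.rk R X, (dualEquiv Framed.frame).symm.trans (stdDual R _).symm⟩

theorem frame_dual (φ : CDual R X) (i : Fin (Framed.rk R X)) :
    Framed.frame (R := R) (X := CDual R X) φ i = star (φ (Framed.frame.symm (Pi.single i 1))) :=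
  rfl

/-- The invariance of $Z$ under conjugate transposition is applied here, and everywhere else only
through this lemma. -/
theorem GoodMatrix.dual (hZ : StarInvariant Z) {a b : ℕ} {A : (Fin a → R) ≃ₗ[R] (Fin b → R)}
    (hA : GoodMatrix Z A) :
    GoodMatrix Z ((stdDual R b).trans ((dualEquiv A).trans (stdDual R a).symm)) := by
  obtain ⟨rfl, -⟩ := id hA
  rw [goodMatrix_iff] at *
  exact hZ _ _ hA

theorem Good.dual (hZ : StarInvariant Z) {f : X ≃ₗ[R] Y} (hf : Good Z f) :
    Good Z (dualEquiv f) := by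
  have h : frameMatrix (dualEquiv f) = (stdDual R _).trans
      ((dualEquiv (frameMatrix f)).trans (stdDual R _).symm) :=
    LinearEquiv.ext fun _ => rfl
  rw [Good, h]
  exact GoodMatrix.dual hZ hf

theorem Good.stdDual (n : ℕ) : Good Z (PrimEmb.stdDual R n) :=
  Good.of_frame rfl fun x i => by
    refine (congrFun ((PrimEmb.stdDual R n).symm_apply_apply x) i)

theorem Good.prodDual : Good Z (prodDual : (CDual R X × CDual R Y) ≃ₗ[R] _) := by
  refine Good.of_frame rfl fun p i => ?_
  change star (PrimEmb.prodDual p ((LinearEquiv.prodCongr Framed.frame Framed.frame).symm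
    ((PrimEmb.finAdd R (Framed.rk R X) (Framed.rk R Y)).symm (Pi.single i 1)))) =
    PrimEmb.finAdd R (Framed.rk R X) (Framed.rk R Y)
      (Framed.frame (R := R) (X := CDual R X) p.1, Framed.frame (R := R) (X := CDual R Y) p.2) i
  refine Fin.addCases (fun k => ?_) (fun k => ?_) i
  · rw [finAdd_castAdd, finAdd_symm_single_castAdd]
    simp [frame_dual]
  · rw [finAdd_natAdd, finAdd_symm_single_natAdd]
    simp [frame_dual]

theorem Framed.ev_bijective : Function.Bijective (ev R X) :=
  ev_bijective_of_retract Framed.frame.toLinearMap Framed.frame.symm.toLinearMap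
    (fun x => by simp) (ev_std_bijective _)

theorem Good.ev {e : X ≃ₗ[R] CDual R (CDual R X)} (he : ∀ x, e x = ev R X x) : Good Z e := by
  refine Good.of_frame rfl fun x i => ?_
  rw [he]
  change star (PrimEmb.ev R X x (dualEquiv Framed.frame (PrimEmb.stdDual R _ (Pi.single i 1)))) = _
  simp [stdDual_apply, Pi.single_apply]

end TorsionDual

/-! ## Simple isomorphisms of based modules -/

section SimpleIso

variable {R : Type u} [Ring R] {Z : AddSubgroup (RedK1 R)}

/-- The free module `M ⊕ R^extra`, framed by the `s`-basis. -/
def Aug (M : BMod R) : Type u := M × (Fin M.extra → R)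

instance (M : BMod R) : AddCommGroup (Aug M) :=
  inferInstanceAs (AddCommGroup (M × (Fin M.extra → R)))
instance (M : BMod R) : Module R (Aug M) :=
  inferInstanceAs (Module R (M × (Fin M.extra → R)))
instance (M : BMod R) : Framed R (Aug M) := ⟨M.rank, M.sbasis⟩

/-- `M ⊕ R^extra`, as a framed module. -/
def aug (M : BMod R) : (M × (Fin M.extra → R)) ≃ₗ[R] Aug M := LinearEquiv.refl R _

variable {M N L M' N' : BMod R}

/-- The stabilisation `(M ⊕ R^(extra M)) ⊕ R^(extra N) ≃ (N ⊕ R^(extra N)) ⊕ R^(extra M)` of an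
isomorphism `M ≃ N`. -/
def stableIso (f : M ≃ₗ[R] N) : (Aug M × (Fin N.extra → R)) ≃ₗ[R] (Aug N × (Fin M.extra → R)) :=
  (LinearEquiv.prodCongr (aug M).symm (LinearEquiv.refl R _)).trans <|
    (swapRight R M (Fin M.extra → R) (Fin N.extra → R)).trans <|
    (LinearEquiv.prodCongr (LinearEquiv.prodCongr f (LinearEquiv.refl R _))
      (LinearEquiv.refl R _)).trans <|
    LinearEquiv.prodCongr (aug N) (LinearEquiv.refl R _)

theorem stableIso_apply (f : M ≃ₗ[R] N) (m : M) (x : Fin M.extra → R) (y : Fin N.extra → R) :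
    stableIso f (aug M (m, x), y) = (aug N (f m, y), x) := rfl

/-- Replaces explicit matrices by isomorphisms of framed modules, where no indices appear. -/
theorem isSimple_iff (f : M ≃ₗ[R] N) : IsSimple Z f ↔ Good Z (stableIso f) := by
  have h : frameMatrix (stableIso f) =
      (finAdd R M.rank N.extra).symm.trans ((stableMatrix f).trans (finAdd R N.rank M.extra)) :=
    rfl
  rw [Good, h]
  exact Iff.rfl

theorem IsSimple.congr {f g : M ≃ₗ[R] N} (hf : IsSimple Z f) (h : ∀ x, g x = f x) :
    IsSimple Z g := by
  rwa [LinearEquiv.ext h]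

/-- If `f ⊕ t` has torsion in `Z` and so has `t`, then `f` is simple. -/
theorem IsSimple.of_aug {f : M ≃ₗ[R] N} {t : (Fin M.extra → R) ≃ₗ[R] (Fin N.extra → R)}
    {F : Aug M ≃ₗ[R] Aug N} (ht : Good Z t) (hF : Good Z F)
    (h : ∀ m x, F (aug M (m, x)) = aug N (f m, t x)) : IsSimple Z f := by
  let i : (Fin N.extra → R) →ₗ[R] Aug N := (aug N).toLinearMap ∘ₗ LinearMap.inr R _ _
  let p : Aug N →ₗ[R] (Fin N.extra → R) := LinearMap.snd R _ _ ∘ₗ (aug N).symm.toLinearMap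
  have hp : ∀ y, p (i y) = y := fun y => rfl
  rw [isSimple_iff]
  -- The exchange trades the component $tx$ inside the free module of $N$ for the spare $y$; then
  -- $t^{-1}$ recovers $x$.
  refine (hF.prod_refl.trans ((Good.exchange i p).trans ht.symm.refl_prod)).congr ?_
  rintro ⟨m, y⟩
  obtain ⟨⟨m, x⟩, rfl⟩ := (aug M).surjective m
  rw [stableIso_apply]
  simp only [LinearEquiv.trans_apply, LinearEquiv.prodCongr_apply, h,
    LinearEquiv.refl_apply, exchange_apply i p hp]
  ext1
  · change aug N (f m, y) = aug N (f m, t x) + aug N (0, y - t x)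
    rw [← map_add]
    simp
  · exact (t.symm_apply_apply x).symm

theorem IsSimple.refl : IsSimple Z (LinearEquiv.refl R M) :=
  IsSimple.of_aug (t := LinearEquiv.refl R _) Good.refl Good.refl fun _ _ => rfl

theorem IsSimple.symm {f : M ≃ₗ[R] N} (hf : IsSimple Z f) : IsSimple Z f.symm := by
  rw [isSimple_iff] at *
  exact hf.symm.congr fun _ => rfl

/-- The stabilisations of $f$ and $g$ use different free summands; they become composable after
adding the free summand belonging to $N$, which is cancelled at the end. -/
theorem IsSimple.trans {f : M ≃ₗ[R] N} {g : N ≃ₗ[R] L} (hf : IsSimple Z f) (hg : IsSimple Z g) :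
    IsSimple Z (f.trans g) := by
  rw [isSimple_iff] at *
  refine Good.of_prod_refl (W := Fin N.extra → R) ?_
  refine (Good.swapRight.trans (hf.prod_refl.trans (Good.swapRight.trans
    (hg.prod_refl.trans Good.swapRight)))).congr ?_
  rintro ⟨⟨m, y⟩, z⟩
  rfl

/-- The free module of a sum is the sum of the free modules. -/
def augProd (M N : BMod R) : Aug (M.prod N) ≃ₗ[R] (Aug M × Aug N) :=
  (LinearEquiv.prodCongr (LinearEquiv.refl R (M × N)) (finAdd R M.extra N.extra).symm).trans <|
    (LinearEquiv.prodProdProdComm R M N (Fin M.extra → R) (Fin N.extra → R)).trans <|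
    LinearEquiv.prodCongr (aug M) (aug N)

/-- The element of `Aug (M ⊕ N)` with the given components. -/
def augPair (m : M) (n : N) (x : Fin M.extra → R) (y : Fin N.extra → R) : Aug (M.prod N) :=
  aug (M.prod N) ((m, n), finAdd R _ _ (x, y))

theorem augProd_pair (m : M) (n : N) (x : Fin M.extra → R) (y : Fin N.extra → R) :
    augProd M N (augPair m n x y) = (aug M (m, x), aug N (n, y)) := by
  change LinearEquiv.prodCongr (aug M) (aug N) (LinearEquiv.prodProdProdComm R M N _ _
    ((m, n), (finAdd R M.extra N.extra).symm (finAdd R _ _ (x, y)))) = _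
  rw [LinearEquiv.symm_apply_apply]
  rfl

theorem Good.augProd : Good Z (augProd M N) := Good.of_frame rfl fun _ _ => rfl

theorem augProd_symm_pair (m : M) (n : N) (x : Fin M.extra → R) (y : Fin N.extra → R) :
    (augProd M N).symm (aug M (m, x), aug N (n, y)) = augPair m n x y := by
  rw [LinearEquiv.symm_apply_eq, augProd_pair]

theorem augPair_surjective (z : Aug (M.prod N)) : ∃ m n x y, augPair (M := M) (N := N) m n x y = z := by
  obtain ⟨⟨⟨m, n⟩, x⟩, rfl⟩ := (aug _).surjective z
  obtain ⟨⟨x, y⟩, rfl⟩ := (finAdd R M.extra N.extra).surjective x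
  exact ⟨_, _, _, _, rfl⟩

theorem stableIso_pair (f : M ≃ₗ[R] N) (g : M' ≃ₗ[R] N') (m : M) (m' : M') (x : Fin M.extra → R)
    (x' : Fin M'.extra → R) (y : Fin N.extra → R) (y' : Fin N'.extra → R) :
    stableIso (M := M.prod M') (N := N.prod N') (LinearEquiv.prodCongr f g)
      (augPair m m' x x', finAdd R _ _ (y, y')) =
      (augPair (f m) (g m') y y', finAdd R _ _ (x, x')) := rfl

theorem IsSimple.prod {f : M ≃ₗ[R] N} {g : M' ≃ₗ[R] N'} (hf : IsSimple Z f) (hg : IsSimple Z g) :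
    IsSimple Z (M := M.prod M') (N := N.prod N') (LinearEquiv.prodCongr f g) := by
  rw [isSimple_iff] at *
  refine ((Good.augProd.prodCongr (Good.finAdd _ _).symm).trans <|
    Good.prodProdProdComm.trans <| (hf.prodCongr hg).trans <| Good.prodProdProdComm.trans <|
      (Good.augProd.symm.prodCongr (Good.finAdd _ _))).congr ?_
  rintro ⟨m, y⟩
  obtain ⟨⟨y, y'⟩, rfl⟩ := (PrimEmb.finAdd R _ _).surjective y
  obtain ⟨m, m', x, x', rfl⟩ := augPair_surjective m
  refine (stableIso_pair f g m m' x x' y y').trans ?_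
  simp only [LinearEquiv.trans_apply, LinearEquiv.prodCongr_apply, augProd_pair,
    LinearEquiv.symm_apply_apply, LinearEquiv.prodProdProdComm_apply, stableIso_apply,
    augProd_symm_pair]

/-- A sum with an isomorphism of based modules is simple only if the other summand is. -/
theorem IsSimple.of_prod_refl {f : M ≃ₗ[R] N}
    (h : IsSimple Z (M := M.prod L) (N := N.prod L)
      (LinearEquiv.prodCongr f (LinearEquiv.refl R L))) : IsSimple Z f := by
  have h' := (isSimple_iff _).1 h
  -- On $L$ the stabilised identity exchanges two free summands; `hL` is there to undo this.
  have hL := (isSimple_iff _).1 (IsSimple.refl (Z := Z) (M := L))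
  rw [isSimple_iff]
  refine Good.of_prod_refl (W := Aug L × (Fin L.extra → R)) ?_
  have h2 := ((Good.augProd.symm.prodCongr (Good.finAdd _ _)).trans <|
    h'.trans (Good.augProd.prodCongr (Good.finAdd _ _).symm))
  refine (Good.prodProdProdComm.trans <| h2.trans <| Good.prodProdProdComm.trans
    hL.symm.refl_prod).congr ?_
  rintro ⟨⟨m, y⟩, ⟨l, z⟩⟩
  obtain ⟨⟨m, x⟩, rfl⟩ := (aug _).surjective m
  obtain ⟨⟨l, w⟩, rfl⟩ := (aug _).surjective l
  simp only [LinearEquiv.trans_apply, LinearEquiv.prodProdProdComm_apply,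
    LinearEquiv.prodCongr_apply, augProd_symm_pair, stableIso_apply, LinearEquiv.refl_apply]
  have h3 := stableIso_pair f (LinearEquiv.refl R L) m l x w y z
  refine Eq.symm ?_
  rw [h3]
  simp only [augProd_pair, LinearEquiv.symm_apply_apply]
  rfl

theorem IsSimple.comm :
    IsSimple Z (M := M.prod N) (N := N.prod M) (LinearEquiv.prodComm R M N) := by
  refine IsSimple.of_aug
    (t := (finAdd R M.extra N.extra).symm.trans ((LinearEquiv.prodComm R _ _).trans
      (finAdd R N.extra M.extra)))
    ((Good.finAdd _ _).symm.trans (Good.comm.trans (Good.finAdd _ _)))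
    (Good.augProd.trans (Good.comm.trans Good.augProd.symm)) ?_
  rintro ⟨m, n⟩ xy
  obtain ⟨⟨x, y⟩, rfl⟩ := (finAdd R M.extra N.extra).surjective xy
  change (PrimEmb.augProd N M).symm (PrimEmb.augProd M N (augPair m n x y)).swap =
    aug (N.prod M) ((n, m), finAdd R _ _ ((finAdd R _ _).symm (finAdd R _ _ (x, y))).swap)
  rw [LinearEquiv.symm_apply_apply, augProd_pair]
  exact augProd_symm_pair _ _ _ _

theorem IsSimple.assoc : IsSimple Z (M := (M.prod N).prod L) (N := M.prod (N.prod L))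
    (LinearEquiv.prodAssoc R M N L) := by
  let t : (Fin ((M.prod N).prod L).extra → R) ≃ₗ[R] (Fin (M.prod (N.prod L)).extra → R) :=
    (finAdd R (M.extra + N.extra) L.extra).symm.trans <|
      (LinearEquiv.prodCongr (finAdd R M.extra N.extra).symm (LinearEquiv.refl R _)).trans <|
      (LinearEquiv.prodAssoc R _ _ _).trans <|
      (LinearEquiv.prodCongr (LinearEquiv.refl R _) (finAdd R N.extra L.extra)).trans <|
      finAdd R M.extra (N.extra + L.extra)
  have ht : Good Z t := (Good.finAdd _ _).symm.trans <| ((Good.finAdd _ _).symm.prod_refl).trans <|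
    Good.assoc.trans <| (Good.finAdd _ _).refl_prod.trans <| Good.finAdd _ _
  refine IsSimple.of_aug ht (Good.augProd.trans <| Good.augProd.prod_refl.trans <|
    Good.assoc.trans <| Good.augProd.symm.refl_prod.trans Good.augProd.symm) ?_
  rintro ⟨⟨m, n⟩, l⟩ xyz
  obtain ⟨⟨xy, z⟩, rfl⟩ := (finAdd R (M.extra + N.extra) L.extra).surjective xyz
  obtain ⟨⟨x, y⟩, rfl⟩ := (PrimEmb.finAdd R _ _).surjective xy
  have h : t (finAdd R (M.extra + N.extra) L.extra (finAdd R M.extra N.extra (x, y), z)) =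
      finAdd R M.extra (N.extra + L.extra) (x, finAdd R N.extra L.extra (y, z)) := by
    simp only [t, LinearEquiv.trans_apply, LinearEquiv.symm_apply_apply,
      LinearEquiv.prodCongr_apply, LinearEquiv.refl_apply]
    rfl
  rw [h]
  have h1 := augProd_pair (M := M.prod N) (N := L) (m, n) l (finAdd R M.extra N.extra (x, y)) z
  have h2 := augProd_symm_pair (M := M) (N := N.prod L) m (n, l) x (finAdd R N.extra L.extra (y, z))
  refine Eq.trans ?_ h2
  change (PrimEmb.augProd M (N.prod L)).symm
    (LinearEquiv.prodCongr (LinearEquiv.refl R _) (PrimEmb.augProd N L).symm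
      (LinearEquiv.prodAssoc R _ _ _ (LinearEquiv.prodCongr (PrimEmb.augProd M N)
        (LinearEquiv.refl R _) (PrimEmb.augProd (M.prod N) L (augPair _ _ _ _))))) = _
  rw [h1]
  congr 1
  change (((PrimEmb.augProd M N) (augPair m n x y)).1, (PrimEmb.augProd N L).symm
    (((PrimEmb.augProd M N) (augPair m n x y)).2, aug L (l, z))) = _
  rw [augProd_pair, augProd_symm_pair]
  rfl

/-- Extended by zero on the free summands, $c$ gives a shear of free modules. -/
theorem IsSimple.shear (c : M →ₗ[R] N) :
    IsSimple Z (M := M.prod N) (N := M.prod N) (shear c) := by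
  let c' : Aug M →ₗ[R] Aug N := (aug N).toLinearMap ∘ₗ LinearMap.inl R _ _ ∘ₗ c ∘ₗ
    LinearMap.fst R _ _ ∘ₗ (aug M).symm.toLinearMap
  refine IsSimple.of_aug (t := LinearEquiv.refl R _) Good.refl
    (Good.augProd.trans ((Good.shear c').trans Good.augProd.symm)) ?_
  rintro ⟨m, n⟩ xy
  obtain ⟨⟨x, y⟩, rfl⟩ := (finAdd R M.extra N.extra).surjective xy
  have h : aug N (n, y) + c' (aug M (m, x)) = aug N (n + c m, y) := by
    change aug N (n, y) + aug N (c m, 0) = _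
    rw [← map_add]
    simp
  change (PrimEmb.augProd M N).symm (PrimEmb.shear c' (PrimEmb.augProd M N (augPair m n x y))) = _
  rw [augProd_pair, shear_apply, h]
  exact augProd_symm_pair _ _ _ _

theorem IsSimple.shear' (c : N →ₗ[R] M) :
    IsSimple Z (M := M.prod N) (N := M.prod N) (shear' c) :=
  (IsSimple.comm (M := M) (N := N)).trans
    ((IsSimple.shear c).trans (IsSimple.comm (M := N) (N := M)))

theorem IsSimple.neg : IsSimple Z (LinearEquiv.neg R : M ≃ₗ[R] M) :=
  IsSimple.of_aug (t := LinearEquiv.neg R) Good.neg Good.neg fun _ _ => rfl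

theorem IsSimple.zsmul (e : ℤˣ) {f : M ≃ₗ[R] M} (h : ∀ x, f x = (e : ℤ) • x) : IsSimple Z f := by
  rcases Int.units_eq_one_or e with rfl | rfl
  · exact IsSimple.refl.congr fun x => by simp [h]
  · exact IsSimple.neg.congr fun x => by simp [h]

theorem IsSimple.transport {N : Type u} [AddCommGroup N] [Module R N] (e : M ≃ₗ[R] N) :
    IsSimple Z (N := M.transport e) e := by
  refine IsSimple.of_aug (N := M.transport e) (t := LinearEquiv.refl R _)
    (F := LinearEquiv.prodCongr e (LinearEquiv.refl R _)) Good.refl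
    (Good.of_frame rfl fun x i => ?_) fun _ _ => rfl
  change M.sbasis (e.symm (e x.1), x.2) i = M.sbasis x i
  rw [e.symm_apply_apply]
  rfl

variable [StarRing R]

/-- The free module of a dual is the dual of the free module. -/
def augDual (M : BMod R) : Aug M.dual ≃ₗ[R] CDual R (Aug M) :=
  (LinearEquiv.prodCongr (LinearEquiv.refl R (CDual R M)) (stdDual R M.extra)).trans <|
    prodDual.trans (dualEquiv (aug M)).symm

theorem Good.augDual : Good Z (augDual M) := Good.of_frame rfl fun _ _ => rfl

theorem IsSimple.dual (hZ : StarInvariant Z) {f : M ≃ₗ[R] N} (hf : IsSimple Z f) :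
    IsSimple Z (M := N.dual) (N := M.dual) (dualEquiv f) := by
  rw [isSimple_iff] at *
  refine ((Good.augDual.prodCongr (Good.stdDual _)).trans <| Good.prodDual.trans <|
    (hf.dual hZ).trans <| Good.prodDual.symm.trans
      (Good.augDual.symm.prodCongr (Good.stdDual _).symm)).congr ?_
  rintro ⟨φ, b⟩
  obtain ⟨⟨φ, a⟩, rfl⟩ := (aug N.dual).surjective φ
  simp only [LinearEquiv.trans_apply]
  change _ = (LinearEquiv.prodCongr (PrimEmb.augDual M) (PrimEmb.stdDual R N.extra)).symm
    (PrimEmb.prodDual.symm _)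
  refine (LinearEquiv.eq_symm_apply _).2
    ((LinearEquiv.eq_symm_apply PrimEmb.prodDual).2 (CDual.ext ?_))
  rintro ⟨m, y⟩
  obtain ⟨⟨m, x⟩, rfl⟩ := (aug _).surjective m
  change (φ (f m) + PrimEmb.stdDual R _ b x) + PrimEmb.stdDual R _ a y =
    (φ (f m) + PrimEmb.stdDual R _ a y) + PrimEmb.stdDual R _ b x
  abel

theorem stdDual_finAdd {a b : ℕ} (x x' : Fin a → R) (y y' : Fin b → R) :
    stdDual R (a + b) (finAdd R a b (x, y)) (finAdd R a b (x', y')) =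
      stdDual R a x x' + stdDual R b y y' := by
  simp only [stdDual_apply, Fin.sum_univ_add, finAdd_castAdd, finAdd_natAdd]

theorem IsSimple.prodDual (hZ : StarInvariant Z) :
    IsSimple Z (M := M.dual.prod N.dual) (N := (M.prod N).dual)
      (prodDual : (CDual R M × CDual R N) ≃ₗ[R] CDual R (M × N)) := by
  refine IsSimple.of_aug (M := M.dual.prod N.dual) (N := (M.prod N).dual)
    (t := LinearEquiv.refl R _) Good.refl
    (Good.augProd.trans <| (Good.augDual.prodCongr Good.augDual).trans <|
      Good.prodDual.trans <| (Good.augProd (M := M) (N := N).dual hZ).trans Good.augDual.symm) ?_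
  rintro ⟨φ, ψ⟩ xy
  obtain ⟨⟨x, y⟩, rfl⟩ := (finAdd R M.extra N.extra).surjective xy
  refine (LinearEquiv.symm_apply_eq (PrimEmb.augDual (M.prod N))).2 (CDual.ext fun z => ?_)
  obtain ⟨m, n, x', y', rfl⟩ := augPair_surjective z
  have h := augProd_pair (M := M.dual) (N := N.dual) φ ψ x y
  change PrimEmb.prodDual (LinearEquiv.prodCongr (PrimEmb.augDual M) (PrimEmb.augDual N)
      (PrimEmb.augProd M.dual N.dual (augPair φ ψ x y)))
      (PrimEmb.augProd M N (augPair m n x' y')) =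
    (φ m + ψ n) + PrimEmb.stdDual R (M.extra + N.extra) (finAdd R M.extra N.extra (x, y))
      (finAdd R M.extra N.extra (x', y'))
  rw [h, augProd_pair, stdDual_finAdd]
  change (φ m + PrimEmb.stdDual R _ x x') + (ψ n + PrimEmb.stdDual R _ y y') = _
  abel

theorem BMod.evEquiv_apply (x : M) : M.evEquiv x = ev R M x := rfl

theorem IsSimple.ev (hZ : StarInvariant Z) : IsSimple Z (N := M.dual.dual) M.evEquiv := by
  have h1 : Good Z (LinearEquiv.ofBijective (PrimEmb.ev R (Aug M)) Framed.ev_bijective) :=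
    Good.ev fun _ => rfl
  refine IsSimple.of_aug (N := M.dual.dual) (t := LinearEquiv.refl R _) Good.refl
    (h1.trans ((Good.augDual (M := M).dual hZ).trans Good.augDual.symm)) ?_
  intro m x
  refine (LinearEquiv.symm_apply_eq (PrimEmb.augDual M.dual)).2 (CDual.ext fun z => ?_)
  obtain ⟨⟨φ, y⟩, rfl⟩ := (aug M.dual).surjective z
  change star (φ m + PrimEmb.stdDual R _ y x) = star (φ m) + PrimEmb.stdDual R _ x y
  simp [stdDual_apply]

end SimpleIso

/-! ## Calculus in `Q_ε` -/

section QCalculus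

variable {R : Type u} [Ring R] [StarRing R] {ε : ℤˣ}
variable {M N L : Type u} [AddCommGroup M] [Module R M] [AddCommGroup N] [Module R N]
  [AddCommGroup L] [Module R L]

theorem unit_zsmul_zsmul {A : Type*} [AddCommGroup A] (e : ℤˣ) (a : A) :
    (e : ℤ) • (e : ℤ) • a = a := by
  rw [smul_smul, ← Units.val_mul, Int.units_mul_self, Units.val_one, one_smul]

@[simp] theorem CDual.zsmul_apply {R M : Type*} [Ring R] [AddCommGroup M] [Module R M] (n : ℤ)
    (f : CDual R M) (x : M) : (n • f) x = n • f x := rfl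

@[simp] theorem CDual.coe_zsmul_hom (n : ℤ) (f : M →ₗ[R] CDual R N) (x : M) :
    (n • f) x = n • f x := rfl

theorem hom_ext {A B : M →ₗ[R] CDual R N} (h : ∀ x y, A x y = B x y) : A = B :=
  LinearMap.ext fun x => CDual.ext fun y => h x y

theorem Q.mk_surjective (q : Q R ε M) : ∃ ψ, Q.mk ψ = q := QuotientAddGroup.mk_surjective q

theorem Q.mk_add (ψ ψ' : M →ₗ[R] CDual R M) : (Q.mk (ψ + ψ') : Q R ε M) = Q.mk ψ + Q.mk ψ' := rfl

theorem Q.mk_neg (ψ : M →ₗ[R] CDual R M) : (Q.mk (-ψ) : Q R ε M) = -Q.mk ψ := rfl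

theorem Q.mk_sub (ψ ψ' : M →ₗ[R] CDual R M) : (Q.mk (ψ - ψ') : Q R ε M) = Q.mk ψ - Q.mk ψ' := rfl

theorem Q.mk_zero : (Q.mk 0 : Q R ε M) = 0 := rfl

theorem Q.mk_T (ψ : M →ₗ[R] CDual R M) : (Q.mk ((ε : ℤ) • T M ψ) : Q R ε M) = Q.mk ψ := by
  refine (QuotientAddGroup.eq).2 ⟨ψ, ?_⟩
  simp only [oneSub, AddMonoidHom.sub_apply, AddMonoidHom.id_apply]
  change ψ - (ε : ℤ) • T M ψ = _
  abel

theorem Q.mk_eq_of_swap {ψ ψ' : M →ₗ[R] CDual R M}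
    (h : ∀ x y, ψ' x y = (ε : ℤ) • star (ψ y x)) : (Q.mk ψ' : Q R ε M) = Q.mk ψ := by
  rw [← Q.mk_T ψ]
  exact congrArg _ (hom_ext h)

theorem Q.pull_mk (f : M →ₗ[R] N) (ψ : N →ₗ[R] CDual R N) :
    Q.pull f (Q.mk ψ : Q R ε N) = Q.mk (pullHom f ψ) := rfl

theorem Q.pull_pull (f : M →ₗ[R] N) (g : N →ₗ[R] L) (q : Q R ε L) :
    Q.pull f (Q.pull g q) = Q.pull (g ∘ₗ f) q := by
  obtain ⟨ψ, rfl⟩ := Q.mk_surjective q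
  rfl

theorem Q.pull_id (q : Q R ε M) : Q.pull LinearMap.id q = q := by
  obtain ⟨ψ, rfl⟩ := Q.mk_surjective q
  rfl

theorem Q.pull_congr {f g : M →ₗ[R] N} (h : ∀ x, f x = g x) (q : Q R ε N) :
    Q.pull f q = Q.pull g q := by
  rw [LinearMap.ext h]

theorem Q.pull_zero_map (q : Q R ε N) : Q.pull (0 : M →ₗ[R] N) q = 0 := by
  obtain ⟨ψ, rfl⟩ := Q.mk_surjective q
  rw [Q.pull_mk, ← Q.mk_zero]
  exact congrArg _ (hom_ext fun x y => by simp)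

theorem Q.pull_neg_map (f : M →ₗ[R] N) (q : Q R ε N) : Q.pull (-f) q = Q.pull f q := by
  obtain ⟨ψ, rfl⟩ := Q.mk_surjective q
  rw [Q.pull_mk, Q.pull_mk]
  exact congrArg _ (hom_ext fun x y => by simp)

theorem Q.pull_injective {f : M →ₗ[R] N} {g : N →ₗ[R] M} (h : ∀ x, f (g x) = x)
    {q q' : Q R ε N} (hq : Q.pull f q = Q.pull f q') : q = q' := by
  have key : ∀ q : Q R ε N, Q.pull g (Q.pull f q) = q := fun q => by
    rw [Q.pull_pull, Q.pull_congr (f := f ∘ₗ g) (g := LinearMap.id) h, Q.pull_id]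
  rw [← key q, hq, key]

theorem Q.symm_mk' (ψ : M →ₗ[R] CDual R M) (x y : M) :
    Q.symm (Q.mk ψ : Q R ε M) x y = ψ x y + (ε : ℤ) • star (ψ y x) := Q.symm_mk ψ x y

theorem Q.symm_pull (f : M →ₗ[R] N) (q : Q R ε N) (x y : M) :
    Q.symm (Q.pull f q) x y = Q.symm q (f x) (f y) := by
  obtain ⟨ψ, rfl⟩ := Q.mk_surjective q
  rw [Q.pull_mk, Q.symm_mk', Q.symm_mk']
  rfl

theorem Q.symm_swap (q : Q R ε M) (x y : M) :
    (ε : ℤ) • star (Q.symm q y x) = Q.symm q x y := by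
  obtain ⟨ψ, rfl⟩ := Q.mk_surjective q
  rw [Q.symm_mk', Q.symm_mk', star_add, star_zsmul, star_star, smul_add, unit_zsmul_zsmul,
    add_comm]

theorem Q.star_symm (q : Q R ε M) (x y : M) :
    star (Q.symm q y x) = (ε : ℤ) • Q.symm q x y := by
  rw [← Q.symm_swap q x y, unit_zsmul_zsmul]

theorem Q.symm_add (q q' : Q R ε M) (x y : M) :
    Q.symm (q + q') x y = Q.symm q x y + Q.symm q' x y := by
  rw [map_add]
  rfl

theorem Q.symm_neg (q : Q R ε M) (x y : M) : Q.symm (-q) x y = -Q.symm q x y := by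
  rw [map_neg]
  rfl

theorem Q.symm_sub (q q' : Q R ε M) (x y : M) :
    Q.symm (q - q') x y = Q.symm q x y - Q.symm q' x y := by
  rw [map_sub]
  rfl

/-- The bilinear form `(x, y) ↦ B (f x) (g y)`. -/
def bil {M' N' : Type u} [AddCommGroup M'] [Module R M'] [AddCommGroup N'] [Module R N']
    (B : M →ₗ[R] CDual R N) (f : M' →ₗ[R] M) (g : N' →ₗ[R] N) : M' →ₗ[R] CDual R N' :=
  dualMap g ∘ₗ B ∘ₗ f

@[simp] theorem bil_apply {M' N' : Type u} [AddCommGroup M'] [Module R M'] [AddCommGroup N']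
    [Module R N'] (B : M →ₗ[R] CDual R N) (f : M' →ₗ[R] M) (g : N' →ₗ[R] N) (x : M') (y : N') :
    bil B f g x y = B (f x) (g y) := rfl

/-- The mixed terms are $\psi(f,g)$ and $\psi(g,f)$. In $Q_\varepsilon$ the second equals
$\varepsilon$ times its transpose, and together they form the symmetrisation. -/
theorem Q.pull_add_map (f g : M →ₗ[R] N) (q : Q R ε N) :
    Q.pull (f + g) q = Q.pull f q + Q.pull g q + Q.mk (bil (Q.symm q) f g) := by
  obtain ⟨ψ, rfl⟩ := Q.mk_surjective q
  have h : bil (Q.symm (Q.mk ψ : Q R ε N)) f g = bil ψ f g + (ε : ℤ) • T M (bil ψ g f) :=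
    hom_ext fun x y => Q.symm_mk' ψ _ _
  rw [h, Q.mk_add, Q.mk_T, Q.pull_mk, Q.pull_mk, Q.pull_mk, ← Q.mk_add, ← Q.mk_add, ← Q.mk_add]
  refine congrArg _ (hom_ext fun x y => ?_)
  simp
  abel

/-- An element of `Q_ε` of a direct sum is zero if its restrictions to the summands and the cross
terms of its symmetrisation are zero. -/
theorem Q.prod_eq_zero (q : Q R ε (M × N)) (h₁ : Q.pull (LinearMap.inl R M N) q = 0)
    (h₂ : Q.pull (LinearMap.inr R M N) q = 0)
    (h : ∀ x y, Q.symm q (x, 0) (0, y) = 0) : q = 0 := by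
  have hid : (LinearMap.id : (M × N) →ₗ[R] (M × N)) =
      LinearMap.inl R M N ∘ₗ LinearMap.fst R M N + LinearMap.inr R M N ∘ₗ LinearMap.snd R M N :=
    LinearMap.ext fun p => by simp
  rw [← Q.pull_id q, hid, Q.pull_add_map, ← Q.pull_pull, ← Q.pull_pull, h₁, h₂, map_zero, map_zero,
    add_zero, zero_add, ← Q.mk_zero]
  exact congrArg _ (hom_ext fun x y => by simp [h])

theorem Q.prod_ext {q q' : Q R ε (M × N)}
    (h₁ : Q.pull (LinearMap.inl R M N) q = Q.pull (LinearMap.inl R M N) q')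
    (h₂ : Q.pull (LinearMap.inr R M N) q = Q.pull (LinearMap.inr R M N) q')
    (h : ∀ x y, Q.symm q (x, 0) (0, y) = Q.symm q' (x, 0) (0, y)) : q = q' := by
  rw [← sub_eq_zero]
  refine Q.prod_eq_zero _ (by rw [map_sub, h₁, sub_self]) (by rw [map_sub, h₂, sub_self]) ?_
  intro x y
  rw [Q.symm_sub, h, sub_self]

/-- The same for the dual of a direct sum. -/
theorem Q.dual_prod_ext {q q' : Q R ε (CDual R (M × N))}
    (h₁ : Q.pull (dualMap (LinearMap.fst R M N)) q = Q.pull (dualMap (LinearMap.fst R M N)) q')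
    (h₂ : Q.pull (dualMap (LinearMap.snd R M N)) q = Q.pull (dualMap (LinearMap.snd R M N)) q')
    (h : ∀ ξ η, Q.symm q (dualMap (LinearMap.fst R M N) ξ) (dualMap (LinearMap.snd R M N) η) =
      Q.symm q' (dualMap (LinearMap.fst R M N) ξ) (dualMap (LinearMap.snd R M N) η)) : q = q' := by
  let e : (CDual R M × CDual R N) →ₗ[R] CDual R (M × N) := prodDual.toLinearMap
  have hi : e ∘ₗ LinearMap.inl R _ _ = dualMap (LinearMap.fst R M N) :=
    LinearMap.ext fun ξ => CDual.ext fun x => by simp [e]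
  have hj : e ∘ₗ LinearMap.inr R _ _ = dualMap (LinearMap.snd R M N) :=
    LinearMap.ext fun ξ => CDual.ext fun x => by simp [e]
  refine Q.pull_injective (f := e) (g := prodDual.symm.toLinearMap)
    (fun x => prodDual.apply_symm_apply x) (Q.prod_ext ?_ ?_ ?_)
  · rw [Q.pull_pull, Q.pull_pull, hi, h₁]
  · rw [Q.pull_pull, Q.pull_pull, hj, h₂]
  · intro ξ η
    have hi' : e (ξ, 0) = dualMap (LinearMap.fst R M N) ξ := LinearMap.congr_fun hi ξ
    have hj' : e (0, η) = dualMap (LinearMap.snd R M N) η := LinearMap.congr_fun hj η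
    rw [Q.symm_pull, Q.symm_pull, hi', hj', h]

end QCalculus

/-! ## Isomorphisms of split formations -/

section Formation

variable {R : Type u} [Ring R] [StarRing R] {ε : ℤˣ} {Z : AddSubgroup (RedK1 R)}

/-- Based modules are reflexive, so functionals separate points. This allows equations between
module elements to be checked as equations in $R$, without explicit double duals. -/
theorem BMod.ext_dual {M : BMod R} {x y : M} (h : ∀ ξ : CDual R M, ξ x = ξ y) : x = y :=
  M.ev_bijective.1 (CDual.ext fun ξ => by simp [h])

theorem BMod.apply_evEquiv_symm {M : BMod R} (G : CDual R (CDual R M)) (ξ : CDual R M) :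
    ξ (M.evEquiv.symm G) = star (G ξ) := by
  obtain ⟨x, rfl⟩ := M.evEquiv.surjective G
  rw [LinearEquiv.symm_apply_apply, BMod.evEquiv_apply, ev_apply, star_star]

theorem apply_codual {M : BMod R} {N : Type u} [AddCommGroup N] [Module R N]
    (f : CDual R M →ₗ[R] N) (F : CDual R N) (ξ : CDual R M) : ξ (codual f F) = star (F (f ξ)) :=
  BMod.apply_evEquiv_symm _ _

variable {X Y W X' Y' : SplitFormation R ε}

/-- The element `α ν α^*` of `Q_ε(F₂^*)`. -/
def Triple.push (f : Triple X Y) : Q R ε (CDual R Y.F) := Q.pull (dualMap f.α.toLinearMap) f.ν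

theorem Triple.ν_eq_pull_push (f : Triple X Y) :
    f.ν = Q.pull (dualMap f.α.symm.toLinearMap) f.push := by
  rw [Triple.push, Q.pull_pull]
  refine (Q.pull_id f.ν).symm.trans (Q.pull_congr (fun x => CDual.ext fun y => ?_) _)
  simp

theorem Triple.push_comp (g : Triple Y W) (f : Triple X Y) :
    (g.comp f).push = Q.pull (dualMap g.α.toLinearMap) f.push + g.push := by
  simp only [Triple.push, Triple.comp, map_add, Q.pull_pull]
  congr 1
  exact Q.pull_congr (fun x => CDual.ext fun y => by simp) _

/-- The equations of an isomorphism of split formations, in terms of `α ν α^*` and evaluated on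
elements. -/
structure Triple.Eqs (f : Triple X Y) : Prop where
  hessian : X.θ + Q.pull f.β.toLinearMap (Q.pull Y.δ f.push) = Q.pull f.β.toLinearMap Y.θ
  map_γ : ∀ (ξ : CDual R Y.F) (x : X.G),
    ξ (f.α (X.γ x)) + Q.symm f.push ξ (Y.δ (f.β x)) = ξ (Y.γ (f.β x))
  map_δ : ∀ (x : X.G) (u : X.F), X.δ x u = Y.δ (f.β x) (f.α u)

theorem Triple.pull_δ_ν {f : Triple X Y} (h : ∀ (x : X.G) (u : X.F), X.δ x u = Y.δ (f.β x) (f.α u)) :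
    Q.pull X.δ f.ν = Q.pull f.β.toLinearMap (Q.pull Y.δ f.push) := by
  rw [Triple.push, Q.pull_pull, Q.pull_pull]
  exact Q.pull_congr (fun x => CDual.ext fun u => by simp [h]) _

/-- Using $\alpha\nu\alpha^*$ instead of $\nu$ moves all equations to the target, where the entry
$s$ of the union lives. -/
theorem Triple.isIso_iff (f : Triple X Y) :
    f.IsIso Z ↔ IsSimple Z f.α ∧ IsSimple Z f.β ∧ f.Eqs := by
  have hδ : (∀ x : X.G, dualMap f.α.symm.toLinearMap (X.δ x) = Y.δ (f.β x)) ↔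
      ∀ (x : X.G) (u : X.F), X.δ x u = Y.δ (f.β x) (f.α u) := by
    refine forall_congr' fun x => ⟨fun h u => ?_, fun h => CDual.ext fun u => ?_⟩
    · rw [← h]
      simp
    · have := h (f.α.symm u)
      simpa using this
  have hγ : ∀ (h : ∀ (x : X.G) (u : X.F), X.δ x u = Y.δ (f.β x) (f.α u)) (ξ : CDual R Y.F)
      (x : X.G), ξ (f.α (X.γ x) + f.α (X.F.evEquiv.symm (T (CDual R X.F) (Q.symm f.ν) (X.δ x)))) =
      ξ (f.α (X.γ x)) + Q.symm f.push ξ (Y.δ (f.β x)) := by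
    intro h ξ x
    have h1 : X.δ x = dualMap f.α.toLinearMap (Y.δ (f.β x)) := CDual.ext fun u => h x u
    rw [map_add]
    congr 1
    change dualMap f.α.toLinearMap ξ (X.F.evEquiv.symm _) = _
    rw [BMod.apply_evEquiv_symm, T_apply, star_star, Triple.push, Q.symm_pull, ← h1]
  constructor
  · rintro ⟨h1, h2, h3, h4, h5⟩
    rw [hδ] at h5
    refine ⟨h1, h2, ?_, fun ξ x => ?_, h5⟩
    · rw [← Triple.pull_δ_ν h5, h3]
    · rw [← h4, hγ h5]
  · rintro ⟨h1, h2, h3, h4, h5⟩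
    refine ⟨h1, h2, ?_, fun x => BMod.ext_dual fun ξ => ?_, hδ.2 h5⟩
    · rw [Triple.pull_δ_ν h5, h3]
    · rw [hγ h5, h4]

theorem Triple.IsIso.eqs {f : Triple X Y} (hf : f.IsIso Z) : f.Eqs :=
  ((Triple.isIso_iff f).1 hf).2.2

theorem Triple.IsIso.comp {g : Triple Y W} {f : Triple X Y} (hg : g.IsIso Z) (hf : f.IsIso Z) :
    (g.comp f).IsIso Z := by
  rw [Triple.isIso_iff] at *
  obtain ⟨hg1, hg2, hg⟩ := hg
  obtain ⟨hf1, hf2, hf⟩ := hf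
  refine ⟨hf1.trans hg1, hf2.trans hg2, ?_, ?_, ?_⟩
  · have h1 := congrArg (Q.pull f.β.toLinearMap) hg.hessian
    have h2 : Q.pull f.β.toLinearMap (Q.pull Y.δ f.push) =
        Q.pull (g.comp f).β.toLinearMap
          (Q.pull W.δ (Q.pull (dualMap g.α.toLinearMap) f.push)) := by
      simp only [Q.pull_pull]
      exact Q.pull_congr (fun x => CDual.ext fun u => by simp [hg.map_δ, Triple.comp]) _
    have h3 := hf.hessian
    rw [map_add] at h1
    rw [Triple.push_comp, map_add, map_add, ← add_assoc, ← h2, h3]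
    simp only [Q.pull_pull] at h1 ⊢
    exact h1
  · intro ξ x
    have h1 := hf.map_γ (dualMap g.α.toLinearMap ξ) x
    have h2 : Y.δ (f.β x) = dualMap g.α.toLinearMap (W.δ (g.β (f.β x))) :=
      CDual.ext fun u => hg.map_δ _ u
    have h3 := hg.map_γ ξ (f.β x)
    rw [Triple.push_comp, Q.symm_add, Q.symm_pull, ← add_assoc]
    change _ + Q.symm f.push _ (dualMap g.α.toLinearMap (W.δ (g.β (f.β x)))) + _ = _
    rw [← h2]
    refine Eq.trans ?_ h3
    exact congrArg (· + Q.symm g.push ξ (W.δ (g.β (f.β x)))) h1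
  · intro x u
    rw [hf.map_δ, hg.map_δ]
    rfl

theorem Triple.push_inv (f : Triple X Y) : f.inv.push = -f.ν := by
  have h := f.ν_eq_pull_push
  rw [Triple.push] at h
  rw [Triple.push, Triple.inv, map_neg]
  exact congrArg _ h.symm

theorem Triple.IsIso.inv {f : Triple X Y} (hf : f.IsIso Z) : f.inv.IsIso Z := by
  rw [Triple.isIso_iff] at *
  obtain ⟨hf1, hf2, hf⟩ := hf
  refine ⟨hf1.symm, hf2.symm, ?_, ?_, ?_⟩
  · have h := congrArg (Q.pull f.β.symm.toLinearMap) hf.hessian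
    rw [← Triple.pull_δ_ν hf.map_δ, map_add] at h
    rw [Triple.push_inv, map_neg, map_neg]
    have h2 : Q.pull f.β.symm.toLinearMap (Q.pull f.β.toLinearMap Y.θ) = Y.θ := by
      rw [Q.pull_pull]
      exact (Q.pull_congr (fun x => by simp) _).trans (Q.pull_id _)
    rw [h2] at h
    rw [← h]
    exact add_neg_cancel_right _ _
  · intro ξ y
    have h := hf.map_γ (dualMap f.α.symm.toLinearMap ξ) (f.β.symm y)
    have h2 : X.δ (f.β.symm y) = dualMap f.α.toLinearMap (Y.δ y) :=
      CDual.ext fun u => by simp [hf.map_δ]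
    have h3 : Q.symm f.push (dualMap f.α.symm.toLinearMap ξ) (Y.δ y) =
        Q.symm f.ν ξ (X.δ (f.β.symm y)) := by
      rw [Triple.push, Q.symm_pull, ← h2]
      congr 2
      exact CDual.ext fun u => by simp
    rw [LinearEquiv.apply_symm_apply, h3] at h
    rw [Triple.push_inv, Q.symm_neg]
    change ξ (f.α.symm (Y.γ y)) + -Q.symm f.ν ξ (X.δ (f.β.symm y)) = ξ (X.γ (f.β.symm y))
    simp only [dualMap_apply, LinearEquiv.coe_coe, LinearEquiv.symm_apply_apply] at h
    rw [← h, add_neg_cancel_right]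
  · intro y u
    change Y.δ y u = X.δ (f.β.symm y) (f.α.symm u)
    simp [hf.map_δ]

theorem Triple.push_sum (f : Triple X Y) (g : Triple X' Y') :
    (f.sum g).push = Q.pull (dualMap (LinearMap.inl R Y.F Y'.F)) f.push +
      Q.pull (dualMap (LinearMap.inr R Y.F Y'.F)) g.push := by
  simp only [Triple.push, Triple.sum, map_add, Q.pull_pull]
  congr 1 <;> exact Q.pull_congr (fun x => CDual.ext fun y => by simp) _

@[simp] theorem SplitFormation.sum_δ_apply (x : X.G) (y : Y.G) (u : X.F) (w : Y.F) :
    (X.sum Y).δ (x, y) (u, w) = X.δ x u + Y.δ y w := rfl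

theorem Triple.IsIso.sum {f : Triple X Y} {g : Triple X' Y'} (hf : f.IsIso Z) (hg : g.IsIso Z) :
    (f.sum g).IsIso Z := by
  rw [Triple.isIso_iff] at *
  obtain ⟨hf1, hf2, hf⟩ := hf
  obtain ⟨hg1, hg2, hg⟩ := hg
  refine ⟨hf1.prod hg1, hf2.prod hg2, ?_, ?_, ?_⟩
  · have h1 := congrArg (Q.pull (LinearMap.fst R X.G X'.G)) hf.hessian
    have h2 := congrArg (Q.pull (LinearMap.snd R X.G X'.G)) hg.hessian
    simp only [map_add] at h1 h2
    have h3 : Q.pull (f.sum g).β.toLinearMap (Q.pull (Y.sum Y').δ (f.sum g).push) =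
        Q.pull (LinearMap.fst R X.G X'.G) (Q.pull f.β.toLinearMap (Q.pull Y.δ f.push)) +
        Q.pull (LinearMap.snd R X.G X'.G) (Q.pull g.β.toLinearMap (Q.pull Y'.δ g.push)) := by
      rw [Triple.push_sum]
      simp only [map_add, Q.pull_pull]
      congr 1 <;> exact Q.pull_congr (fun x => CDual.ext fun u => by simp [Triple.sum]) _
    have h4 : Q.pull (f.sum g).β.toLinearMap (Y.sum Y').θ =
        Q.pull (LinearMap.fst R X.G X'.G) (Q.pull f.β.toLinearMap Y.θ) +
        Q.pull (LinearMap.snd R X.G X'.G) (Q.pull g.β.toLinearMap Y'.θ) := by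
      simp only [map_add, Q.pull_pull]
      rfl
    rw [h3, h4, ← h1, ← h2]
    change Q.pull (LinearMap.fst R X.G X'.G) X.θ + Q.pull (LinearMap.snd R X.G X'.G) X'.θ + _ = _
    abel
  · rintro ξ ⟨x, x'⟩
    have h1 := hf.map_γ (dualMap (LinearMap.inl R Y.F Y'.F) ξ) x
    have h2 := hg.map_γ (dualMap (LinearMap.inr R Y.F Y'.F) ξ) x'
    have e : ∀ (y : Y.F) (y' : Y'.F), ξ (y, y') = ξ (y, 0) + ξ (0, y') := fun y y' => by
      rw [← map_add]
      simp
    have h3 : dualMap (LinearMap.inl R Y.F Y'.F) ((Y.sum Y').δ (f.β x, g.β x')) = Y.δ (f.β x) :=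
      CDual.ext fun u => by simp
    have h4 : dualMap (LinearMap.inr R Y.F Y'.F) ((Y.sum Y').δ (f.β x, g.β x')) = Y'.δ (g.β x') :=
      CDual.ext fun u => by simp
    rw [Triple.push_sum, Q.symm_add, Q.symm_pull, Q.symm_pull]
    change ξ (f.α (X.γ x), g.α (X'.γ x')) +
      (Q.symm f.push _ (dualMap _ ((Y.sum Y').δ (f.β x, g.β x'))) +
        Q.symm g.push _ (dualMap _ ((Y.sum Y').δ (f.β x, g.β x')))) =
      ξ (Y.γ (f.β x), Y'.γ (g.β x'))
    rw [h3, h4, e, e (Y.γ _)]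
    simp only [dualMap_apply, LinearMap.inl_apply, LinearMap.inr_apply] at h1 h2
    rw [← h1, ← h2]
    abel
  · rintro ⟨x, x'⟩ ⟨u, u'⟩
    change X.δ x u + X'.δ x' u' = Y.δ (f.β x) (f.α u) + Y'.δ (g.β x') (g.α u')
    rw [hf.map_δ, hg.map_δ]

theorem Triple.Eqs.of_ν_eq_zero {f : Triple X Y} (hν : f.ν = 0)
    (hθ : X.θ = Q.pull f.β.toLinearMap Y.θ) (hγ : ∀ x, f.α (X.γ x) = Y.γ (f.β x))
    (hδ : ∀ (x : X.G) (u : X.F), X.δ x u = Y.δ (f.β x) (f.α u)) : f.Eqs := by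
  have hp : f.push = 0 := by rw [Triple.push, hν, map_zero]
  refine ⟨?_, fun ξ x => ?_, hδ⟩
  · rw [hp, map_zero, map_zero, add_zero, hθ]
  · rw [hp, map_zero, hγ]
    exact add_zero _

theorem Triple.isIso_id : (Triple.id X).IsIso Z :=
  (Triple.isIso_iff _).2 ⟨IsSimple.refl, IsSimple.refl,
    Triple.Eqs.of_ν_eq_zero rfl (Q.pull_id _).symm (fun _ => rfl) fun _ _ => rfl⟩

theorem Triple.isIso_assoc : (Triple.assoc X Y W).IsIso Z := by
  refine (Triple.isIso_iff _).2 ⟨IsSimple.assoc, IsSimple.assoc,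
    Triple.Eqs.of_ν_eq_zero rfl ?_ (fun _ => rfl) ?_⟩
  · simp only [map_add, Q.pull_pull, Triple.assoc]
    exact add_assoc _ _ _
  · rintro ⟨⟨x, y⟩, w⟩ ⟨⟨x', y'⟩, w'⟩
    exact add_assoc _ _ _

theorem Triple.isIso_bdry {v w : QForm R ε} (h : Isometry Z v w) :
    (Triple.bdry (v := v) (w := w) h.e).IsIso Z := by
  refine (Triple.isIso_iff _).2 ⟨h.simple, h.simple,
    Triple.Eqs.of_ν_eq_zero rfl h.isometric.symm (fun _ => rfl) fun x u => ?_⟩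
  change Q.symm v.form x u = Q.symm w.form (h.e x) (h.e u)
  rw [← h.isometric, Q.symm_pull]
  rfl

theorem stabilise_isIso {x y u w r p q : SplitFormation R ε} {f : Triple (x.sum u) (y.sum w)}
    {g : Triple p (u.sum r)} {h : Triple (w.sum r) q} (hf : f.IsIso Z) (hg : g.IsIso Z)
    (hh : h.IsIso Z) : (stabilise f g h).IsIso Z :=
  (Triple.isIso_id.sum hh).comp <| Triple.isIso_assoc.comp <| (hf.sum Triple.isIso_id).comp <|
    Triple.isIso_assoc.inv.comp (Triple.isIso_id.sum hg)

/-- The isomorphism of trivial formations given by an isomorphism of based modules. -/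
def Triple.trivMap {P P' : BMod R} (e : P ≃ₗ[R] P') :
    Triple (triv ε P) (triv ε P') :=
  ⟨e, (dualEquiv e).symm, 0⟩

theorem Triple.isIso_trivMap (hZ : StarInvariant Z) {P P' : BMod R} {e : P ≃ₗ[R] P'}
    (he : IsSimple Z e) : (Triple.trivMap (ε := ε) e).IsIso Z := by
  refine (Triple.isIso_iff _).2 ⟨he, (he.dual hZ).symm,
    Triple.Eqs.of_ν_eq_zero rfl (map_zero _).symm (fun x => map_zero e) fun x u => ?_⟩
  change x u = x (e.symm (e u))
  rw [e.symm_apply_apply]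

/-- The trivial formation of a sum is the sum of the trivial formations. -/
def Triple.trivSum (ε : ℤˣ) (P P' : BMod R) :
    Triple (triv ε (P.prod P')) ((triv ε P).sum (triv ε P')) :=
  ⟨LinearEquiv.refl R (P × P'), (prodDual (M := P) (N := P')).symm, 0⟩

theorem Triple.isIso_trivSum (hZ : StarInvariant Z) (P P' : BMod R) :
    (Triple.trivSum ε P P').IsIso Z := by
  refine (Triple.isIso_iff _).2 ⟨IsSimple.refl, (IsSimple.prodDual hZ).symm,
    Triple.Eqs.of_ν_eq_zero rfl ?_ (fun x => rfl) fun x u => ?_⟩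
  · simp only [map_zero, add_zero]
  · exact congrArg (fun φ : CDual R (P × P') => φ u) ((prodDual.apply_symm_apply x).symm)

end Formation

/-! ## The union and its two embeddings -/

/-- An isomorphism `M ⊕ L ≃ N ⊕ L` of the form `φ ⊕ 1` comes from an isomorphism `M ≃ N`. -/
theorem exists_equiv_of_prod {R : Type*} [Ring R] {M N L : Type*} [AddCommGroup M] [Module R M] [AddCommGroup N]
    [Module R N] [AddCommGroup L] [Module R L] (e : (M × L) ≃ₗ[R] (N × L)) (φ : M →ₗ[R] N)
    (h : ∀ x l, e (x, l) = (φ x, l)) :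
    ∃ e₀ : M ≃ₗ[R] N, (∀ x, e₀ x = φ x) ∧ LinearEquiv.prodCongr e₀ (LinearEquiv.refl R L) = e := by
  have hb : Function.Bijective φ := by
    constructor
    · intro x y hxy
      have := e.injective ((h x 0).trans ((congrArg (·, 0) hxy).trans (h y 0).symm))
      exact congrArg Prod.fst this
    · intro y
      obtain ⟨⟨x, l⟩, hx⟩ := e.surjective (y, 0)
      rw [h] at hx
      exact ⟨x, congrArg Prod.fst hx⟩
  exact ⟨LinearEquiv.ofBijective φ hb, fun _ => rfl, LinearEquiv.ext fun p => (h p.1 p.2).symm⟩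

section Union

variable {R : Type u} [Ring R] [StarRing R] {ε : ℤˣ} {Z : AddSubgroup (RedK1 R)}

/-- In $Q_\varepsilon$ the classes of $\psi$ and $\varepsilon T\psi$ agree, so symmetrising doubles.
-/
theorem Q.mk_symm {M : Type u} [AddCommGroup M] [Module R M] (q : Q R ε M) :
    (Q.mk (Q.symm q) : Q R ε M) = q + q := by
  obtain ⟨ψ, rfl⟩ := Q.mk_surjective q
  have h : Q.symm (Q.mk ψ : Q R ε M) = ψ + (ε : ℤ) • T M ψ := hom_ext fun x y => Q.symm_mk' ψ x y
  rw [h, Q.mk_add, Q.mk_T]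

variable {v v' : QForm R ε} {P P' : BMod R}

/-- The map `(V')^* → (V' ⊕ P')^*`. -/
abbrev extL (M N : Type u) [AddCommGroup M] [Module R M] [AddCommGroup N] [Module R N] :
    CDual R M →ₗ[R] CDual R (M × N) := dualMap (LinearMap.fst R M N)

/-- The map `(P')^* → (V' ⊕ P')^*`. -/
abbrev extR (M N : Type u) [AddCommGroup M] [Module R M] [AddCommGroup N] [Module R N] :
    CDual R N →ₗ[R] CDual R (M × N) := dualMap (LinearMap.snd R M N)

theorem stable_δ (y : v.M) (ζ : CDual R P) :
    ((bdry v).sum (triv ε P)).δ (y, ζ) = extL v.M P (v.symm y) + extR v.M P ζ := rfl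

theorem stable_δ_left (v : QForm R ε) (P : BMod R) (y : v.M) :
    ((bdry v).sum (triv ε P)).δ ((y, 0) : v.M × CDual R P) = extL v.M P (v.symm y) := by
  rw [stable_δ, map_zero, add_zero]

theorem stable_δ_right (v : QForm R ε) (P : BMod R) (ζ : CDual R P) :
    ((bdry v).sum (triv ε P)).δ ((0, ζ) : v.M × CDual R P) = extR v.M P ζ := by
  rw [stable_δ, map_zero, map_zero, zero_add]

theorem union_form (f : StTriple v v' P P') : (union f).form =
    Q.pull (LinearMap.fst R v.M (CDual R v'.M)) v.form
    + Q.mk (M := v.M × CDual R v'.M) ((ε : ℤ) • (dualMap (LinearMap.snd R v.M (CDual R v'.M)) ∘ₗ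
        ev R v'.M ∘ₗ compA f ∘ₗ LinearMap.fst R v.M (CDual R v'.M)))
    - Q.pull (LinearMap.snd R v.M (CDual R v'.M)) (compS f) := rfl

theorem compS_eq (f : StTriple v v' P P') : compS f = Q.pull (extL v'.M P') f.push := rfl

theorem symm_compS (f : StTriple v v' P P') (ξ η : CDual R v'.M) :
    Q.symm (compS f) ξ η = Q.symm f.push (extL v'.M P' ξ) (extL v'.M P' η) := by
  rw [compS_eq, Q.symm_pull]

theorem union_symm_apply (f : StTriple v v' P P') (x x' : v.M) (ξ ξ' : CDual R v'.M) :
    (union f).symm ((x, ξ) : v.M × CDual R v'.M) ((x', ξ') : v.M × CDual R v'.M) =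
      v.symm x x' + (ε : ℤ) • star (ξ' (compA f x)) + ξ (compA f x') -
        Q.symm (compS f) ξ ξ' := by
  rw [QForm.symm, Q.symm_sub, Q.symm_add, Q.symm_pull, Q.symm_pull, Q.symm_mk']
  change v.symm x x' + ((ε : ℤ) • star (ξ' (compA f x)) +
    (ε : ℤ) • star ((ε : ℤ) • star (ξ (compA f x')))) - _ = _
  rw [star_zsmul, star_star, unit_zsmul_zsmul, add_assoc]
  rfl

/-- With $\hat s$ the symmetrisation of $s$, the upper left entries of the equations of an
isomorphism are $\xi(aby)+\hat s(\xi,\lambda'y)=\xi(y)$, $\lambda(by,u)=\lambda'(y,au)$ and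
$b^*\theta b+\lambda'^*s\lambda'=\theta'$. They are established here and in the next two lemmas. -/
theorem Triple.Eqs.apply_compA_compB {f : StTriple v v' P P'} (hf : f.Eqs) (ξ : CDual R v'.M)
    (y : v'.M) : ξ (compA f (compB f y)) + Q.symm (compS f) ξ (v'.symm y) = ξ y := by
  have h := hf.map_γ (extL v'.M P' ξ) (f.β.symm ((y, 0) : v'.M × CDual R P'))
  rw [LinearEquiv.apply_symm_apply, stable_δ_left, ← symm_compS] at h
  exact h

theorem Triple.Eqs.symm_compB {f : StTriple v v' P P'} (hf : f.Eqs) (y : v'.M) (u : v.M) :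
    v.symm (compB f y) u = v'.symm y (compA f u) := by
  have h := hf.map_δ (f.β.symm ((y, 0) : v'.M × CDual R P')) ((u, 0) : v.M × P)
  rw [LinearEquiv.apply_symm_apply, stable_δ_left] at h
  refine Eq.trans ?_ h
  change _ = v.symm (compB f y) u + (f.β.symm ((y, 0) : v'.M × CDual R P')).2 0
  rw [map_zero, add_zero]

theorem Triple.Eqs.pull_compB {f : StTriple v v' P P'} (hf : f.Eqs) :
    Q.pull (compB f) v.form + Q.pull v'.symm (compS f) = v'.form := by
  let i : v'.M →ₗ[R] (v'.M × CDual R P') := LinearMap.inl R _ _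
  have h := congrArg (Q.pull (f.β.symm.toLinearMap ∘ₗ i)) hf.hessian
  simp only [map_add, Q.pull_pull, map_zero, add_zero] at h
  refine Eq.trans ?_ (h.trans ?_)
  · rw [compS_eq, Q.pull_pull]
    congr 1
    refine Q.pull_congr (fun y => ?_) _
    refine (stable_δ_left v' P' y).symm.trans (congrArg _ ?_)
    exact (f.β.apply_symm_apply _).symm
  · refine (Q.pull_congr (g := LinearMap.id) (fun y => ?_) _).trans (Q.pull_id _)
    change (f.β (f.β.symm (y, 0))).1 = y
    rw [LinearEquiv.apply_symm_apply]

theorem pull_unionInl (f : StTriple v v' P P') : Q.pull (unionInl f) (union f).form = v.form := by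
  obtain ⟨s, hs⟩ := Q.mk_surjective (compS f)
  obtain ⟨θ, hθ⟩ := Q.mk_surjective v.form
  rw [union_form, ← hs, ← hθ, map_sub, map_add, Q.pull_mk, Q.pull_mk, Q.pull_mk, Q.pull_mk, Q.pull_mk,
    ← Q.mk_add, ← Q.mk_sub]
  exact congrArg _ (hom_ext fun x y => by simp [unionInl])

/-- By the first entry equation the mixed term of the union contributes
$-2\theta'+2\lambda'^*s\lambda'$. Adding $b^*\theta
b-\lambda'^*s\lambda'=\theta'-2\lambda'^*s\lambda'$ leaves $-\theta'$. -/
theorem pull_unionInr {f : StTriple v v' P P'} (hf : f.Eqs) :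
    Q.pull (unionInr f) (union f).form = -v'.form := by
  have h1 : Q.pull (unionInr f) (Q.pull (LinearMap.fst R v.M (CDual R v'.M)) v.form) =
      Q.pull (compB f) v.form := by
    rw [Q.pull_pull]
    rfl
  have h2 : Q.pull (unionInr f) (Q.pull (LinearMap.snd R v.M (CDual R v'.M)) (compS f)) =
      Q.pull v'.symm (compS f) := by
    rw [Q.pull_pull, ← Q.pull_neg_map v'.symm]
    rfl
  have h3 : Q.pull (unionInr f) (Q.mk (M := v.M × CDual R v'.M) ((ε : ℤ) •
      (dualMap (LinearMap.snd R v.M (CDual R v'.M)) ∘ₗ ev R v'.M ∘ₗ compA f ∘ₗ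
        LinearMap.fst R v.M (CDual R v'.M)))) =
      -(v'.form + v'.form) + Q.pull v'.symm (compS f + compS f) := by
    rw [← Q.mk_symm, ← Q.mk_symm (compS f), Q.pull_mk, Q.pull_mk, ← Q.mk_neg, ← Q.mk_add]
    refine congrArg _ (hom_ext fun y y' => ?_)
    have h := hf.apply_compA_compB (v'.symm y') y
    have h' : v'.symm y' (compA f (compB f y)) =
      v'.symm y' y - Q.symm (compS f) (v'.symm y') (v'.symm y) := by
      rw [← h]
      abel
    change (ε : ℤ) • star ((-v'.symm y') (compA f (compB f y))) =
      -v'.symm y y' + Q.symm (compS f) (v'.symm y) (v'.symm y')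
    rw [CDual.neg_apply, h', star_neg, star_sub, Q.star_symm, Q.star_symm, smul_neg, smul_sub,
      unit_zsmul_zsmul, unit_zsmul_zsmul]
    abel
  rw [union_form, map_sub, map_add, h1, h2, h3, map_add, ← hf.pull_compB]
  abel

/-- This makes the identity of $V\oplus V'^*$ the splitting required of a primitive embedding, and
forces isomorphisms of embedding pairs to preserve the $V'^*$-coordinate. -/
theorem union_symm_unionInr {f : StTriple v v' P P'} (hf : f.Eqs) (x : v.M) (ξ : CDual R v'.M)
    (y : v'.M) : (union f).symm ((x, ξ) : v.M × CDual R v'.M) (unionInr f y) = ξ y := by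
  refine (union_symm_apply f x (compB f y) ξ (-v'.symm y)).trans ?_
  rw [CDual.neg_apply, star_neg, ← hf.symm_compB, Q.star_symm, smul_neg, unit_zsmul_zsmul,
    map_neg (Q.symm (compS f) ξ), add_neg_cancel, zero_add, sub_neg_eq_add, hf.apply_compA_compB]

/-- Orthogonality of $(x,\xi)$ to $V$ means $\lambda x+a^*\xi=0$. With $\eta$ minus the pullback of
$\xi$ along the entry $P\to V'$ of $\alpha$, this says $\delta(x,\eta)=-\alpha^*(\xi,0)$, hence
$\delta'\beta(x,\eta)=-(\xi,0)$. So $\beta(x,\eta)=(y,0)$ with $\xi=-\lambda'y$ and $x=by$. -/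
theorem union_orth {f : StTriple v v' P P'} (hf : f.Eqs) :
    orth (m := union f) (unionInl f) = LinearMap.range (unionInr f) := by
  ext p
  obtain ⟨x, ξ⟩ := p
  have hmem : ((x, ξ) : v.M × CDual R v'.M) ∈ orth (m := union f) (unionInl f) ↔
      ∀ u, v.symm x u + ξ (compA f u) = 0 := by
    have key : ∀ u : v.M, (union f).symm ((x, ξ) : v.M × CDual R v'.M) (unionInl f u) =
        v.symm x u + ξ (compA f u) := fun u => by
      refine (union_symm_apply f x u ξ 0).trans ?_
      rw [map_zero (Q.symm (compS f) ξ)]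
      simp
    rw [orth, LinearMap.mem_ker]
    constructor
    · intro h u
      rw [← key]
      exact congrArg (fun φ : CDual R v.M => φ u) h
    · intro h
      exact CDual.ext fun u => (key u).trans (h u)
  refine hmem.trans ⟨fun h => ?_, ?_⟩
  · let η : CDual R P := -dualMap (LinearMap.fst R v'.M P' ∘ₗ f.α.toLinearMap ∘ₗ
      LinearMap.inr R v.M P) ξ
    have key : ((bdry v').sum (triv ε P')).δ (f.β ((x, η) : v.M × CDual R P)) =
        -extL v'.M P' ξ := CDual.ext fun w => by
      obtain ⟨⟨u, p⟩, rfl⟩ := f.α.surjective w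
      have h1 := hf.map_δ ((x, η) : v.M × CDual R P) ((u, p) : v.M × P)
      have h2 : ((u, p) : v.M × P) = (u, 0) + (0, p) := by simp
      refine h1.symm.trans ?_
      change v.symm x u + -ξ (f.α ((0, p) : v.M × P)).1 = -ξ (f.α ((u, p) : v.M × P)).1
      rw [h2, map_add, Prod.fst_add, map_add, eq_neg_of_add_eq_zero_left (h u), neg_add]
      rfl
    obtain ⟨⟨y, ζ⟩, hy⟩ : ∃ q, q = f.β ((x, η) : v.M × CDual R P) := ⟨_, rfl⟩
    rw [← hy, stable_δ] at key
    have hζ : ζ = 0 := CDual.ext fun p => by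
      have := congrArg (fun φ : CDual R (v'.M × P') => φ (0, p)) key
      simpa using this
    have hξ : ξ = -v'.symm y := CDual.ext fun u => by
      have := congrArg (fun φ : CDual R (v'.M × P') => φ (u, 0)) key
      simp only [CDual.add_apply, dualMap_apply, LinearMap.fst_apply, LinearMap.snd_apply, map_zero,
        add_zero, CDual.neg_apply] at this
      rw [CDual.neg_apply, this, neg_neg]
    refine ⟨y, Prod.ext ?_ hξ.symm⟩
    change (f.β.symm ((y, 0) : v'.M × CDual R P')).1 = x
    rw [hζ] at hy
    rw [hy, LinearEquiv.symm_apply_apply]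
  · rintro ⟨y, hy⟩ u
    have h1 : compB f y = x := congrArg Prod.fst hy
    have h2 : -v'.symm y = ξ := congrArg Prod.snd hy
    rw [← h1, ← h2, hf.symm_compB, CDual.neg_apply, add_neg_cancel]

/-- Stabilised by the identity of $P'^*$, the symmetrisation factors through $\alpha^*$ and $\beta$,
with shears in between; simplicity descends by cancelling $P'^*$. -/
theorem union_simple (hZ : StarInvariant Z) {f : StTriple v v' P P'} (hf : f.IsIso Z) :
    (union f).Simple Z := by
  have he := hf.eqs
  -- Corrections for the last shear: after $\beta$ has been applied, $D_1$ restores the terms in the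
  -- symmetrised $\alpha\nu\alpha^*$, and $D_2$ the $P'^*$-component of $\alpha^{-*}(u,0)$.
  let D₁ : CDual R v.M →ₗ[R] v'.M := v'.M.evEquiv.symm.toLinearMap ∘ₗ
    (-bil (Q.symm f.push) (dualMap f.α.symm.toLinearMap ∘ₗ extL v.M P) (extL v'.M P'))
  let D₂ : CDual R v.M →ₗ[R] CDual R P' :=
    dualMap (LinearMap.inr R v'.M P') ∘ₗ dualMap f.α.symm.toLinearMap ∘ₗ extL v.M P
  let b' : CDual R P' →ₗ[R] v.M := LinearMap.fst R v.M (CDual R P) ∘ₗ f.β.symm.toLinearMap ∘ₗ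
    LinearMap.inr R v'.M (CDual R P')
  let eε : v'.M ≃ₗ[R] v'.M :=
    LinearEquiv.ofLinearMap ((ε : ℤ) • LinearMap.id) ((ε : ℤ) • LinearMap.id)
      (LinearMap.ext fun x => by simp [unit_zsmul_zsmul])
      (LinearMap.ext fun x => by simp [unit_zsmul_zsmul])
  have heε : IsSimple Z eε := IsSimple.zsmul ε fun x => rfl
  have s1 := IsSimple.assoc (Z := Z) (M := v.M) (N := v'.M.dual) (L := P'.dual)
  have s2 := (IsSimple.refl (Z := Z) (M := v.M)).prod
    (IsSimple.prodDual (M := v'.M) (N := P') hZ)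
  have s3 := (IsSimple.refl (Z := Z) (M := v.M)).prod (hf.simple_α.dual hZ)
  have s4 := (IsSimple.refl (Z := Z) (M := v.M)).prod
    (IsSimple.prodDual (M := v.M) (N := P) hZ).symm
  have s5 := (IsSimple.assoc (Z := Z) (M := v.M) (N := v.M.dual) (L := P.dual)).symm
  have s6 := (IsSimple.comm (Z := Z) (M := v.M) (N := v.M.dual)).prod
    (IsSimple.refl (M := P.dual))
  have s7 := IsSimple.assoc (Z := Z) (M := v.M.dual) (N := v.M) (L := P.dual)
  have s8 := IsSimple.shear' (Z := Z) (M := v.M.dual) (N := v.M.prod P.dual)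
    (v.symm ∘ₗ LinearMap.fst R v.M (CDual R P))
  have s9 := (IsSimple.refl (Z := Z) (M := v.M.dual)).prod
    ((IsSimple.refl (M := v.M)).prod (IsSimple.neg (M := P.dual)))
  have s10 := (IsSimple.refl (Z := Z) (M := v.M.dual)).prod hf.simple_β
  have s11 := (IsSimple.refl (Z := Z) (M := v.M.dual)).prod
    (heε.prod (IsSimple.neg (M := P'.dual)))
  have s12 := IsSimple.shear (Z := Z) (M := v.M.dual) (N := v'.M.prod P'.dual) (D₁.prod D₂)
  have s13 := (IsSimple.refl (Z := Z) (M := v.M.dual)).prod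
    ((IsSimple.ev (M := v'.M) hZ).prod (IsSimple.refl (M := P'.dual)))
  have s14 := (IsSimple.assoc (Z := Z) (M := v.M.dual) (N := v'.M.dual.dual) (L := P'.dual)).symm
  have s15 := (IsSimple.prodDual (Z := Z) (M := v.M) (N := v'.M.dual) hZ).prod
    (IsSimple.refl (M := P'.dual))
  -- Subtracting $b'\zeta$ from $x$ at the start removes the contribution of the entry $P'^*\to V$
  -- of $\beta^{-1}$.
  have s0 := (IsSimple.shear' (Z := Z) (M := v.M.prod v'.M.dual) (N := P'.dual)
    (LinearMap.inl R v.M (CDual R v'.M) ∘ₗ b')).symm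
  have key := (s0.trans <| s1.trans <| s2.trans <| s3.trans <| s4.trans <| s5.trans <|
    s6.trans <| s7.trans <| s8.trans <| s9.trans <| s10.trans <| s11.trans <| s12.trans <|
    s13.trans <| s14.trans s15)
  obtain ⟨e, hval, hs⟩ : ∃ e : ((v.M × CDual R v'.M) × CDual R P') ≃ₗ[R]
      (CDual R (v.M × CDual R v'.M) × CDual R P'),
      (∀ p l, e (p, l) = ((union f).symm p, l)) ∧ IsSimple Z
        (M := (v.M.prod v'.M.dual).prod P'.dual) (N := (v.M.prod v'.M.dual).dual.prod P'.dual)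
        e := by
    refine ⟨_, ?_, key⟩
    rintro ⟨x, ξ⟩ ζ
    obtain ⟨x₀, hx₀⟩ : ∃ x₀, x₀ = x - b' ζ := ⟨_, rfl⟩
    obtain ⟨χ, hχ⟩ : ∃ χ : CDual R (v'.M × P'), χ = extL v'.M P' ξ + extR v'.M P' ζ := ⟨_, rfl⟩
    obtain ⟨u, hu⟩ : ∃ u : CDual R v.M, u =
      dualMap (LinearMap.inl R v.M P) (dualMap f.α.toLinearMap χ) + v.symm x₀ := ⟨_, rfl⟩
    obtain ⟨η, hη⟩ : ∃ η : CDual R P, η =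
      -dualMap (LinearMap.inr R v.M P) (dualMap f.α.toLinearMap χ) := ⟨_, rfl⟩
    obtain ⟨y, hy⟩ : ∃ y, y = f.β ((x₀, η) : v.M × CDual R P) := ⟨_, rfl⟩
    trans ((prodDual (u, v'.M.evEquiv ((ε : ℤ) • y.1 + D₁ u)), -y.2 + D₂ u) :
      CDual R (v.M × CDual R v'.M) × CDual R P')
    · have hsub : (shear' (LinearMap.inl R v.M (CDual R v'.M) ∘ₗ b')).symm ((x, ξ), ζ) =
          ((x₀, ξ), ζ) := by
        rw [hx₀, shear'_symm_apply]
        simp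
      rw [LinearEquiv.trans_apply, hsub, hy, hη, hu, hχ]
      rfl
    -- By the choice of $u$ and $\eta$, $\alpha^*\chi=(u,0)-\delta(x_0,\eta)$; applying
    -- $\alpha^{-*}$ and the compatibility of $\delta$ gives the formula. Its $P'$-part shows that
    -- the last coordinate returns to $\zeta$.
    · have hA : ∀ w, χ w = dualMap f.α.symm.toLinearMap (extL v.M P u) w -
          ((bdry v').sum (triv ε P')).δ y w := fun w => by
        obtain ⟨⟨w, p⟩, rfl⟩ := f.α.surjective w
        have h1 := he.map_δ ((x₀, η) : v.M × CDual R P) ((w, p) : v.M × P)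
        have h2 : ((w, p) : v.M × P) = (w, 0) + (0, p) := by simp
        rw [hy, ← h1]
        change _ = u ((f.α.symm (f.α (w, p))).1) - (v.symm x₀ w + η p)
        rw [LinearEquiv.symm_apply_apply, hu, hη]
        change _ = χ (f.α ((w, 0) : v.M × P)) + v.symm x₀ w -
          (v.symm x₀ w + -χ (f.α ((0, p) : v.M × P)))
        rw [h2, map_add, map_add]
        abel
      have hχA : χ = dualMap f.α.symm.toLinearMap (extL v.M P u) -
          ((bdry v').sum (triv ε P')).δ y := CDual.ext hA
      have hx : x = x₀ + b' ζ := by rw [hx₀, sub_add_cancel]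
      refine Eq.symm (Prod.ext ?_ (CDual.ext fun p => ?_))
      · refine CDual.ext fun w => ?_
        obtain ⟨w, ω⟩ := w
        have e1 := he.map_γ (extL v'.M P' ω) (f.β.symm ((0, ζ) : v'.M × CDual R P'))
        have e2 := he.map_δ (f.β.symm ((0, ζ) : v'.M × CDual R P')) ((w, 0) : v.M × P)
        have e3 := he.map_γ (extL v'.M P' ω) ((x₀, η) : v.M × CDual R P)
        rw [LinearEquiv.apply_symm_apply, stable_δ_right] at e1
        rw [LinearEquiv.apply_symm_apply, stable_δ_right] at e2
        rw [← hy] at e3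
        change ω (compA f (b' ζ)) + Q.symm f.push (extL v'.M P' ω) (extR v'.M P' ζ) = ω 0 at e1
        change v.symm (b' ζ) w + (f.β.symm ((0, ζ) : v'.M × CDual R P')).2 0 =
          ζ (f.α ((w, 0) : v.M × P)).2 at e2
        change ω (compA f x₀) + Q.symm f.push (extL v'.M P' ω)
          (((bdry v').sum (triv ε P')).δ y) = ω y.1 at e3
        rw [map_zero, add_zero] at e2
        rw [map_zero] at e1
        have e4 : u w = ξ (compA f w) + ζ (f.α ((w, 0) : v.M × P)).2 + v.symm x₀ w := by
          rw [hu, hχ]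
          rfl
        have e5 : Q.symm f.push χ (extL v'.M P' ω) =
            Q.symm (compS f) ξ ω + Q.symm f.push (extR v'.M P' ζ) (extL v'.M P' ω) := by
          rw [hχ, map_add, symm_compS]
          rfl
        have e6 : Q.symm f.push χ (extL v'.M P' ω) =
            Q.symm f.push (dualMap f.α.symm.toLinearMap (extL v.M P u)) (extL v'.M P' ω) -
              Q.symm f.push (((bdry v').sum (triv ε P')).δ y) (extL v'.M P' ω) := by
          rw [hχA, map_sub]
          rfl
        have e7 : ω (D₁ u) = star (-Q.symm f.push (dualMap f.α.symm.toLinearMap (extL v.M P u))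
            (extL v'.M P' ω)) := BMod.apply_evEquiv_symm _ _
        refine (union_symm_apply f x w ξ ω).trans ?_
        change _ = u w + star (ω ((ε : ℤ) • y.1 + D₁ u))
        rw [map_add, map_zsmul, star_add, e7, star_star, star_zsmul, ← e3, star_add,
          Q.star_symm, smul_add, unit_zsmul_zsmul, hx, map_add, map_add, map_add,
          CDual.add_apply, e2, eq_neg_of_add_eq_zero_left e1, star_add, star_neg, Q.star_symm, smul_add,
          smul_neg, unit_zsmul_zsmul, e4]
        have e8 := e5.symm.trans e6
        rw [← sub_eq_zero] at e8 ⊢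
        rw [← neg_eq_zero, ← e8]
        abel
      · have h := hA (0, p)
        rw [hχ] at h
        change ξ 0 + ζ p = dualMap f.α.symm.toLinearMap (extL v.M P u) ((0, p) : v'.M × P') -
          (v'.symm y.1 0 + y.2 p) at h
        rw [map_zero, map_zero, zero_add, zero_add] at h
        refine h.trans ?_
        change _ = -y.2 p + dualMap f.α.symm.toLinearMap (extL v.M P u) ((0, p) : v'.M × P')
        abel
  obtain ⟨e₀, he₀, rfl⟩ := exists_equiv_of_prod e _ hval
  exact ⟨e₀, IsSimple.of_prod_refl hs, he₀⟩

end Union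

/-! ## The embeddings of the union, and homotopies -/

section Embeddings

variable {R : Type u} [Ring R] [StarRing R] {ε : ℤˣ} {Z : AddSubgroup (RedK1 R)}

theorem Q.symm_of_pull_eq {M N : Type u} [AddCommGroup M] [Module R M] [AddCommGroup N]
    [Module R N] {f : M →ₗ[R] N} {q : Q R ε N} {q' : Q R ε M} (h : Q.pull f q = q') (x y : M) :
    Q.symm q (f x) (f y) = Q.symm q' x y := by
  rw [← h, Q.symm_pull]

/-! ### Isometries and their action on 2-sided primitive embeddings. -/

section Isometries

variable {m₀ m₁ m₂ : QForm R ε}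

/-- The identity isometry. -/
def Isometry.refl (Z : AddSubgroup (RedK1 R)) (m : QForm R ε) : Isometry Z m m :=
  ⟨LinearEquiv.refl R _, IsSimple.refl, Q.pull_id _⟩

/-- The inverse of an isometry. -/
def Isometry.symm (k : Isometry Z m₀ m₁) : Isometry Z m₁ m₀ :=
  ⟨k.e.symm, k.simple.symm, by
    rw [← k.isometric, Q.pull_pull]
    exact (Q.pull_congr (fun x => k.e.apply_symm_apply x) _).trans (Q.pull_id _)⟩

/-- The composite of two isometries. -/
def Isometry.trans (k : Isometry Z m₀ m₁) (l : Isometry Z m₁ m₂) : Isometry Z m₀ m₂ :=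
  ⟨k.e.trans l.e, k.simple.trans l.simple, by
    rw [← k.isometric, ← l.isometric, Q.pull_pull]
    rfl⟩

/-- The isometry `-1`. -/
def Isometry.minus (Z : AddSubgroup (RedK1 R)) (m : QForm R ε) : Isometry Z m m :=
  ⟨LinearEquiv.neg R, IsSimple.neg, by
    refine (Q.pull_congr (g := -LinearMap.id) (fun x => rfl) _).trans ?_
    rw [Q.pull_neg_map, Q.pull_id]⟩

theorem Isometry.symm_apply (k : Isometry Z m₀ m₁) (x y : m₀.M) :
    m₁.symm (k.e x) (k.e y) = m₀.symm x y := Q.symm_of_pull_eq k.isometric x y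

theorem Isometry.simple_form (hZ : StarInvariant Z) (k : Isometry Z m₀ m₁) (h : m₀.Simple Z) :
    m₁.Simple Z := by
  obtain ⟨e, hs, he⟩ := h
  refine ⟨k.e.symm.trans (e.trans (dualEquiv k.e).symm), k.simple.symm.trans
    (hs.trans (k.simple.dual hZ).symm), fun x => CDual.ext fun y => ?_⟩
  change e (k.e.symm x) (k.e.symm y) = _
  rw [he, ← k.symm_apply, LinearEquiv.apply_symm_apply, LinearEquiv.apply_symm_apply]

/-- An isometry of negatives is an isometry. -/
def Isometry.ofNeg {m₀ m₁ : QForm R ε} (k : Isometry Z m₀.neg m₁.neg) : Isometry Z m₀ m₁ :=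
  ⟨k.e, k.simple, by
    have h := k.isometric
    rw [map_neg, neg_inj] at h
    exact h⟩

/-- An isometry is an isometry of the negatives. -/
def Isometry.neg {m₀ m₁ : QForm R ε} (k : Isometry Z m₀ m₁) : Isometry Z m₀.neg m₁.neg :=
  ⟨k.e, k.simple, by rw [map_neg, k.isometric]⟩

variable {v w : QForm R ε}

/-- The composite of a 2-sided primitive embedding with isometries of the three forms. -/
def TwoSided.comp (hZ : StarInvariant Z) (E : TwoSided Z v w m₀) (k : Isometry Z m₀ m₁)
    (g : Isometry Z v v) (h : Isometry Z w w) : TwoSided Z v w m₁ where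
  j := k.e.toLinearMap ∘ₗ E.j ∘ₗ g.e.symm.toLinearMap
  j' := k.e.toLinearMap ∘ₗ E.j' ∘ₗ h.e.symm.toLinearMap
  simple := k.simple_form hZ E.simple
  isometric := by
    rw [← Q.pull_pull, k.isometric, ← Q.pull_pull, E.isometric]
    exact g.symm.isometric
  isometric' := by
    rw [← Q.pull_pull, k.isometric, ← Q.pull_pull, E.isometric']
    exact h.symm.isometric
  split := by
    obtain ⟨p, hp⟩ := E.split
    refine ⟨g.e.toLinearMap ∘ₗ p ∘ₗ k.e.symm.toLinearMap, LinearMap.ext fun x => ?_⟩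
    have := LinearMap.congr_fun hp (g.e.symm x)
    simp only [LinearMap.comp_apply, LinearMap.id_apply] at this
    simp [this]
  split' := by
    obtain ⟨p, hp⟩ := E.split'
    refine ⟨h.e.toLinearMap ∘ₗ p ∘ₗ k.e.symm.toLinearMap, LinearMap.ext fun x => ?_⟩
    have := LinearMap.congr_fun hp (h.e.symm x)
    simp only [LinearMap.comp_apply, LinearMap.id_apply] at this
    simp [this]
  orth_eq := by
    have key : ∀ x, x ∈ orth (m := m₀) E.j ↔ k.e x ∈ orth (m := m₁)
        (k.e.toLinearMap ∘ₗ E.j ∘ₗ g.e.symm.toLinearMap) := by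
      intro x
      simp only [orth, LinearMap.mem_ker]
      constructor
      · intro hx
        refine CDual.ext fun y => ?_
        refine (k.symm_apply x (E.j (g.e.symm y))).trans ?_
        exact congrArg (fun φ : CDual R v.M => φ (g.e.symm y)) hx
      · intro hx
        refine CDual.ext fun y => ?_
        refine (k.symm_apply x (E.j y)).symm.trans ?_
        have := congrArg (fun φ : CDual R v.M => φ (g.e y)) hx
        simpa using this
    ext x
    obtain ⟨x, rfl⟩ := k.e.surjective x
    rw [← key, E.orth_eq]
    constructor
    · rintro ⟨y, rfl⟩
      exact ⟨h.e y, by simp⟩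
    · rintro ⟨y, hy⟩
      exact ⟨h.e.symm y, k.e.injective hy⟩
  based := by
    obtain ⟨e, he, h1, h2⟩ := E.based
    refine ⟨(LinearEquiv.prodCongr g.e.symm (dualEquiv h.e)).trans (e.trans k.e),
      (g.simple.symm.prod (h.simple.dual hZ)).trans (he.trans k.simple), fun x => ?_,
      fun x ξ => CDual.ext fun y => ?_⟩
    · change k.e (e ((g.e.symm x, dualEquiv h.e 0) : v.M × CDual R w.M)) = _
      rw [map_zero, h1]
      rfl
    · refine (k.symm_apply _ _).trans ?_
      have := congrArg (fun φ : CDual R w.M => φ (h.e.symm y)) (h2 (g.e.symm x) (dualEquiv h.e ξ))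
      simpa using this

theorem TwoSided.Isomorphic.refl (E : TwoSided Z v w m₀) : E.Isomorphic E :=
  ⟨Isometry.refl Z m₀, fun _ => rfl, fun _ => rfl⟩

theorem TwoSided.Isomorphic.symm {E : TwoSided Z v w m₀} {E' : TwoSided Z v w m₁}
    (h : E.Isomorphic E') : E'.Isomorphic E := by
  obtain ⟨g, h1, h2⟩ := h
  exact ⟨g.symm, fun x => (LinearEquiv.symm_apply_eq g.e).2 (h1 x).symm,
    fun x => (LinearEquiv.symm_apply_eq g.e).2 (h2 x).symm⟩

theorem TwoSided.Isomorphic.trans {E : TwoSided Z v w m₀} {E' : TwoSided Z v w m₁}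
    {E'' : TwoSided Z v w m₂} (h : E.Isomorphic E') (h' : E'.Isomorphic E'') :
    E.Isomorphic E'' := by
  obtain ⟨g, h1, h2⟩ := h
  obtain ⟨g', h1', h2'⟩ := h'
  exact ⟨g.trans g', fun x => (congrArg g'.e (h1 x)).trans (h1' x),
    fun x => (congrArg g'.e (h2 x)).trans (h2' x)⟩

/-- The composite of a 2-sided primitive embedding with an isometry of the ambient forms. -/
abbrev TwoSided.map (hZ : StarInvariant Z) (E : TwoSided Z v w m₀) (k : Isometry Z m₀ m₁) :
    TwoSided Z v w m₁ := E.comp hZ k (Isometry.refl Z v) (Isometry.refl Z w)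

theorem TwoSided.isomorphic_map (hZ : StarInvariant Z) (E : TwoSided Z v w m₀)
    (k : Isometry Z m₀ m₁) : E.Isomorphic (E.map hZ k) :=
  ⟨k, fun _ => rfl, fun _ => rfl⟩

end Isometries

/-! ### The embedding pair of a union, and isomorphisms between such pairs. -/

variable {v v' : QForm R ε} {P P' L L' : BMod R}

/-- The 2-sided primitive embedding of `v` and `-v'` in `v ∪_f -v'`. -/
def prEmb (hZ : StarInvariant Z) (f : StableIso Z v v') : TwoSided Z v v'.neg (union f.f) where
  j := unionInl f.f
  j' := unionInr f.f
  simple := union_simple hZ f.isIso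
  isometric := pull_unionInl _
  isometric' := pull_unionInr f.isIso.eqs
  split := ⟨LinearMap.fst R v.M (CDual R v'.M), rfl⟩
  split' := by
    -- The entry equation $ab+\hat s\lambda'=1$ says that $(a,-\hat s)$ is a retraction of
    -- $(b,-\lambda')$.
    let σ : CDual R v'.M →ₗ[R] v'.M :=
      v'.M.evEquiv.symm.toLinearMap ∘ₗ T _ (Q.symm (compS f.f))
    refine ⟨compA f.f ∘ₗ LinearMap.fst R v.M (CDual R v'.M) -
      σ ∘ₗ LinearMap.snd R v.M (CDual R v'.M), LinearMap.ext fun y => BMod.ext_dual fun ξ => ?_⟩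
    have h : ∀ η, ξ (σ η) = Q.symm (compS f.f) ξ η := fun η => by
      refine (BMod.apply_evEquiv_symm _ _).trans ?_
      rw [T_apply, star_star]
    change ξ (compA f.f (compB f.f y) - σ (-v'.symm y)) = ξ y
    rw [map_neg, sub_neg_eq_add, map_add, h, f.isIso.eqs.apply_compA_compB]
  orth_eq := union_orth f.isIso.eqs
  based := ⟨LinearEquiv.refl R _, IsSimple.refl, fun _ => rfl, fun x ξ =>
    CDual.ext fun y => union_symm_unionInr f.isIso.eqs x ξ y⟩

/-- The components `(a, b, s)` and `(a', b', s')` of two stable isomorphisms are related as by a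
homotopy `Δ` such that `Δ^*` has upper left entry `D : V'^* → V`. -/
def Linked (f : StTriple v v' P P') (f' : StTriple v v' L L') : Prop :=
  ∃ D : CDual R v'.M →ₗ[R] v.M,
    (∀ y, compB f' y = compB f y + D (v'.symm y)) ∧
    (∀ x (ξ : CDual R v'.M), ξ (compA f' x) = ξ (compA f x) + v.symm (D ξ) x) ∧
    Q.pull (LinearMap.prod D LinearMap.id) (union f).form = -compS f'

theorem pull_inr_union (f : StTriple v v' P P') :
    Q.pull (LinearMap.inr R v.M (CDual R v'.M)) (union f).form = -compS f := by
  obtain ⟨s, hs⟩ := Q.mk_surjective (compS f)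
  obtain ⟨θ, hθ⟩ := Q.mk_surjective v.form
  rw [union_form, ← hs, ← hθ, map_sub, map_add, Q.pull_mk, Q.pull_mk, Q.pull_mk, Q.pull_mk,
    Q.pull_mk, ← Q.mk_neg, ← Q.mk_add, ← Q.mk_sub]
  exact congrArg _ (hom_ext fun x y => by simp)

theorem pull_shear_union {f : StTriple v v' P P'} {f' : StTriple v v' L L'}
    {D : CDual R v'.M →ₗ[R] v.M}
    (ha : ∀ x (ξ : CDual R v'.M), ξ (compA f' x) = ξ (compA f x) + v.symm (D ξ) x)
    (hs : Q.pull (LinearMap.prod D LinearMap.id) (union f).form = -compS f') :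
    Q.pull (shear' D).toLinearMap (union f).form = (union f').form := by
  refine Q.prod_ext ?_ ?_ fun x ξ => ?_
  · refine Eq.trans ?_ (pull_unionInl f').symm
    rw [← pull_unionInl f, Q.pull_pull]
    exact Q.pull_congr (fun x => by simp [unionInl]) _
  · rw [pull_inr_union, ← hs, Q.pull_pull]
    exact Q.pull_congr (fun x => by simp) _
  · rw [Q.symm_pull]
    have h1 := union_symm_apply f x (D ξ) 0 ξ
    have h2 := union_symm_apply f' x 0 0 ξ
    have h3 : (shear' D).toLinearMap ((x, 0) : v.M × CDual R v'.M) = (x, 0) := by simp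
    have h4 : (shear' D).toLinearMap ((0, ξ) : v.M × CDual R v'.M) = (D ξ, ξ) := by simp
    have e3 : (Q.symm (compS f) 0) ξ = 0 := by rw [map_zero]; rfl
    have e4 : (Q.symm (compS f') 0) ξ = 0 := by rw [map_zero]; rfl
    rw [h3, h4]
    refine h1.trans (Eq.trans ?_ h2.symm)
    rw [ha, e3, e4, star_add, smul_add, Q.symm_swap, map_zero (v.symm x), CDual.zero_apply,
      CDual.zero_apply]
    abel

/-- The shear by $D$ fixes $V$ and carries the second embedding of the union of $f'$ to that of $f$;
the remaining conditions on $D$ make it an isometry. -/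
theorem Linked.isomorphic (hZ : StarInvariant Z) {f f' : StableIso Z v v'} (h : Linked f.f f'.f) :
    (prEmb hZ f').Isomorphic (prEmb hZ f) := by
  obtain ⟨D, hb, ha, hs⟩ := h
  let k : Isometry Z (union f'.f) (union f.f) :=
    { e := shear' D
      simple := IsSimple.shear' (M := v.M) (N := v'.M.dual) D
      isometric := pull_shear_union ha hs }
  refine ⟨k, fun x => ?_, fun y => ?_⟩
  · change ((x + D 0, 0) : v.M × CDual R v'.M) = (x, 0)
    rw [map_zero, add_zero]
  · change ((compB f'.f y + D (-v'.symm y), -v'.symm y) : v.M × CDual R v'.M) =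
      (compB f.f y, -v'.symm y)
    rw [hb, map_neg, add_neg_cancel_right]

/-- The isometry fixes $V$ and, as pairing with the second embedding is the projection to $V'^*$,
also that projection; so it is a shear by some $D$. The three conditions are its values on the
second embedding, its cross terms, and its restriction to $V'^*$. -/
theorem linked_of_isomorphic (hZ : StarInvariant Z) {f f' : StableIso Z v v'}
    (h : (prEmb hZ f').Isomorphic (prEmb hZ f)) : Linked f.f f'.f := by
  obtain ⟨g, h1, h2⟩ := h
  have h1' : ∀ x : v.M, g.e ((x, 0) : v.M × CDual R v'.M) = ((x, 0) : v.M × CDual R v'.M) := h1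
  have h2' : ∀ y : v'.M, g.e ((compB f'.f y, -v'.symm y) : v.M × CDual R v'.M) =
    ((compB f.f y, -v'.symm y) : v.M × CDual R v'.M) := h2
  have hsnd : ∀ p : v.M × CDual R v'.M, (g.e p : v.M × CDual R v'.M).2 = p.2 := fun p =>
    CDual.ext fun y => by
      have e1 := union_symm_unionInr f.isIso.eqs (g.e p : v.M × CDual R v'.M).1
        (g.e p : v.M × CDual R v'.M).2 y
      have e2 := union_symm_unionInr f'.isIso.eqs p.1 p.2 y
      rw [← e1, ← e2]
      refine Eq.trans ?_ (g.symm_apply p (unionInr f'.f y))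
      exact congrArg _ (h2 y).symm
  let D : CDual R v'.M →ₗ[R] v.M := LinearMap.fst R v.M (CDual R v'.M) ∘ₗ g.e.toLinearMap ∘ₗ
    LinearMap.inr R v.M (CDual R v'.M)
  have hD : ∀ ξ : CDual R v'.M, g.e ((0, ξ) : v.M × CDual R v'.M) =
    ((D ξ, ξ) : v.M × CDual R v'.M) := fun ξ => Prod.ext rfl (hsnd _)
  refine ⟨D, fun y => ?_, fun x ξ => ?_, ?_⟩
  · have e1 : ((compB f'.f y, -v'.symm y) : v.M × CDual R v'.M) =
      (compB f'.f y, 0) + (0, -v'.symm y) := by simp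
    have e2 := h2' y
    rw [e1, map_add, h1', hD, map_neg] at e2
    have e3 : compB f'.f y + -D (v'.symm y) = compB f.f y := congrArg Prod.fst e2
    rw [← e3, neg_add_cancel_right]
  · have e1 := g.symm_apply ((x, 0) : v.M × CDual R v'.M) ((0, ξ) : v.M × CDual R v'.M)
    rw [h1', hD] at e1
    have e2 := (union_symm_apply f.f x (D ξ) 0 ξ).symm.trans
      (e1.trans (union_symm_apply f'.f x 0 0 ξ))
    simp only [map_zero, CDual.zero_apply, add_zero, zero_add, sub_zero] at e2
    have e3 : (Q.symm (compS f.f) 0) ξ = 0 := by rw [map_zero]; rfl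
    have e4 : (Q.symm (compS f'.f) 0) ξ = 0 := by rw [map_zero]; rfl
    have e5 : (ε : ℤ) • star (ξ (compA f'.f x)) = v.symm x (D ξ) +
        (ε : ℤ) • star (ξ (compA f.f x)) := by
      simpa [e3, e4] using e2.symm
    have e6 := congrArg (fun r => (ε : ℤ) • star r) e5
    simp only [star_zsmul, star_add, star_star, smul_add, unit_zsmul_zsmul, Q.star_symm] at e6
    rw [e6, add_comm]
  · rw [← pull_inr_union, ← g.isometric, Q.pull_pull]
    exact Q.pull_congr (fun ξ => (hD ξ).symm) _

end Embeddings

section Homotopy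

variable {R : Type u} [Ring R] [StarRing R] {ε : ℤˣ} {Z : AddSubgroup (RedK1 R)}
variable {v v' : QForm R ε} {P P' L L' : BMod R}

/-! ## Stabilisation -/

section Stabilisation

variable {r K K' : BMod R}

/-- Trivial formations have zero Hessian and identity $\delta$, so the Hessian equation reads
$\nu=0$. -/
theorem ν_eq_zero_of_isIso {g : Triple (triv ε K) ((triv ε P).sum (triv ε r))}
    (hg : g.IsIso Z) : g.ν = 0 := by
  have h := hg.hessian
  simp only [map_zero, add_zero, zero_add] at h
  exact (Q.pull_id _).symm.trans h

variable (f : StTriple v v' P P') (g : Triple (triv ε K) ((triv ε P).sum (triv ε r)))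
  (h : Triple ((triv ε P').sum (triv ε r)) (triv ε K'))

theorem compA_stabilise : compA (stabilise f g h) = compA f := by
  refine LinearMap.ext fun x => ?_
  change (f.α ((x, (g.α (0 : K) : P × r).1) : v.M × P)).1 = (f.α ((x, 0) : v.M × P)).1
  rw [map_zero]
  rfl

theorem compB_stabilise : compB (stabilise f g h) = compB f := by
  refine LinearMap.ext fun y => ?_
  change (f.β.symm ((y, (h.β.symm (0 : CDual R K') : CDual R P' × CDual R r).1) :
    v'.M × CDual R P')).1 = (f.β.symm ((y, 0) : v'.M × CDual R P')).1
  rw [map_zero]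
  rfl

theorem push_id (X : SplitFormation R ε) : (Triple.id X).push = 0 := map_zero _

theorem push_assoc (X Y W : SplitFormation R ε) : (Triple.assoc X Y W).push = 0 := map_zero _

/-- With the two preceding lemmas: stabilisation touches only trivial summands and leaves $a$, $b$,
$s$ unchanged. For $s$ the vanishing of $\nu$ of the first isomorphism is needed; the last one does
not reach the corner $V'^*$. -/
theorem compS_stabilise (hg : g.ν = 0) : compS (stabilise f g h) = compS f := by
  have h1 : g.push = 0 := by rw [Triple.push, hg, map_zero]
  have h2 : (Triple.assoc (bdry v) (triv ε P) (triv ε r)).inv.push = 0 := by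
    rw [Triple.push_inv]
    exact neg_zero
  rw [compS_eq, compS_eq, stabilise, Triple.push_comp, Triple.push_comp, Triple.push_comp,
    Triple.push_comp, Triple.push_sum, Triple.push_sum, Triple.push_sum, push_assoc, push_id,
    push_id, push_id, h1, h2]
  simp only [map_zero, map_add, zero_add, add_zero, Q.pull_pull]
  have h3 : ∀ q : Q R ε (CDual R K'), Q.pull (dualMap (LinearMap.inr R v'.M K') ∘ₗ extL v'.M K') q
      = 0 := fun q => by
    refine Eq.trans (Q.pull_congr (fun ξ => CDual.ext fun x => ?_) q) (Q.pull_zero_map q)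
    exact map_zero ξ
  refine (congrArg₂ (· + ·) ?_ (h3 _)).trans (add_zero _)
  exact Q.pull_congr (fun ξ => CDual.ext fun x => rfl) _

end Stabilisation

/-! ## Homotopies -/

section Comparison

variable {f f' : StTriple v v' P P'}

/-- The component `P'^* → V` of `β⁻¹`: its upper right entry. -/
def compB' (f : StTriple v v' P P') : CDual R P' →ₗ[R] v.M :=
  LinearMap.fst R v.M (CDual R P) ∘ₗ f.β.symm.toLinearMap ∘ₗ LinearMap.inr R v'.M (CDual R P')

theorem Triple.Eqs.symm_compB' (hf : f.Eqs) (ζ : CDual R P') (u : v.M) :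
    v.symm (compB' f ζ) u = ζ (f.α ((u, 0) : v.M × P)).2 := by
  have h := hf.map_δ (f.β.symm ((0, ζ) : v'.M × CDual R P')) ((u, 0) : v.M × P)
  rw [LinearEquiv.apply_symm_apply, stable_δ_right] at h
  refine Eq.trans ?_ h
  change _ = v.symm (compB' f ζ) u + (f.β.symm ((0, ζ) : v'.M × CDual R P')).2 0
  rw [map_zero, add_zero]

theorem Triple.Eqs.β_symm_snd (hf : f.Eqs) (y : v'.M) (p : P) :
    (f.β.symm ((y, 0) : v'.M × CDual R P')).2 p = v'.symm y (f.α ((0, p) : v.M × P)).1 := by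
  have h := hf.map_δ (f.β.symm ((y, 0) : v'.M × CDual R P')) ((0, p) : v.M × P)
  rw [LinearEquiv.apply_symm_apply, stable_δ_left] at h
  refine Eq.trans ?_ h
  change _ = v.symm (compB f y) 0 + (f.β.symm ((y, 0) : v'.M × CDual R P')).2 p
  rw [map_zero, zero_add]

theorem Triple.Eqs.apply_compA_compB' (hf : f.Eqs) (ξ : CDual R v'.M) (ζ : CDual R P') :
    ξ (compA f (compB' f ζ)) = -Q.symm f.push (extL v'.M P' ξ) (extR v'.M P' ζ) := by
  have h := hf.map_γ (extL v'.M P' ξ) (f.β.symm ((0, ζ) : v'.M × CDual R P'))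
  rw [LinearEquiv.apply_symm_apply, stable_δ_right] at h
  refine eq_neg_of_add_eq_zero_left (h.trans ?_)
  exact map_zero ξ

/-- The Hessian of the target vanishes on $P'^*$, so this corner of $\alpha\nu\alpha^*$ is
determined by the corresponding column of $\beta^{-1}$. -/
theorem Triple.Eqs.pull_extR_push (hf : f.Eqs) :
    Q.pull (extR v'.M P') f.push = -Q.pull (compB' f) v.form := by
  let i : CDual R P' →ₗ[R] (v'.M × CDual R P') := LinearMap.inr R _ _
  have h := congrArg (Q.pull (f.β.symm.toLinearMap ∘ₗ i)) hf.hessian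
  simp only [map_add, Q.pull_pull, map_zero, add_zero] at h
  refine eq_neg_of_add_eq_zero_right (Eq.trans ?_ (h.trans ?_))
  · congr 1
    refine Q.pull_congr (fun ζ => ?_) _
    refine (stable_δ_right v' P' ζ).symm.trans (congrArg _ ?_)
    exact (f.β.apply_symm_apply _).symm
  · refine (Q.pull_congr (g := 0) (fun ζ => ?_) _).trans (Q.pull_zero_map _)
    change (f.β (f.β.symm (0, ζ))).1 = 0
    rw [LinearEquiv.apply_symm_apply]

/-- A homotopy in terms of `C = Δ^*`. -/
theorem homotopic_iff {X Y : SplitFormation R ε} {f f' : Triple X Y} : Homotopic f f' ↔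
    ∃ C : CDual R Y.F →ₗ[R] X.G,
      (∀ z, f'.β.symm z - f.β.symm z = C (Y.δ z)) ∧
      (∀ (ξ : CDual R Y.F) (u : X.F), ξ (f'.α u) - ξ (f.α u) = X.δ (C ξ) u) ∧
      f'.push - f.push =
        Q.mk (-((ε : ℤ) • (ev R Y.F ∘ₗ f'.α.toLinearMap ∘ₗ X.γ ∘ₗ C))) + Q.pull C X.θ := by
  have key : ∀ Δ : CDual R X.G →ₗ[R] Y.F,
      ((∀ φ : CDual R X.G, dualMap f'.β.symm.toLinearMap φ - dualMap f.β.symm.toLinearMap φ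
        = flip Y.δ (Δ φ)) ↔ ∀ z, f'.β.symm z - f.β.symm z = codual Δ (Y.δ z)) ∧
      ((∀ x : X.F, f'.α x - f.α x = Δ (flip X.δ x)) ↔
        ∀ (ξ : CDual R Y.F) (u : X.F), ξ (f'.α u) - ξ (f.α u) = X.δ (codual Δ ξ) u) := by
    intro Δ
    constructor
    · constructor
      · intro h z
        refine BMod.ext_dual fun φ => ?_
        have := congrArg (fun ψ : CDual R Y.G => ψ z) (h φ)
        rw [apply_codual, map_sub]
        exact this
      · intro h φ
        refine CDual.ext fun z => ?_
        have := congrArg φ (h z)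
        rw [apply_codual, map_sub] at this
        exact this
    · have h0 : ∀ ξ u, X.δ (codual Δ ξ) u = ξ (Δ (flip X.δ u)) := fun ξ u => by
        have := apply_codual Δ ξ (flip X.δ u)
        rw [flip_apply] at this
        rw [← star_star (X.δ (codual Δ ξ) u), this, star_star]
      constructor
      · intro h ξ u
        rw [h0, ← h, map_sub]
      · intro h u
        refine BMod.ext_dual fun ξ => ?_
        rw [map_sub, h, h0]
  constructor
  · rintro ⟨Δ, h1, h2, h3⟩
    exact ⟨codual Δ, (key Δ).1.1 h1, (key Δ).2.1 h2, h3⟩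
  · rintro ⟨C, h1, h2, h3⟩
    let Δ : CDual R X.G →ₗ[R] Y.F := codual C
    have hΔ : codual Δ = C := LinearMap.ext fun F => BMod.ext_dual fun φ => by
      rw [apply_codual, apply_codual, star_star]
    refine ⟨Δ, (key Δ).1.2 ?_, (key Δ).2.2 ?_, ?_⟩
    · rwa [hΔ]
    · rwa [hΔ]
    · rwa [hΔ]

/-- Since $a'$ and $a$ differ by the dual of $\lambda D$, replacing $a$ by $a'$ in the mixed term
costs $2D^*\theta$. This turns the union form of the condition into the third equation of a
homotopy. -/
theorem linked_hessian_iff {D : CDual R v'.M →ₗ[R] v.M}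
    (ha : ∀ x (ξ : CDual R v'.M), ξ (compA f' x) = ξ (compA f x) + v.symm (D ξ) x) :
    Q.pull (LinearMap.prod D LinearMap.id) (union f).form = -compS f' ↔
      compS f' - compS f =
        Q.mk (-((ε : ℤ) • (ev R v'.M ∘ₗ compA f' ∘ₗ D))) + Q.pull D v.form := by
  have h1 : Q.pull (LinearMap.prod D LinearMap.id) (union f).form =
      Q.pull D v.form + Q.mk ((ε : ℤ) • (ev R v'.M ∘ₗ compA f ∘ₗ D)) - compS f := by
    rw [union_form, map_sub, map_add, Q.pull_pull, Q.pull_pull, Q.pull_mk]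
    congr 1
    exact Q.pull_id _
  have h2 : (Q.mk ((ε : ℤ) • (ev R v'.M ∘ₗ compA f' ∘ₗ D)) : Q R ε _) =
      Q.mk ((ε : ℤ) • (ev R v'.M ∘ₗ compA f ∘ₗ D)) + (Q.pull D v.form + Q.pull D v.form) := by
    rw [← Q.mk_symm, ← Q.mk_add]
    refine congrArg _ (hom_ext fun ξ η => ?_)
    have h3 := ha (D ξ) η
    change (ε : ℤ) • star (η (compA f' (D ξ))) =
      (ε : ℤ) • star (η (compA f (D ξ))) + Q.symm (Q.pull D v.form) ξ η
    rw [h3, star_add, smul_add, Q.symm_swap, Q.symm_pull]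
  rw [h1, Q.mk_neg, h2]
  generalize (Q.mk ((ε : ℤ) • (ev R v'.M ∘ₗ compA f ∘ₗ D)) : Q R ε _) = A
  generalize Q.pull D v.form = B
  constructor
  · intro h
    have h' : compS f' = compS f - A - B := by
      rw [← neg_inj, ← h]
      abel
    rw [h']
    abel
  · intro h
    rw [sub_eq_iff_eq_add.1 h]
    abel

/-- $D$ is the upper left entry of $\Delta^*$, and each condition is the corner of a homotopy
equation. -/
theorem Homotopic.linked (h : Homotopic f f') : Linked f f' := by
  obtain ⟨C, h1, h2, h3⟩ := homotopic_iff.1 h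
  let D : CDual R v'.M →ₗ[R] v.M := LinearMap.fst R v.M (CDual R P) ∘ₗ C ∘ₗ extL v'.M P'
  have ha : ∀ x (ξ : CDual R v'.M), ξ (compA f' x) = ξ (compA f x) + v.symm (D ξ) x := by
    intro x ξ
    have := h2 (extL v'.M P' ξ) ((x, 0) : v.M × P)
    have h0 : ((bdry v).sum (triv ε P)).δ (C (extL v'.M P' ξ)) ((x, 0) : v.M × P) =
        v.symm (D ξ) x := by
      change v.symm (D ξ) x + (C (extL v'.M P' ξ)).2 0 = _
      rw [map_zero, add_zero]
    rw [h0] at this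
    rw [← this, add_comm]
    exact (sub_add_cancel _ _).symm
  refine ⟨D, fun y => ?_, ha, (linked_hessian_iff ha).2 ?_⟩
  · have := h1 ((y, 0) : v'.M × CDual R P')
    rw [stable_δ_left] at this
    rw [← sub_eq_iff_eq_add']
    exact congrArg Prod.fst this
  · have := congrArg (Q.pull (extL v'.M P')) h3
    rw [map_sub, map_add, Q.pull_mk, Q.pull_pull] at this
    refine this.trans ?_
    congr 1
    simp only [map_zero, add_zero, Q.pull_pull]
    rfl

/-- Only the corner of $\Delta^*$ is free. The other blocks are dictated by the linear homotopy
equations because $\delta$ is an identity on trivial summands; the remaining blocks of the quadratic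
equation then follow from $f$ and $f'$ being isomorphisms. -/
theorem Linked.homotopic (hf : f.Eqs) (hf' : f'.Eqs) (h : Linked f f') : Homotopic f f' := by
  obtain ⟨D, hb, ha, hs⟩ := h
  rw [linked_hessian_iff ha] at hs
  -- The first component is the given $D$; the second is forced by the change of $\alpha$ on $P$.
  let C₁ : CDual R v'.M →ₗ[R] (v.M × CDual R P) := D.prod
    (dualMap (LinearMap.fst R v'.M P' ∘ₗ (f'.α.toLinearMap - f.α.toLinearMap) ∘ₗ
      LinearMap.inr R v.M P))
  -- This column is forced to be the change of $\beta^{-1}$ on $P'^*$.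
  let C₂ : CDual R P' →ₗ[R] (v.M × CDual R P) :=
    (f'.β.symm.toLinearMap - f.β.symm.toLinearMap) ∘ₗ LinearMap.inr R v'.M (CDual R P')
  let C : CDual R (v'.M × P') →ₗ[R] (v.M × CDual R P) := C₁.coprod C₂ ∘ₗ prodDual.symm.toLinearMap
  have hpL : ∀ ξ : CDual R v'.M, prodDual.symm (extL v'.M P' ξ) = (ξ, 0) := fun ξ =>
    Prod.ext (CDual.ext fun x => rfl) (CDual.ext fun x => map_zero ξ)
  have hpR : ∀ ζ : CDual R P', prodDual.symm (extR v'.M P' ζ) = (0, ζ) := fun ζ =>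
    Prod.ext (CDual.ext fun x => map_zero ζ) (CDual.ext fun x => rfl)
  have hL : ∀ ξ, C (extL v'.M P' ξ) = C₁ ξ := fun ξ => by
    change (C₁.coprod C₂) (prodDual.symm (extL v'.M P' ξ)) = _
    rw [hpL, LinearMap.coprod_apply, map_zero, add_zero]
  have hR : ∀ ζ, C (extR v'.M P' ζ) = C₂ ζ := fun ζ => by
    change (C₁.coprod C₂) (prodDual.symm (extR v'.M P' ζ)) = _
    rw [hpR, LinearMap.coprod_apply, map_zero, zero_add]
  have hadd : ∀ y ζ, f'.β.symm ((y, ζ) : v'.M × CDual R P') - f.β.symm ((y, ζ) : v'.M × CDual R P')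
      = (f'.β.symm ((y, 0) : v'.M × CDual R P') - f.β.symm ((y, 0) : v'.M × CDual R P')) +
        C₂ ζ := by
    intro y ζ
    have : ((y, ζ) : v'.M × CDual R P') = (y, 0) + (0, ζ) := by simp
    rw [this, map_add, map_add]
    exact add_sub_add_comm _ _ _ _
  have hα : ∀ (g : StTriple v v' P P') (x : v.M) (p : P), g.α ((x, p) : v.M × P) =
      g.α ((x, 0) : v.M × P) + g.α ((0, p) : v.M × P) := by
    intro g x p
    rw [← map_add]
    simp
  refine homotopic_iff.2 ⟨C, ?_, ?_, Q.dual_prod_ext ?_ ?_ fun ξ ω => ?_⟩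
  · rintro ⟨y, ζ⟩
    rw [stable_δ, map_add, hL, hR, hadd]
    congr 1
    refine Prod.ext ?_ (CDual.ext fun p => ?_)
    · change compB f' y - compB f y = _
      rw [hb, add_sub_cancel_left]
      rfl
    · have h1 := hf.β_symm_snd y p
      have h2 := hf'.β_symm_snd y p
      change (f'.β.symm ((y, 0) : v'.M × CDual R P')).2 p -
        (f.β.symm ((y, 0) : v'.M × CDual R P')).2 p =
        v'.symm y (f'.α ((0, p) : v.M × P) - f.α ((0, p) : v.M × P) : v'.M × P').1
      rw [h1, h2, Prod.fst_sub, map_sub]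
  · rintro φ ⟨x, p⟩
    obtain ⟨⟨ξ, ζ⟩, rfl⟩ := prodDual.surjective φ
    have hφ : prodDual (ξ, ζ) = extL v'.M P' ξ + extR v'.M P' ζ := rfl
    have h1 : ((bdry v).sum (triv ε P)).δ (C₁ ξ) ((x, p) : v.M × P) =
        ξ (f'.α ((x, p) : v.M × P)).1 - ξ (f.α ((x, p) : v.M × P)).1 := by
      change v.symm (D ξ) x + ξ (f'.α ((0, p) : v.M × P) - f.α ((0, p) : v.M × P) :
        v'.M × P').1 = _
      have := ha x ξ
      rw [hα f' x p, hα f x p, Prod.fst_sub, map_sub, Prod.fst_add, Prod.fst_add, map_add, map_add]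
      change _ = ξ (compA f' x) + _ - (ξ (compA f x) + _)
      rw [this]
      abel
    have h2 : ((bdry v).sum (triv ε P)).δ (C₂ ζ) ((x, p) : v.M × P) =
        ζ (f'.α ((x, p) : v.M × P)).2 - ζ (f.α ((x, p) : v.M × P)).2 := by
      have e1 := hf.map_δ (f.β.symm ((0, ζ) : v'.M × CDual R P')) ((x, p) : v.M × P)
      have e2 := hf'.map_δ (f'.β.symm ((0, ζ) : v'.M × CDual R P')) ((x, p) : v.M × P)
      rw [LinearEquiv.apply_symm_apply, stable_δ_right] at e1 e2
      change ((bdry v).sum (triv ε P)).δ (f'.β.symm ((0, ζ) : v'.M × CDual R P') -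
        f.β.symm ((0, ζ) : v'.M × CDual R P')) ((x, p) : v.M × P) = _
      rw [map_sub, CDual.sub_apply, e1, e2]
      rfl
    rw [hφ, map_add, hL, hR, map_add]
    refine Eq.trans ?_ (congrArg₂ (· + ·) h1 h2).symm
    exact add_sub_add_comm _ _ _ _
  · rw [map_sub, map_add, ← compS_eq, ← compS_eq, hs, Q.pull_mk, Q.pull_pull]
    congr 1
    · refine congrArg _ (hom_ext fun ξ η => ?_)
      change -((ε : ℤ) • star (η (compA f' (D ξ)))) = -((ε : ℤ) • star (η
        (f'.α (((bdry v).sum (triv ε P)).γ (C (extL v'.M P' ξ)))).1))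
      rw [hL]
      rfl
    · simp only [map_zero, add_zero, Q.pull_pull]
      refine Q.pull_congr (fun ξ => ?_) _
      exact congrArg Prod.fst (hL ξ).symm
  -- Expanding $\theta$ along this sum turns a difference of two pullbacks into one pullback and a
  -- cross term, the shape of the homotopy equation.
  · have h0 : compB' f = -(compB' f' - compB' f) + compB' f' := by abel
    rw [map_sub, map_add, hf.pull_extR_push, hf'.pull_extR_push, h0, Q.pull_add_map,
      Q.pull_neg_map, Q.pull_mk, Q.pull_pull]
    have h1 : Q.mk (bil (Q.symm v.form) (-(compB' f' - compB' f)) (compB' f')) =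
        (Q.mk (pullHom (extR v'.M P') (-((ε : ℤ) • (ev R (v'.M × P') ∘ₗ f'.α.toLinearMap ∘ₗ
          ((bdry v).sum (triv ε P)).γ ∘ₗ C)))) : Q R ε _) := by
      refine congrArg _ (hom_ext fun ζ ω => ?_)
      change _ = -((ε : ℤ) • star (ω
        (f'.α (((bdry v).sum (triv ε P)).γ (C (extR v'.M P' ζ)))).2))
      rw [hR]
      change _ = -((ε : ℤ) • star (ω (f'.α (((compB' f' - compB' f) ζ, 0) : v.M × P)).2))
      rw [← hf'.symm_compB', Q.symm_swap, bil_apply, LinearMap.neg_apply, map_neg]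
      rfl
    have h2 : Q.pull (C ∘ₗ extR v'.M P') ((bdry v).sum (triv ε P)).θ =
        Q.pull (compB' f' - compB' f) v.form := by
      simp only [map_zero, add_zero, Q.pull_pull]
      exact Q.pull_congr (fun ζ => congrArg Prod.fst (hR ζ)) _
    rw [h1, h2]
    abel
  · have e1 := hf.apply_compA_compB' ξ ω
    have e2 := hf'.apply_compA_compB' ξ ω
    have e3 : Q.symm (((bdry v).sum (triv ε P)).θ) (C₁ ξ) (C₂ ω) =
        v.symm (D ξ) (compB' f' ω - compB' f ω) := by
      simp only [map_zero, add_zero, Q.symm_pull]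
      rfl
    rw [Q.symm_sub, Q.symm_add, Q.symm_mk', Q.symm_pull, hL, hR, e3]
    change _ = -((ε : ℤ) • star (ω
        (f'.α (((bdry v).sum (triv ε P)).γ (C (extL v'.M P' ξ)))).2)) + (ε : ℤ) •
        star (-((ε : ℤ) • star (ξ
        (f'.α (((bdry v).sum (triv ε P)).γ (C (extR v'.M P' ω)))).1))) + _
    rw [hL, hR]
    change _ = -((ε : ℤ) • star (ω (f'.α ((D ξ, 0) : v.M × P)).2)) + (ε : ℤ) •
        star (-((ε : ℤ) • star (ξ (compA f' (compB' f' ω - compB' f ω))))) + _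
    rw [← hf'.symm_compB', Q.symm_swap, star_neg, star_zsmul, star_star, smul_neg,
      unit_zsmul_zsmul, map_sub, map_sub, map_sub, ha (compB' f ω), e1, e2]
    abel

end Comparison

end Homotopy

/-! ### Simple isomorphism as a relation on based modules. -/

section SimplyIso

variable {R : Type u} [Ring R] {Z : AddSubgroup (RedK1 R)}

/-- Based modules that are isomorphic by a simple isomorphism. -/
def SimplyIso (Z : AddSubgroup (RedK1 R)) (M N : BMod R) : Prop :=
  ∃ e : M ≃ₗ[R] N, IsSimple Z e

variable {M N L M' N' : BMod R}

theorem SimplyIso.refl (M : BMod R) : SimplyIso Z M M := ⟨_, IsSimple.refl⟩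

theorem SimplyIso.symm (h : SimplyIso Z M N) : SimplyIso Z N M :=
  ⟨_, h.choose_spec.symm⟩

theorem SimplyIso.trans (h : SimplyIso Z M N) (h' : SimplyIso Z N L) : SimplyIso Z M L :=
  ⟨_, h.choose_spec.trans h'.choose_spec⟩

theorem SimplyIso.prod (h : SimplyIso Z M N) (h' : SimplyIso Z M' N') :
    SimplyIso Z (M.prod M') (N.prod N') :=
  ⟨_, h.choose_spec.prod h'.choose_spec⟩

theorem SimplyIso.comm (M N : BMod R) : SimplyIso Z (M.prod N) (N.prod M) := ⟨_, IsSimple.comm⟩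

theorem SimplyIso.assoc (M N L : BMod R) :
    SimplyIso Z ((M.prod N).prod L) (M.prod (N.prod L)) := ⟨_, IsSimple.assoc⟩

theorem SimplyIso.left_comm (M N L : BMod R) :
    SimplyIso Z (M.prod (N.prod L)) (N.prod (M.prod L)) :=
  (SimplyIso.assoc M N L).symm.trans <|
    ((SimplyIso.comm M N).prod (SimplyIso.refl L)).trans (SimplyIso.assoc N M L)

end SimplyIso

/-! ### Stable homotopy classes versus isomorphism classes of embedding pairs. -/

section Classes

variable {R : Type u} [Ring R] [StarRing R] {ε : ℤˣ} {Z : AddSubgroup (RedK1 R)}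
variable {v v' : QForm R ε}

theorem Linked.of_eq {P P' L L' K K' J J' : BMod R} {f : StTriple v v' P P'}
    {f' : StTriple v v' L L'} {g : StTriple v v' K K'} {g' : StTriple v v' J J'}
    (h : Linked f f') (ha : compA f = compA g) (hb : compB f = compB g) (hs : compS f = compS g)
    (ha' : compA f' = compA g') (hb' : compB f' = compB g') (hs' : compS f' = compS g') :
    Linked g g' := by
  obtain ⟨D, h1, h2, h3⟩ := h
  rw [union_form] at h3
  rw [ha, hs, hs'] at h3
  rw [hb, hb'] at h1
  rw [ha, ha'] at h2
  exact ⟨D, h1, h2, h3⟩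

theorem StablyHomotopic.linked {f f' : StableIso Z v v'} (h : StablyHomotopic Z f f') :
    Linked f.f f'.f := by
  obtain ⟨R₁, R₂, K, K', g₁, g₂, h₁, h₂, hg₁, hg₂, -, -, H⟩ := h
  exact H.linked.of_eq (compA_stabilise _ _ _) (compB_stabilise _ _ _)
    (compS_stabilise _ _ _ (ν_eq_zero_of_isIso hg₁)) (compA_stabilise _ _ _)
    (compB_stabilise _ _ _) (compS_stabilise _ _ _ (ν_eq_zero_of_isIso hg₂))

/-- The first is stabilised by $L\oplus V'$ and the second by $P\oplus V'$. The trivial summands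
then agree up to simple isomorphism, while $a$, $b$, $s$ are unchanged, so the unstable criterion
applies. -/
theorem Linked.stablyHomotopic (hZ : StarInvariant Z) {f f' : StableIso Z v v'}
    (h : Linked f.f f'.f) : StablyHomotopic Z f f' := by
  obtain ⟨P, P', f, hf⟩ := f
  obtain ⟨L, L', f', hf'⟩ := f'
  obtain ⟨e, he⟩ := SimplyIso.left_comm (Z := Z) P L v'.M
  -- $P'$ and $L'$ can be compared only through $V\oplus P\cong V'\oplus P'$ and $V\oplus L\cong
  -- V'\oplus L'$; this is why $V'$ is added as well.
  have hw : SimplyIso Z (P'.prod (L.prod v'.M)) (L'.prod (P.prod v'.M)) := by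
    have e1 : SimplyIso Z (v.M.prod P) (v'.M.prod P') := ⟨_, hf.simple_α⟩
    have e2 : SimplyIso Z (v.M.prod L) (v'.M.prod L') := ⟨_, hf'.simple_α⟩
    have e3 : SimplyIso Z (P'.prod (L.prod v'.M)) (L.prod (v'.M.prod P')) :=
      (SimplyIso.comm _ _).trans (SimplyIso.assoc _ _ _)
    have e4 : SimplyIso Z (L.prod (v.M.prod P)) (P.prod (v.M.prod L)) :=
      (SimplyIso.comm _ _).trans <| (SimplyIso.assoc _ _ _).trans <|
        (SimplyIso.left_comm _ _ _)
    have e5 : SimplyIso Z (P.prod (v'.M.prod L')) (L'.prod (P.prod v'.M)) :=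
      (SimplyIso.assoc _ _ _).symm.trans (SimplyIso.comm _ _)
    exact e3.trans <| ((SimplyIso.refl L).prod e1.symm).trans <| e4.trans <|
      ((SimplyIso.refl P).prod e2).trans e5
  obtain ⟨w, hw⟩ := hw
  let g₁ := Triple.trivSum ε P (L.prod v'.M)
  let g₂ := (Triple.trivSum ε L (P.prod v'.M)).comp
    (Triple.trivMap (P := P.prod (L.prod v'.M)) (P' := L.prod (P.prod v'.M)) e)
  let h₁ := (Triple.trivMap (P := P'.prod (L.prod v'.M)) (P' := L'.prod (P.prod v'.M)) w).comp
    (Triple.trivSum ε P' (L.prod v'.M)).inv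
  let h₂ := (Triple.trivSum ε L' (P.prod v'.M)).inv
  have hg₁ : g₁.IsIso Z := Triple.isIso_trivSum hZ _ _
  have hg₂ : g₂.IsIso Z := (Triple.isIso_trivSum hZ _ _).comp (Triple.isIso_trivMap hZ he)
  have hh₁ : h₁.IsIso Z := (Triple.isIso_trivMap hZ hw).comp (Triple.isIso_trivSum hZ _ _).inv
  have hh₂ : h₂.IsIso Z := (Triple.isIso_trivSum hZ _ _).inv
  refine ⟨_, _, _, _, g₁, g₂, h₁, h₂, hg₁, hg₂, hh₁, hh₂, ?_⟩
  exact Linked.homotopic (stabilise_isIso hf hg₁ hh₁).eqs (stabilise_isIso hf' hg₂ hh₂).eqs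
    (h.of_eq (compA_stabilise _ _ _).symm (compB_stabilise _ _ _).symm
      (compS_stabilise _ _ _ (ν_eq_zero_of_isIso hg₁)).symm (compA_stabilise _ _ _).symm
      (compB_stabilise _ _ _).symm (compS_stabilise _ _ _ (ν_eq_zero_of_isIso hg₂)).symm)

/-- Two stable isomorphisms are stably homotopic if and only if the 2-sided primitive embeddings
in their unions are isomorphic. -/
theorem stablyHomotopic_iff (hZ : StarInvariant Z) {f f' : StableIso Z v v'} :
    StablyHomotopic Z f f' ↔ (prEmb hZ f).Isomorphic (prEmb hZ f') :=
  ⟨fun h => (h.linked.isomorphic hZ).symm,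
    fun h => (linked_of_isomorphic hZ h.symm).stablyHomotopic hZ⟩

end Classes

/-! ## The stable isomorphism of a primitive embedding -/

section Delta

variable {R : Type u} [Ring R] [StarRing R] {ε : ℤˣ} {Z : AddSubgroup (RedK1 R)}

theorem symm_sum_form {M N : Type u} [AddCommGroup M] [Module R M] [AddCommGroup N] [Module R N]
    (a : Q R ε M) (b : Q R ε N) (p q : M × N) :
    Q.symm (Q.pull (LinearMap.fst R M N) a + Q.pull (LinearMap.snd R M N) b) p q =
      Q.symm a p.1 q.1 + Q.symm b p.2 q.2 := by
  rw [Q.symm_add, Q.symm_pull, Q.symm_pull]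
  rfl

theorem symm_hyp (L : BMod R) (p q : L × CDual R L) :
    (hyp ε L).symm p q = p.2 q.1 + (ε : ℤ) • star (q.2 p.1) := Q.symm_mk' _ p q

theorem hyp_simple (hZ : StarInvariant Z) (L : BMod R) : (hyp ε L).Simple Z := by
  let e : L ≃ₗ[R] L :=
    LinearEquiv.ofLinearMap ((ε : ℤ) • LinearMap.id) ((ε : ℤ) • LinearMap.id)
      (LinearMap.ext fun x => by simp [unit_zsmul_zsmul])
      (LinearMap.ext fun x => by simp [unit_zsmul_zsmul])
  have he : IsSimple Z e := IsSimple.zsmul ε fun x => rfl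
  refine ⟨_, ((he.trans (IsSimple.ev (M := L) hZ)).prod (IsSimple.refl (M := L.dual))).trans
    ((IsSimple.comm (M := L.dual.dual) (N := L.dual)).trans
      (IsSimple.prodDual (M := L) (N := L.dual) hZ)), ?_⟩
  rintro ⟨y, ξ⟩
  refine CDual.ext fun q => ?_
  refine Eq.trans ?_ (symm_hyp L (y, ξ) q).symm
  change ξ q.1 + star (q.2 ((ε : ℤ) • y)) = _
  rw [map_zsmul, star_zsmul]

/-! ### The boundary of a simple form is trivial. -/

section Trivialise

variable (m : QForm R ε) (hm : m.Nonsingular)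

theorem symm_symmEquiv_symm (ξ : CDual R m.M) : m.symm ((m.symmEquiv hm).symm ξ) = ξ :=
  (m.symmEquiv hm).apply_symm_apply ξ

theorem push_untrivialise :
    (untrivialise m hm).push = Q.pull (m.symmEquiv hm).symm.toLinearMap m.form :=
  Q.pull_id _

theorem trivialise_eq_inv : trivialise m hm = (untrivialise m hm).inv := by
  have h := push_untrivialise m hm
  rw [Triple.push] at h
  rw [Triple.inv, h]
  rfl

variable {m}

theorem isIso_untrivialise (h : m.Simple Z) : (untrivialise m hm).IsIso Z := by
  have hs : IsSimple Z (N := m.M.dual) (m.symmEquiv hm) := by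
    obtain ⟨e, he, h1⟩ := h
    exact he.congr fun x => (h1 x).symm
  refine (Triple.isIso_iff _).2 ⟨IsSimple.refl, hs.symm, ?_, fun ξ x => ?_, fun x u => ?_⟩
  · rw [push_untrivialise, zero_add]
    congr 1
    rw [Q.pull_pull]
    exact (Q.pull_congr (fun x => (m.symmEquiv hm).symm_apply_apply x) _).trans (Q.pull_id _)
  · rw [push_untrivialise, Q.symm_pull]
    change ξ 0 + m.symm ((m.symmEquiv hm).symm ξ) ((m.symmEquiv hm).symm
      (m.symm ((m.symmEquiv hm).symm x))) = ξ ((m.symmEquiv hm).symm x)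
    rw [symm_symmEquiv_symm, symm_symmEquiv_symm, map_zero, zero_add]
  · change x u = m.symm ((m.symmEquiv hm).symm x) u
    rw [symm_symmEquiv_symm]

theorem isIso_trivialise (h : m.Simple Z) : (trivialise m hm).IsIso Z := by
  rw [trivialise_eq_inv]
  exact (isIso_untrivialise hm h).inv

end Trivialise

/-! ### The isometry from $v\oplus H_\varepsilon(v^\perp)$ to $-v^\perp\oplus m$. -/

section HMap

variable {v k m : QForm R ε} {ψ : m.M →ₗ[R] CDual R m.M} {j : v.M →ₗ[R] m.M} {κ : k.M →ₗ[R] m.M}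
  (S : Splitting m j κ)

/-- The correction term `- σ^* φ^* j x - σ^* ψ^* σ ξ` of `hMap`. -/
def Splitting.corr (S : Splitting m j κ) (ψ : m.M →ₗ[R] CDual R m.M) :
    (v.M × CDual R k.M) →ₗ[R] k.M :=
  (-(codual S.σ ∘ₗ flip m.symm ∘ₗ j)).coprod (-(codual S.σ ∘ₗ flip ψ ∘ₗ S.σ))

theorem hMap_apply (x : v.M) (y : k.M) (ξ : CDual R k.M) :
    hMap m ψ S (x, (y, ξ)) = (y + S.corr ψ (x, ξ), κ (y + S.corr ψ (x, ξ)) + (j x + S.σ ξ)) := rfl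

theorem Splitting.apply_corr (ζ : CDual R k.M) (x : v.M) (ξ : CDual R k.M) :
    ζ (S.corr ψ (x, ξ)) = -m.symm (S.σ ζ) (j x) - ψ (S.σ ζ) (S.σ ξ) := by
  change ζ (-codual S.σ (flip m.symm (j x)) + -codual S.σ (flip ψ (S.σ ξ))) = _
  rw [map_add, map_neg, map_neg, apply_codual, apply_codual, flip_apply, flip_apply, star_star,
    star_star, sub_eq_add_neg]

theorem Splitting.symm_σ (ξ : CDual R k.M) (z : k.M) : m.symm (S.σ ξ) (κ z) = ξ z :=
  congrArg (fun φ : CDual R k.M => φ z) (S.section_eq ξ)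

/-- Up to reordering summands, the map is the shear by the correction term, then $(j,\sigma)$, then
the shear by $\kappa$. -/
theorem hMap_simple {e : (v.M × CDual R k.M) ≃ₗ[R] m.M}
    (he : IsSimple Z (M := v.M.prod k.M.dual) e) (h : ∀ x ξ, e (x, ξ) = j x + S.σ ξ) :
    IsSimple Z (M := v.M.prod (k.M.prod k.M.dual)) (N := k.M.prod m.M) (hMap m ψ S) := by
  have s1 := (IsSimple.assoc (Z := Z) (M := v.M) (N := k.M) (L := k.M.dual)).symm
  have s2 := (IsSimple.comm (Z := Z) (M := v.M) (N := k.M)).prod (IsSimple.refl (M := k.M.dual))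
  have s3 := IsSimple.assoc (Z := Z) (M := k.M) (N := v.M) (L := k.M.dual)
  have s4 := IsSimple.shear' (Z := Z) (M := k.M) (N := v.M.prod k.M.dual) (S.corr ψ)
  have s5 := (IsSimple.refl (Z := Z) (M := k.M)).prod he
  have s6 := IsSimple.shear (Z := Z) (M := k.M) (N := m.M) κ
  refine (s1.trans <| s2.trans <| s3.trans <| s4.trans <| s5.trans s6).congr ?_
  rintro ⟨x, y, ξ⟩
  refine (hMap_apply S x y ξ).trans ?_
  rw [add_comm (κ _), ← h]
  rfl

/-- Writing $z$ for the first coordinate of the image, the form of $m$ on $\kappa z+jx+\sigma\xi$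
contains $\theta^\perp(z)$, cancelled by $-v^\perp$, and $\theta(x)$. The correction in $z$ removes
everything else except the hyperbolic form. -/
theorem hMap_isometric (hψ : Q.mk ψ = m.form) (hj : Q.pull j m.form = v.form)
    (hκ : Q.pull κ m.form = k.form) (ho : ∀ z x, m.symm (κ z) (j x) = 0) :
    Q.pull (hMap m ψ S).toLinearMap (Q.pull (LinearMap.fst R k.M m.M) k.neg.form +
        Q.pull (LinearMap.snd R k.M m.M) m.form) =
      Q.pull (LinearMap.fst R v.M (k.M × CDual R k.M)) v.form +
        Q.pull (LinearMap.snd R v.M (k.M × CDual R k.M)) (hyp ε k.M).form := by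
  let z : (v.M × (k.M × CDual R k.M)) →ₗ[R] k.M :=
    LinearMap.fst R k.M m.M ∘ₗ (hMap m ψ S).toLinearMap
  let px := LinearMap.fst R v.M (k.M × CDual R k.M)
  let pξ := LinearMap.snd R k.M (CDual R k.M) ∘ₗ LinearMap.snd R v.M (k.M × CDual R k.M)
  have e1 : LinearMap.snd R k.M m.M ∘ₗ (hMap m ψ S).toLinearMap = κ ∘ₗ z + (j ∘ₗ px + S.σ ∘ₗ pξ) :=
    rfl
  -- As $\kappa z\perp jx$ and $\phi(\sigma\xi,\kappa y)=\xi(y)$, the cross term gives the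
  -- hyperbolic form, and the correction supplies minus $\psi(\sigma\xi,\sigma\xi)$ and minus
  -- $\phi(jx,\sigma\xi)$, which cancel the other terms of the expansion.
  have e2 : (Q.mk (bil m.symm (κ ∘ₗ z) (j ∘ₗ px + S.σ ∘ₗ pξ)) : Q R ε _) =
      Q.pull (LinearMap.snd R v.M (k.M × CDual R k.M)) (hyp ε k.M).form
        - Q.pull (S.σ ∘ₗ pξ) m.form - Q.mk (bil m.symm (j ∘ₗ px) (S.σ ∘ₗ pξ)) := by
    have e3 : (Q.mk (bil m.symm (j ∘ₗ px) (S.σ ∘ₗ pξ)) : Q R ε _) =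
        Q.mk (bil m.symm (S.σ ∘ₗ pξ) (j ∘ₗ px)) :=
      Q.mk_eq_of_swap fun p q => (Q.symm_swap m.form _ _).symm
    rw [e3, ← hψ, Q.pull_mk, Q.pull_mk, ← Q.mk_sub, ← Q.mk_sub]
    refine Q.mk_eq_of_swap fun p q => ?_
    obtain ⟨x, y, ξ⟩ := p
    obtain ⟨x', y', ξ'⟩ := q
    change m.symm (κ (y + S.corr ψ (x, ξ))) (j x' + S.σ ξ') = (ε : ℤ) • star
      (ξ' y - ψ (S.σ ξ') (S.σ ξ) - m.symm (S.σ ξ') (j x))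
    rw [map_add, ho, zero_add, ← Q.symm_swap, S.symm_σ, map_add, S.apply_corr]
    congr 2
    abel
  rw [map_add, Q.pull_pull, Q.pull_pull, e1, Q.pull_add_map, Q.pull_add_map, ← Q.pull_pull z κ, hκ,
    ← Q.pull_pull px j, hj, e2, map_neg]
  change -Q.pull z k.form + _ = _
  abel

theorem isIso_hMap (hψ : Q.mk ψ = m.form) (hj : Q.pull j m.form = v.form)
    (hκ : Q.pull κ m.form = k.form) (ho : ∀ z x, m.symm (κ z) (j x) = 0)
    {e : (v.M × CDual R k.M) ≃ₗ[R] m.M}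
    (he : IsSimple Z (M := v.M.prod k.M.dual) e) (h : ∀ x ξ, e (x, ξ) = j x + S.σ ξ) :
    Triple.IsIso Z (⟨hMap m ψ S, hMap m ψ S, 0⟩ :
        Triple ((bdry v).sum (bdry (hyp ε k.M))) ((bdry k.neg).sum (bdry m))) := by
  have hi := hMap_isometric S hψ hj hκ ho
  refine (Triple.isIso_iff _).2 ⟨hMap_simple S he h, hMap_simple S he h,
    Triple.Eqs.of_ν_eq_zero rfl hi.symm (fun _ => rfl) fun p q => ?_⟩
  have h1 := symm_sum_form v.form (hyp ε k.M).form p q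
  have h2 := symm_sum_form k.neg.form m.form (hMap m ψ S p) (hMap m ψ S q)
  refine h1.symm.trans (Eq.trans ?_ h2)
  rw [← hi, Q.symm_pull]
  rfl

end HMap

end Delta

/-! ### The union formed from the stable isomorphism of a primitive embedding. -/

section DeltaEmbedding

variable {R : Type u} [Ring R] [StarRing R] {ε : ℤˣ} {Z : AddSubgroup (RedK1 R)}
variable {v v' m : QForm R ε} (E : TwoSided Z v v'.neg m)

namespace TwoSided

/-- The identification of `v'` with `-v^⊥`. -/
def perpIsometry : Isometry Z v' E.perp.neg where
  e := E.toPerp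
  simple := IsSimple.transport (M := v'.M) E.toPerp
  isometric := by
    have h : Q.pull E.toPerp.toLinearMap (Q.pull (orth E.j).subtype m.form) = -v'.form := by
      refine Eq.trans ?_ E.isometric'
      rw [Q.pull_pull]
      rfl
    exact (map_neg _ _).trans ((congrArg Neg.neg h).trans (neg_neg _))

theorem symm_perpIncl (z : E.perp.M) (x : v.M) : m.symm (E.perpIncl z) (E.j x) = 0 :=
  congrArg (fun φ : CDual R v.M => φ x) z.2

theorem symm_j' (y : v'.M) (x : v.M) : m.symm (E.j' y) (E.j x) = 0 :=
  E.symm_perpIncl (E.toPerp y) x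

/-- The dual `V'^* ≃ (V^⊥)^*` of the identification of `V^⊥` with `V'`. -/
def dualPerp : CDual R v'.M ≃ₗ[R] CDual R E.perp.M := dualEquiv E.toPerp.symm

theorem exists_section (hZ : StarInvariant Z) :
    ∃ e : (v.M × CDual R E.perp.M) ≃ₗ[R] m.M, IsSimple Z (M := v.M.prod E.perp.M.dual) e ∧
      (∀ x, e (x, 0) = E.j x) ∧ ∀ x ζ z, m.symm (e (x, ζ)) (E.perpIncl z) = ζ z := by
  obtain ⟨e, he, h1, h2⟩ := E.based
  refine ⟨(LinearEquiv.prodCongr (LinearEquiv.refl R v.M) (dualEquiv E.toPerp)).trans e,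
    ((IsSimple.refl (M := v.M)).prod (E.perpIsometry.simple.dual hZ)).trans he, fun x => ?_,
    fun x ζ z => ?_⟩
  · change e ((x, dualEquiv E.toPerp 0) : v.M × CDual R v'.M) = _
    rw [map_zero]
    exact h1 x
  · obtain ⟨y, rfl⟩ := E.toPerp.surjective z
    exact congrArg (fun φ : CDual R v'.M => φ y) (h2 x (dualEquiv E.toPerp ζ))

theorem nonempty_splitting (hZ : StarInvariant Z) : Nonempty (Splitting m E.j E.perpIncl) := by
  obtain ⟨e, -, h1, h2⟩ := E.exists_section hZ
  refine ⟨⟨e.toLinearMap ∘ₗ LinearMap.inr R v.M (CDual R E.perp.M),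
    fun ξ => CDual.ext fun z => h2 0 ξ z, ?_⟩⟩
  have h : ⇑(E.j.coprod (e.toLinearMap ∘ₗ LinearMap.inr R v.M (CDual R E.perp.M))) = ⇑e := by
    funext p
    obtain ⟨x, ξ⟩ := p
    change E.j x + e (0, ξ) = e (x, ξ)
    rw [← h1, ← map_add]
    simp
  rw [h]
  exact e.bijective

variable {E} in
-- Two sections of the same sequence differ by a map into $V$, so $(j,\sigma)$ differs from the
-- given simple isomorphism by a shear. Hence simplicity does not depend on $\sigma$.
theorem splitting_simple (hZ : StarInvariant Z) (S : Splitting m E.j E.perpIncl) :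
    ∃ e : (v.M × CDual R E.perp.M) ≃ₗ[R] m.M, IsSimple Z (M := v.M.prod E.perp.M.dual) e ∧
      ∀ x ξ, e (x, ξ) = E.j x + S.σ ξ := by
  obtain ⟨e, he, h1, h2⟩ := E.exists_section hZ
  let d : CDual R E.perp.M →ₗ[R] v.M :=
    LinearMap.fst R v.M (CDual R E.perp.M) ∘ₗ e.symm.toLinearMap ∘ₗ S.σ
  refine ⟨_, (IsSimple.shear' (M := v.M) (N := E.perp.M.dual) d).trans he, fun x ξ => ?_⟩
  have hξ : (e.symm (S.σ ξ)).2 = ξ := CDual.ext fun z => by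
    rw [← h2 (e.symm (S.σ ξ)).1, ← S.symm_σ ξ z]
    simp
  have hσ : S.σ ξ = e (d ξ, ξ) := by
    rw [← LinearEquiv.symm_apply_eq]
    exact Prod.ext rfl hξ
  change e (x + d ξ, ξ) = _
  rw [hσ, ← h1, ← map_add]
  simp

variable {ψ : m.M →ₗ[R] CDual R m.M} (S : Splitting m E.j E.perpIncl)

theorem isIso_delta (hZ : StarInvariant Z) (hψ : Q.mk ψ = m.form) : (E.delta ψ S).IsIso Z := by
  obtain ⟨e, he, h⟩ := splitting_simple hZ S
  exact ((Triple.isIso_bdry E.perpIsometry.symm).sum Triple.isIso_id).comp <|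
    (Triple.isIso_id.sum (isIso_trivialise _ E.simple)).comp <|
    (isIso_hMap (v := v) (k := E.perp) S hψ E.isometric rfl E.symm_perpIncl he h).comp
      (Triple.isIso_id.sum (isIso_untrivialise _ (hyp_simple hZ _)))

theorem apply_compA_delta (ξ : CDual R v'.M) (x : v.M) :
    ξ (compA (E.delta ψ S) x) = -m.symm (S.σ (E.dualPerp ξ)) (E.j x) := by
  -- The trivialisations have $\alpha=1$, so $a$ is an entry of $h$ followed by the identification
  -- of $V^\perp$ with $V'$.
  have h : compA (E.delta ψ S) x = E.toPerp.symm (S.corr (k := E.perp) ψ (x, 0)) := by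
    have h0 : (hMap m ψ S (x, 0)).1 = S.corr (k := E.perp) ψ (x, 0) := zero_add _
    rw [← h0]
    rfl
  rw [h]
  refine (S.apply_corr (k := E.perp) (ψ := ψ) (E.dualPerp ξ) x 0).trans ?_
  rw [map_zero, map_zero, sub_zero]

/-- Of all the factors only the one involving the hyperbolic form contributes: the others have
$\nu=0$ or a $\nu$ supported on the summand $M^*$. -/
theorem compS_delta_eq_pull : compS (E.delta ψ S) =
    Q.pull (((hyp ε E.perp.M).symmEquiv (hyp_nonsingular _)).symm.toLinearMap ∘ₗ
      dualMap (E.toPerp.symm.toLinearMap ∘ₗ LinearMap.fst R E.perp.M m.M ∘ₗ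
        (hMap m ψ S).toLinearMap ∘ₗ LinearMap.inr R v.M (E.perp.M × CDual R E.perp.M)))
      (hyp ε E.perp.M).form := by
  have e1 : Triple.push (⟨hMap m ψ S, hMap m ψ S, 0⟩ : Triple ((bdry v).sum (bdry (hyp ε E.perp.M)))
      ((bdry E.perp.neg).sum (bdry m))) = 0 := map_zero _
  have e2 : (Triple.bdry (v := E.perp.neg) (w := v') E.toPerp.symm).push = 0 := map_zero _
  rw [compS_eq, delta, fj, Triple.push_comp, Triple.push_comp, Triple.push_comp,
    Triple.push_sum, Triple.push_sum, Triple.push_sum, push_id, push_id, push_id,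
    push_untrivialise, e1, e2]
  simp only [map_add, map_zero, zero_add, add_zero, Q.pull_pull]
  refine (congrArg₂ (· + ·) (Q.pull_congr (fun ξ => rfl) _) ?_).trans (add_zero _)
  refine (Q.pull_congr (g := 0) (fun ξ => CDual.ext fun w => ?_) _).trans (Q.pull_zero_map _)
  change ξ (E.toPerp.symm 0) = 0
  rw [map_zero, map_zero]

theorem compS_delta (hψ : Q.mk ψ = m.form) :
    compS (E.delta ψ S) = -Q.pull (S.σ ∘ₗ E.dualPerp.toLinearMap) m.form := by
  let H := hyp ε E.perp.M
  let F : CDual R v'.M →ₗ[R] CDual R (E.perp.M × CDual R E.perp.M) :=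
    dualMap (E.toPerp.symm.toLinearMap ∘ₗ LinearMap.fst R E.perp.M m.M ∘ₗ
      (hMap m ψ S).toLinearMap ∘ₗ LinearMap.inr R v.M (E.perp.M × CDual R E.perp.M))
  let p : CDual R v'.M →ₗ[R] (E.perp.M × CDual R E.perp.M) :=
    (H.symmEquiv (hyp_nonsingular _)).symm.toLinearMap ∘ₗ F
  have h1 : compS (E.delta ψ S) = Q.pull p H.form := E.compS_delta_eq_pull S
  -- $p\xi$ is the vector of the hyperbolic space that represents the functional $F\xi$. Evaluating
  -- on the two summands yields its components, and the hyperbolic form of $p\xi$ and $p\eta$ pairs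
  -- the second component of one with the first of the other.
  have h2 : ∀ ξ q, H.symm (p ξ) q = ξ (E.toPerp.symm (q.1 + S.corr (k := E.perp) ψ (0, q.2))) := by
    intro ξ q
    exact congrArg (fun φ : CDual R (E.perp.M × CDual R E.perp.M) => φ q)
      (symm_symmEquiv_symm H (hyp_nonsingular _) (F ξ))
  have h3 : ∀ (ξ : CDual R v'.M) (q : E.perp.M × CDual R E.perp.M), (p ξ).2 q.1 + (ε : ℤ) • star (q.2 (p ξ).1) =
      E.dualPerp ξ q.1 - ψ (S.σ (E.dualPerp ξ)) (S.σ q.2) := by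
    intro ξ q
    refine (symm_hyp E.perp.M (p ξ) q).symm.trans ((h2 ξ q).trans ?_)
    rw [map_add, map_add]
    refine (congrArg (E.dualPerp ξ q.1 + ·)
      (S.apply_corr (k := E.perp) (ψ := ψ) (E.dualPerp ξ) 0 q.2)).trans ?_
    rw [map_zero, map_zero, neg_zero, zero_sub, sub_eq_add_neg]
  have h4 : ∀ ξ, (p ξ).2 = E.dualPerp ξ := fun ξ => CDual.ext fun y => by
    simpa using h3 ξ (y, 0)
  have h5 : ∀ ξ ζ, (ε : ℤ) • star (ζ (p ξ).1) = -ψ (S.σ (E.dualPerp ξ)) (S.σ ζ) := fun ξ ζ => by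
    simpa using h3 ξ (0, ζ)
  rw [h1, ← hψ, Q.pull_mk, Q.pull_mk, ← Q.mk_neg]
  refine (Q.mk_eq_of_swap fun ξ η => ?_).symm
  refine (h5 ξ (E.dualPerp η)).symm.trans ?_
  rw [← h4]
  rfl

/-- The isometry `v ∪ -v' ≃ m` given by `(x, ξ) ↦ j x - σ ξ`, for the stable isomorphism of a
2-sided primitive embedding in `m`. -/
theorem exists_isometry_delta (hZ : StarInvariant Z) (hψ : Q.mk ψ = m.form) :
    ∃ k : Isometry Z (union (E.delta ψ S)) m, (∀ x, k.e (unionInl (E.delta ψ S) x) = E.j x) ∧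
      ∀ y, k.e (unionInr (E.delta ψ S) y) = -E.j' y := by
  obtain ⟨e, he, h⟩ := splitting_simple hZ S
  have hs : IsSimple Z (M := v.M.prod v'.M.dual) ((LinearEquiv.prodCongr (LinearEquiv.refl R v.M)
      (E.dualPerp.trans (LinearEquiv.neg R))).trans e) :=
    ((IsSimple.refl (M := v.M)).prod ((E.perpIsometry.symm.simple.dual hZ).trans
      (IsSimple.neg (M := E.perp.M.dual)))).trans he
  obtain ⟨k, hk, hks⟩ : ∃ k : (v.M × CDual R v'.M) ≃ₗ[R] m.M,
      (∀ x ξ, k (x, ξ) = E.j x - S.σ (E.dualPerp ξ)) ∧ IsSimple Z (M := v.M.prod v'.M.dual) k := by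
    refine ⟨_, fun x ξ => ?_, hs⟩
    change e (x, -E.dualPerp ξ) = _
    rw [h, map_neg, sub_eq_add_neg]
  have hkx : ∀ x, k (x, 0) = E.j x := fun x => by rw [hk, map_zero, map_zero, sub_zero]
  have hkξ : ∀ ξ, k (0, ξ) = -S.σ (E.dualPerp ξ) := fun ξ => by rw [hk, map_zero, zero_sub]
  let K : Isometry Z (union (E.delta ψ S)) m :=
    { e := k
      simple := hks
      isometric := by
        refine Q.prod_ext ?_ ?_ fun x ξ => ?_
        · refine Eq.trans ?_ (pull_unionInl _).symm
          rw [Q.pull_pull, ← E.isometric]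
          exact Q.pull_congr hkx _
        · rw [pull_inr_union, E.compS_delta S hψ, neg_neg, Q.pull_pull,
            ← Q.pull_neg_map (S.σ ∘ₗ E.dualPerp.toLinearMap)]
          exact Q.pull_congr hkξ _
        · refine Eq.trans ?_ (union_symm_apply (E.delta ψ S) x 0 0 ξ).symm
          rw [E.apply_compA_delta, Q.symm_pull]
          change m.symm (k (x, 0)) (k (0, ξ)) = _
          rw [hkx, hkξ, map_neg, star_neg, smul_neg, Q.symm_swap]
          have e3 : (Q.symm (compS (E.delta ψ S)) 0) ξ = 0 := by rw [map_zero]; rfl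
          rw [e3, map_zero, CDual.zero_apply, zero_add, add_zero, sub_zero] }
  -- Since $m$ is nonsingular, the image of $y$ is found by pairing with all vectors $jx-\sigma\xi$.
  -- In the union the pairing yields $\xi(y)$, whereas $j'y$ pairs with $-\sigma\xi$ to $-\xi(y)$,
  -- up to transposition; this produces $-j'$ instead of $j'$.
  refine ⟨K, hkx, fun y => E.simple.nonsingular.1 (CDual.ext fun w => ?_)⟩
  obtain ⟨⟨x, ξ⟩, rfl⟩ := k.surjective w
  have h1 := union_symm_unionInr (E.isIso_delta S hZ hψ).eqs x ξ y
  refine (K.symm_apply _ ((x, ξ) : v.M × CDual R v'.M)).trans ?_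
  rw [← Q.symm_swap]
  refine (congrArg (fun r => (ε : ℤ) • star r) h1).trans ?_
  rw [hk, map_neg, map_sub, CDual.neg_apply, symm_j', neg_zero, zero_sub,
    CDual.neg_apply, neg_neg]
  refine Eq.trans ?_ (Q.symm_swap m.form (E.j' y) (S.σ (E.dualPerp ξ)))
  have h2 := S.symm_σ (k := E.perp) (E.dualPerp ξ) (E.toPerp y)
  refine congrArg (fun r => (ε : ℤ) • star r) (Eq.trans ?_ h2.symm)
  exact congrArg ξ (E.toPerp.symm_apply_apply y).symm

end TwoSided

end DeltaEmbedding

/-! ## The bijections -/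

section Bijections

variable {R : Type u} [Ring R] [StarRing R] {ε : ℤˣ} {Z : AddSubgroup (RedK1 R)}

/-! ### Isomorphism classes of embeddings, and the sign change of $j'$. -/

section Classes

variable {v w m m₀ m₁ : QForm R ε}

theorem TwoSided.isomorphic_of_eq {E E' : TwoSided Z v w m} (h : E.j = E'.j) (h' : E.j' = E'.j') :
    E.Isomorphic E' :=
  ⟨Isometry.refl Z m, LinearMap.congr_fun h, LinearMap.congr_fun h'⟩

theorem PrimM.mk_eq_mk {E E' : TwoSided Z v w m} : PrimM.mk E = PrimM.mk E' ↔ E.Isomorphic E' :=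
  Equivalence.quot_mk_eq_iff ⟨TwoSided.Isomorphic.refl, TwoSided.Isomorphic.symm,
    TwoSided.Isomorphic.trans⟩ E E'

theorem Prim.mk_eq_mk {E : TwoSided Z v w m₀} {E' : TwoSided Z v w m₁} :
    Prim.mk E = Prim.mk E' ↔ E.Isomorphic E' :=
  Equivalence.quot_mk_eq_iff
    (r := fun E E' : (Σ m : QForm R ε, TwoSided Z v w m) => E.2.Isomorphic E'.2)
    ⟨fun E => TwoSided.Isomorphic.refl E.2, TwoSided.Isomorphic.symm,
    TwoSided.Isomorphic.trans⟩ ⟨m₀, E⟩ ⟨m₁, E'⟩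

theorem PrimM.mk_surjective (x : PrimM Z v w m) : ∃ E, PrimM.mk E = x := Quot.exists_rep x

theorem Prim.mk_surjective (x : Prim Z v w) :
    ∃ (m : QForm R ε) (E : TwoSided Z v w m), Prim.mk E = x := by
  obtain ⟨⟨m, E⟩, h⟩ := Quot.exists_rep x
  exact ⟨m, E, h⟩

theorem Iso.mk_surjective (x : Iso Z v w) : ∃ f, Iso.mk f = x := Quot.exists_rep x

/-- The inclusion of `Prim_m(v, w)` in `Prim(v, w)`. -/
def PrimM.incl (x : PrimM Z v w m) : Prim Z v w :=
  Quot.lift (fun E => Prim.mk E) (fun _ _ h => Prim.mk_eq_mk.2 h) x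

/-- Both sets use the same relation, isometries of the ambient forms, so statements for fixed $m$
can be deduced from those for varying $m$. -/
theorem PrimM.incl_injective :
    Function.Injective (PrimM.incl : PrimM Z v w m → Prim Z v w) := by
  intro x y h
  obtain ⟨E, rfl⟩ := x.mk_surjective
  obtain ⟨E', rfl⟩ := y.mk_surjective
  exact PrimM.mk_eq_mk.2 (Prim.mk_eq_mk.1 h)

theorem TwoSided.Isomorphic.comp (hZ : StarInvariant Z) {E : TwoSided Z v w m₀}
    {E' : TwoSided Z v w m₁} (h : E.Isomorphic E') (g : Isometry Z v v) (g' : Isometry Z w w) :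
    (E.comp hZ (Isometry.refl Z m₀) g g').Isomorphic (E'.comp hZ (Isometry.refl Z m₁) g g') := by
  obtain ⟨k, h1, h2⟩ := h
  exact ⟨k, fun x => h1 _, fun x => h2 _⟩

theorem PrimM.rel_iff (hZ : StarInvariant Z) (s : Side) (x y : PrimM Z v w m) :
    PrimM.Rel s x y ↔ Prim.Rel s x.incl y.incl := by
  constructor
  · rintro ⟨E, E', g, h, hs, rfl, rfl, h1, h2⟩
    exact ⟨m, E, E', g, h, hs, rfl, rfl, h1, h2⟩
  · rintro ⟨m', E, E', g, h, hs, hx, hy, h1, h2⟩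
    obtain ⟨A, rfl⟩ := x.mk_surjective
    -- The pair $(g,h)$ is kept, but it now acts on a representative in $m$ itself; the given ones
    -- lie in some isometric $m'$.
    refine ⟨A, A.comp hZ (Isometry.refl Z m) g h, g, h, hs, rfl, PrimM.incl_injective ?_, rfl, rfl⟩
    have e1 : A.Isomorphic E := Prim.mk_eq_mk.1 hx
    have e2 : (E.comp hZ (Isometry.refl Z m') g h).Isomorphic E' :=
      TwoSided.isomorphic_of_eq h1.symm h2.symm
    exact hy.trans (Prim.mk_eq_mk.2 ((e1.comp hZ g h).trans e2).symm)

/-- The 2-sided primitive embedding `(j, -j')`. -/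
abbrev TwoSided.twist (hZ : StarInvariant Z) (E : TwoSided Z v w m) : TwoSided Z v w m :=
  E.comp hZ (Isometry.refl Z m) (Isometry.refl Z v) (Isometry.minus Z w)

theorem TwoSided.twist_twist (hZ : StarInvariant Z) (E : TwoSided Z v w m) :
    ((E.twist hZ).twist hZ).Isomorphic E :=
  TwoSided.isomorphic_of_eq rfl (LinearMap.ext fun x => congrArg E.j' (neg_neg x))

/-- The map `[(j, j')] ↦ [(j, -j')]`. -/
def Prim.twist (hZ : StarInvariant Z) : Prim Z v w → Prim Z v w :=
  Quot.lift (fun E => Prim.mk (E.2.twist hZ)) fun _ _ h =>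
    Prim.mk_eq_mk.2 (h.comp hZ (Isometry.refl Z v) (Isometry.minus Z w))

/-- The map `[(j, j')] ↦ [(j, -j')]`. -/
def PrimM.twist (hZ : StarInvariant Z) : PrimM Z v w m → PrimM Z v w m :=
  Quot.lift (fun E => PrimM.mk (E.twist hZ)) fun _ _ h =>
    PrimM.mk_eq_mk.2 (h.comp hZ (Isometry.refl Z v) (Isometry.minus Z w))

/-- If $\operatorname{Aut}(w)$ is divided out, $-1$ on $w$ realises the sign change. For
$\operatorname{Aut}(v)$ alone, $-1$ on $v$ gives $(-j,j')$, which $-1$ on the ambient form carries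
to $(j,-j')$. -/
theorem Prim.rel_twist (hZ : StarInvariant Z) (s : Side) (x : Prim Z v w) :
    Prim.Rel s x (x.twist hZ) := by
  obtain ⟨m, E, rfl⟩ := x.mk_surjective
  have key : ∀ g h, s.Allows g h → (E.comp hZ (Isometry.refl Z m) g h).Isomorphic (E.twist hZ) →
      Prim.Rel s (Prim.mk E) ((Prim.mk E).twist hZ) := fun g h hs hE =>
    ⟨m, E, E.comp hZ (Isometry.refl Z m) g h, g, h, hs, rfl, (Prim.mk_eq_mk.2 hE).symm, rfl, rfl⟩
  cases s with
  | left =>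
    refine key (Isometry.minus Z v) (Isometry.refl Z w) rfl
      ⟨Isometry.minus Z m, fun x => ?_, fun x => ?_⟩
    · change -E.j (-x) = E.j x
      rw [map_neg, neg_neg]
    · exact (map_neg E.j' x).symm
  | right => exact key (Isometry.refl Z v) (Isometry.minus Z w) rfl (TwoSided.Isomorphic.refl _)
  | both => exact key (Isometry.refl Z v) (Isometry.minus Z w) trivial (TwoSided.Isomorphic.refl _)

theorem PrimM.incl_twist (hZ : StarInvariant Z) (x : PrimM Z v w m) :
    (x.twist hZ).incl = x.incl.twist hZ := by
  obtain ⟨E, rfl⟩ := x.mk_surjective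
  rfl

end Classes

variable {v v' m : QForm R ε}

/-! ### Compatibility of the union with the isometry groups. -/

section Action

variable {P P' : BMod R}

theorem isIso_act {f : StTriple v v' P P'} (hf : f.IsIso Z) (g : Isometry Z v v)
    (h : Isometry Z v' v') : (act g h f).IsIso Z :=
  ((Triple.isIso_bdry h).sum Triple.isIso_id).comp
    (hf.comp ((Triple.isIso_bdry g.symm).sum Triple.isIso_id))

theorem compS_act (f : StTriple v v' P P') (g : Isometry Z v v) (h : Isometry Z v' v') :
    compS (act g h f) = Q.pull (dualMap h.e.toLinearMap) (compS f) := by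
  have e1 : (Triple.bdry h.e).push = 0 := map_zero _
  have e2 : (Triple.bdry (v := v) (w := v) g.e.symm).push = 0 := map_zero _
  rw [compS_eq, compS_eq, act, Triple.push_comp, Triple.push_comp, Triple.push_sum,
    Triple.push_sum, push_id, push_id, e1, e2]
  simp only [map_zero, zero_add, add_zero, Q.pull_pull]
  rfl

/-- Under the action $a$, $b$, $s$ become $hag^{-1}$, $gbh^{-1}$, $hsh^*$, so $g^{-1}\oplus h^*$ is
an isometry of the unions. -/
theorem prEmb_act (hZ : StarInvariant Z) (f : StTriple v v' P P') (hf : f.IsIso Z)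
    (g : Isometry Z v v) (h : Isometry Z v' v') (hgf : (act g h f).IsIso Z) :
    (prEmb hZ ⟨P, P', act g h f, hgf⟩).Isomorphic
      ((prEmb hZ ⟨P, P', f, hf⟩).comp hZ (Isometry.refl Z _) g h.neg) := by
  let k : (v.M × CDual R v'.M) ≃ₗ[R] (v.M × CDual R v'.M) :=
    LinearEquiv.prodCongr g.e.symm (dualEquiv h.e)
  have hk : ∀ x ξ, k (x, ξ) = (g.e.symm x, dualEquiv h.e ξ) := fun _ _ => rfl
  let K : Isometry Z (union (act g h f)) (union f) :=
    { e := k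
      simple := g.simple.symm.prod (h.simple.dual hZ)
      isometric := by
        refine Q.prod_ext ?_ ?_ fun x ξ => ?_
        · refine Eq.trans ?_ (pull_unionInl _).symm
          rw [← g.symm.isometric, Q.pull_pull, ← pull_unionInl f, Q.pull_pull]
          exact Q.pull_congr (fun x => Prod.ext rfl (map_zero (dualEquiv h.e))) _
        · rw [pull_inr_union, compS_act, ← map_neg, ← pull_inr_union, Q.pull_pull, Q.pull_pull]
          refine Q.pull_congr (fun ξ => ?_) _
          exact (hk 0 ξ).trans (Prod.ext (map_zero g.e.symm) rfl)
        · refine Eq.trans ?_ (union_symm_apply (act g h f) x 0 0 ξ).symm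
          refine (Q.symm_pull _ _ _ _).trans ?_
          change (union f).symm (k (x, 0)) (k (0, ξ)) = _
          rw [hk, hk]
          refine (union_symm_apply f _ _ _ _).trans ?_
          have e1 : ξ (compA (act g h f) x) = dualEquiv h.e ξ (compA f (g.e.symm x)) := rfl
          have e2 : (Q.symm (compS f) 0) (dualEquiv h.e ξ) = 0 := by rw [map_zero]; rfl
          have e3 : (Q.symm (compS (act g h f)) 0) ξ = 0 := by rw [map_zero]; rfl
          rw [e1, map_zero (dualEquiv h.e), map_zero g.e.symm, e2, e3, map_zero (v.symm x),
            map_zero (v.symm _)]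
          rfl }
  refine ⟨K, fun x => Prod.ext rfl (map_zero (dualEquiv h.e)), fun y => Prod.ext ?_
    (CDual.ext fun u => ?_)⟩
  · exact g.e.symm_apply_apply (compB f (h.e.symm y))
  · change -v'.symm y (h.e u) = -v'.symm (h.e.symm y) u
    rw [← h.symm_apply (h.e.symm y) u, LinearEquiv.apply_symm_apply]

end Action

/-- The map `Pr : Iso(∂v, ∂v') → Prim(v, -v')`. -/
def pr (hZ : StarInvariant Z) : Iso Z v v' → Prim Z v v'.neg :=
  Quot.lift (fun f => Prim.mk (prEmb hZ f)) fun _ _ h =>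
    Prim.mk_eq_mk.2 ((stablyHomotopic_iff hZ).1 h)

/-- The isometry from the union to $m$ is compatible with $j$ but reverses the sign of $j'$. -/
theorem pr_delta (hZ : StarInvariant Z) (E : TwoSided Z v v'.neg m)
    {ψ : m.M →ₗ[R] CDual R m.M} (S : Splitting m E.j E.perpIncl) (hψ : Q.mk ψ = m.form) :
    pr hZ (Iso.mk ⟨_, _, E.delta ψ S, E.isIso_delta S hZ hψ⟩) = (Prim.mk E).twist hZ := by
  obtain ⟨k, h1, h2⟩ := E.exists_isometry_delta S hZ hψ
  exact Prim.mk_eq_mk.2 ⟨k, h1, fun y => (h2 y).trans (map_neg E.j' y).symm⟩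

theorem pr_bijective (hZ : StarInvariant Z) :
    Function.Bijective (pr hZ : Iso Z v v' → Prim Z v v'.neg) := by
  constructor
  · intro x y h
    obtain ⟨f, rfl⟩ := x.mk_surjective
    obtain ⟨f', rfl⟩ := y.mk_surjective
    exact Quot.sound ((stablyHomotopic_iff hZ).2 (Prim.mk_eq_mk.1 h))
  · intro y
    obtain ⟨m, E, rfl⟩ := y.mk_surjective
    obtain ⟨ψ, hψ⟩ := Q.mk_surjective m.form
    obtain ⟨S⟩ := (E.twist hZ).nonempty_splitting hZ
    -- Applying $\delta$ to $(j,-j')$ compensates for the sign.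
    exact ⟨_, (pr_delta hZ (E.twist hZ) S hψ).trans (Prim.mk_eq_mk.2 (E.twist_twist hZ))⟩

/-- Forwards this is equivariance. Backwards, the same pair of isometries is applied to a
representative of $x$, and injectivity of $\operatorname{Pr}$ identifies the result with $y$. -/
theorem pr_rel_iff (hZ : StarInvariant Z) (s : Side) (x y : Iso Z v v') :
    Iso.Rel s x y ↔ Prim.Rel s (pr hZ x) (pr hZ y) := by
  constructor
  · rintro ⟨P, P', f, hf, g, h, hgf, hs, rfl, rfl⟩
    refine ⟨_, _, _, g, h.neg, ?_, rfl, Prim.mk_eq_mk.2 (prEmb_act hZ f hf g h hgf), rfl, rfl⟩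
    cases s <;> exact hs
  · rintro ⟨m, E, E', g, h, hs, hx, hy, h1, h2⟩
    obtain ⟨⟨P, P', f, hf⟩, rfl⟩ := x.mk_surjective
    have hgf := isIso_act hf g h.ofNeg
    refine ⟨P, P', f, hf, g, h.ofNeg, hgf, ?_, rfl, (pr_bijective hZ).1 (hy.trans ?_)⟩
    · cases s <;> exact hs
    · have e1 : (prEmb hZ ⟨P, P', f, hf⟩).Isomorphic E := Prim.mk_eq_mk.1 hx
      have e2 : (E.comp hZ (Isometry.refl Z m) g h).Isomorphic E' :=
        TwoSided.isomorphic_of_eq h1.symm h2.symm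
      exact (Prim.mk_eq_mk.2
        ((prEmb_act hZ f hf g h.ofNeg hgf).trans ((e1.comp hZ g h).trans e2))).symm

/-- The map `Pr : Iso_m(∂v, ∂v') → Prim_m(v, -v')`. -/
def prM (hZ : StarInvariant Z) (x : IsoM Z v v' m) : PrimM Z v v'.neg m :=
  PrimM.mk ((prEmb hZ x.2.choose).map hZ x.2.choose_spec.2.some)

/-- Shows that the representative and the isometry chosen in `prM` do not matter: the result is
determined by the class. -/
theorem incl_prM (hZ : StarInvariant Z) (x : IsoM Z v v' m) : (prM hZ x).incl = pr hZ x.1 :=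
  (Prim.mk_eq_mk.2 (TwoSided.isomorphic_map hZ _ _).symm).trans
    (congrArg (pr hZ) x.2.choose_spec.1).symm

theorem prM_mk (hZ : StarInvariant Z) (f : StableIso Z v v') (k : Isometry Z (union f.f) m) :
    prM hZ (IsoM.mk f k) = PrimM.mk ((prEmb hZ f).map hZ k) :=
  PrimM.incl_injective ((incl_prM hZ _).trans
    (Prim.mk_eq_mk.2 (TwoSided.isomorphic_map hZ _ _)))

theorem prM_bijective (hZ : StarInvariant Z) :
    Function.Bijective (prM hZ : IsoM Z v v' m → PrimM Z v v'.neg m) := by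
  constructor
  · intro x y h
    refine Subtype.ext ((pr_bijective hZ).1 ?_)
    rw [← incl_prM, h, incl_prM]
  · intro y
    obtain ⟨E, rfl⟩ := y.mk_surjective
    obtain ⟨x, hx⟩ := (pr_bijective hZ).2 (Prim.mk E)
    obtain ⟨f, rfl⟩ := x.mk_surjective
    obtain ⟨k, -⟩ := id (Prim.mk_eq_mk.1 hx)
    exact ⟨IsoM.mk f k, PrimM.incl_injective ((incl_prM hZ _).trans hx)⟩

/-- A bijection `e` that respects two relations and a map `e⁻¹ ∘ τ`, where `τ` is the identity on
classes, descend to mutually inverse bijections of the quotients. -/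
theorem exists_quot_bijections {α β : Type*} {ra : α → α → Prop} {rb : β → β → Prop} (e : α ≃ β)
    (h : ∀ x y, ra x y ↔ rb (e x) (e y)) {τ : β → β} (hτ : ∀ y, rb y (τ y)) :
    ∃ (F : Quot ra → Quot rb) (G : Quot rb → Quot ra),
      (∀ x, F (Quot.mk _ x) = Quot.mk _ (e x)) ∧
      (∀ y, G (Quot.mk _ y) = Quot.mk _ (e.symm (τ y))) ∧
      Function.Bijective F ∧ Function.LeftInverse G F ∧ Function.RightInverse G F := by
  let F := Quot.congr e h
  refine ⟨F, F.symm, fun _ => rfl, fun y => ?_, F.bijective, F.left_inv, F.right_inv⟩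
  -- As $y$ and $\tau y$ have the same class, the inverse of $F$ may be computed on $\tau y$.
  rw [Quot.sound (hτ y)]
  rfl

end Bijections

end PrimEmb

end

theorem theorem6p8 {R : Type u} [Ring R] [StarRing R] [IsStablyFiniteRing R] (ε : ℤˣ)
    (Z : AddSubgroup (RedK1 R)) (hZ : StarInvariant Z) (v v' : QForm R ε) :
    (∀ m : QForm R ε, m.Nonsingular →
      ∃ (Pr : IsoM Z v v' m → PrimM Z v v'.neg m) (δ : PrimM Z v v'.neg m → IsoM Z v v' m),
        IsPrM Pr ∧ IsDeltaM δ ∧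
        ∀ s : Side, ∃ (Prs : SIsoM s Z v v' m → SPrimM s Z v v'.neg m)
            (δs : SPrimM s Z v v'.neg m → SIsoM s Z v v' m),
          (∀ x : IsoM Z v v' m, Prs (Quot.mk _ x) = Quot.mk _ (Pr x)) ∧
          (∀ y : PrimM Z v v'.neg m, δs (Quot.mk _ y) = Quot.mk _ (δ y)) ∧
          Function.Bijective Prs ∧
          Function.LeftInverse δs Prs ∧ Function.RightInverse δs Prs) ∧
    (∃ (Pr : Iso Z v v' → Prim Z v v'.neg) (δ : Prim Z v v'.neg → Iso Z v v'),
        IsPr Pr ∧ IsDelta δ ∧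
        ∀ s : Side, ∃ (Prs : SIso s Z v v' → SPrim s Z v v'.neg)
            (δs : SPrim s Z v v'.neg → SIso s Z v v'),
          (∀ x : Iso Z v v', Prs (Quot.mk _ x) = Quot.mk _ (Pr x)) ∧
          (∀ y : Prim Z v v'.neg, δs (Quot.mk _ y) = Quot.mk _ (δ y)) ∧
          Function.Bijective Prs ∧
          Function.LeftInverse δs Prs ∧ Function.RightInverse δs Prs) := by
  refine ⟨fun m _ => ?_, ?_⟩
  · let e : IsoM Z v v' m ≃ PrimM Z v v'.neg m := Equiv.ofBijective _ (prM_bijective hZ)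
    have he : ∀ x, e x = prM hZ x := fun _ => rfl
    -- `pr_delta` forces this choice of $\delta$: the inverse of $\operatorname{Pr}$ after the sign
    -- change of $j'$.
    refine ⟨e, fun y => e.symm (y.twist hZ), fun f k => ?_, fun E ψ S hψ => ?_, fun s => ?_⟩
    · exact ⟨(prEmb hZ f).map hZ k, rfl, rfl, prM_mk hZ f k⟩
    -- Injectivity of $\operatorname{Pr}$ reduces the formula, for every $\psi$ and $\sigma$ at
    -- once, to a comparison of embeddings.
    · refine ⟨E.isIso_delta S hZ hψ, (pr_bijective hZ).1 ?_⟩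
      rw [pr_delta hZ E S hψ, ← incl_prM, ← he, Equiv.apply_symm_apply, PrimM.incl_twist]
      rfl
    · refine exists_quot_bijections e (fun x y => ?_) fun y => (PrimM.rel_iff hZ s _ _).2 ?_
      · rw [PrimM.rel_iff hZ, he, he, incl_prM, incl_prM]
        exact pr_rel_iff hZ s _ _
      · rw [PrimM.incl_twist]
        exact Prim.rel_twist hZ s _
  · let e : Iso Z v v' ≃ Prim Z v v'.neg := Equiv.ofBijective _ (pr_bijective hZ)
    refine ⟨e, fun y => e.symm (y.twist hZ), fun f => ?_, fun m E ψ S hψ => ?_, fun s => ?_⟩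
    · exact ⟨prEmb hZ f, rfl, rfl, rfl⟩
    · refine ⟨E.isIso_delta S hZ hψ, e.symm_apply_eq.2 ?_⟩
      exact (pr_delta hZ E S hψ).symm
    · exact exists_quot_bijections e (pr_rel_iff hZ s) (Prim.rel_twist hZ s)
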